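/- \textbf{Conventions.} Let $k$ be a field and $G$ a group with unit $e$. A \emph{multitensor category} is a locally finite $k$-linear abelian rigid monoidal category with bilinear tensor product. A \emph{$G$-crossed multitensor category} is a multitensor category $\mathcal C$ with a pivotal structure $\delta$ (a monoidal isomorphism $\mathrm{id}\cong(-)^{\vee\vee}$), a grading $\mathcal C=\bigoplus_{g\in G}\mathcal C_g$ with $\mathcal C_g\otimes\mathcal C_h\subset\mathcal C_{gh}$, and a monoidal action $\gamma$ of $G$ on $\mathcal C$ by pivotal tensor autoequivalences, written ${}^gX=\gamma(g)(X)$, with ${}^g(\mathcal C_h)\subset\mathcal C_{ghg^{-1}}$. It is \emph{$G$-braided} if it has natural isomorphisms $b_{X,Y}:X\otimes Y\to{}^gY\otimes X$ for $g\in G$, $X\in\mathcal C_g$, $Y\in\mathcal C$, which are preserved by the action and satisfy the two $G$-crossed hexagon identities (multiplicativity in $X$ and in $Y$). Canonical isomorphisms such as ${}^g({}^hX)\cong{}^{gh}X$, ${}^eX\cong X$, ${}^gX\otimes{}^gY\cong{}^g(X\otimes Y)$ and the associators are suppressed below. A \emph{$G$-crossed (tensor) functor} $F:\mathcal C\to\mathcal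 D$ between $G$-crossed multitensor categories is an exact faithful $k$-linear monoidal functor with monoidal natural isomorphisms $\tilde\eta_g:F({}^gX)\cong{}^gF(X)$ satisfying $\tilde\eta_e=\mathrm{id}$ and $\tilde\eta_{gh}={}^g(\tilde\eta_h)\circ\tilde\eta_g$, such that $F(\mathcal C_g)\subset\mathcal D_g$ for all $g$ and $F$ preserves the pivotal structures. A \emph{$G$-equivariant Frobenius algebra} in $\mathcal C$ is a Frobenius algebra $(A,m,\eta,\Delta,\varepsilon)$ with isomorphisms $z_g:{}^gA\cong A$ of algebras and coalgebras such that $z_{gh}=z_g\circ{}^gz_h$. It is \emph{neutral} if $A\in\mathcal C_e$, \emph{special} if $m\circ\Delta$ and $\varepsilon\circ\eta$ are nonzero scalar multiples (in $k$) of identities, and \emph{symmetric} if $\delta_A=\mathrm{id}_A$ when $A$ is identified with its dual through the Frobenius form $\varepsilon\circ m$. \textbf{Proposition.} Let $\mathcal C$ be a $G$-braided multitensor category and let $A$ be a neutral special symmetric $G$-equivariant Frobenius algebra in $\mathcal C$. The category $\mathrm{Bimod}_{\mathcal C}(A)$ of $A$-bimodules with the relative tensor product $\otimes_A$ and unit $A$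 is a $G$-crossed multitensor category with the following structure: a bimodule has degree $g$ iff its underlying object lies in $\mathcal C_g$; ${}^gM$ is the object ${}^gM$ with the actions ${}^g(m^L)\circ(z_g^{-1}\otimes\mathrm{id})$ and ${}^g(m^R)\circ(\mathrm{id}\otimes z_g^{-1})$, the tensor structure ${}^gM\otimes_A{}^gN\cong{}^g(M\otimes_AN)$ is induced by that of $\gamma(g)$, its unit part is $z_g^{-1}:A\to{}^gA$, and the isomorphisms ${}^g({}^hM)\cong{}^{gh}M$ and $M\cong{}^eM$ are those of $\mathcal C$; the pivotal structure is that of $\mathcal C$, where the object underlying the dual bimodule $M^\vee$ is identified with the dual of the object $M$ through the pairing $M^\vee\otimes M\to M^\vee\otimes_AM\xrightarrow{\mathrm{ev}}A\xrightarrow{\varepsilon}\mathbf 1$. For $\lambda\in\mathcal C$ with homogeneous components $\lambda_g$, inclusions $i_g:\lambda_g\to\lambda$ and projections $p_g:\lambda\to\lambda_g$, put $$s^+_\lambda=\sum_{g}(z_g\otimes i_g)\circ b_{\lambda_g,A}\circ(p_g\otimes\mathrm{id}_A),\qquad s^-_\lambda=(b_{A,\lambda})^{-1}\ :\ \lambda\otimes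 A\to A\otimes\lambda .$$ Then $A\otimes\lambda$ with left action $m\otimes\mathrm{id}_\lambda$ and right action $m^{R\pm}_{A\lambda}=(m\otimes\mathrm{id}_\lambda)\circ(\mathrm{id}_A\otimes s^\pm_\lambda)$ is an $A$-bimodule $\alpha^{G\pm}_A(\lambda)$, and both functors $$\alpha_A^{G\pm}:\mathcal C\to\mathrm{Bimod}_{\mathcal C}(A),\qquad \lambda\mapsto\alpha^{G\pm}_A(\lambda),\quad f\mapsto\mathrm{id}_A\otimes f,$$ are $G$-crossed tensor functors. Here the tensor structure $\alpha^{G\pm}_A(\lambda)\otimes_A\alpha^{G\pm}_A(\mu)\cong\alpha^{G\pm}_A(\lambda\otimes\mu)$ is the one induced by $m^{R\pm}_{A\lambda}\otimes\mathrm{id}_\mu$, its unit part is $A\cong A\otimes\mathbf 1$, and $\tilde\eta_g:\alpha^{G\pm}_A({}^g\lambda)\cong{}^g\alpha^{G\pm}_A(\lambda)$ is $z_g^{-1}\otimes\mathrm{id}:A\otimes{}^g\lambda\to{}^gA\otimes{}^g\lambda\cong{}^g(A\otimes\lambda)$. -/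

import Mathlib

open CategoryTheory MonoidalCategory Limits

universe v u w

namespace EquivariantTensor

/-! ### Multitensor categories -/

/-- A multitensor category over a field `k`: a locally finite (finite-dimensional morphism spaces,
every object of finite length) `k`-linear abelian rigid monoidal category whose tensor product is
bilinear on morphisms. -/
structure IsMultitensorCategory (k : Type w) [Field k] (D : Type u) [Category.{v} D]
    [Preadditive D] [Linear k D] [MonoidalCategory D] : Prop where
  abelian : ∃ h : Abelian D, h.toPreadditive = ‹Preadditive D›
  bilinear : ∃ _ : MonoidalPreadditive D, MonoidalLinear k D
  rigid : Nonempty (RigidCategory D)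
  finite_hom : ∀ X Y : D, Module.Finite k (X ⟶ Y)
  finite_length : ∀ X : D, IsNoetherianObject X ∧ IsArtinianObject X

/-! ### Pivotal structures

Mathlib's `Xᘁ` comes with an evaluation `ε_ X Xᘁ : Xᘁ ⊗ X ⟶ 𝟙_` and a coevaluation
`η_ X Xᘁ : 𝟙_ ⟶ X ⊗ Xᘁ`; it is the object often called the left dual of `X` and written `X^∨`. -/

section Pivotal

variable {D : Type u} [Category.{v} D] [MonoidalCategory D]

/-- The morphism `Y ⟶ X^∨` which corresponds to a pairing `e : Y ⊗ X ⟶ 𝟙`. It is an isomorphism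
iff `e` is the evaluation of a duality, and is then the canonical isomorphism between duals. -/
def toDual {X Y : D} [HasRightDual X] (e : Y ⊗ X ⟶ 𝟙_ D) : Y ⟶ Xᘁ :=
  (ρ_ Y).inv ≫ Y ◁ η_ X Xᘁ ≫ (α_ Y X Xᘁ).inv ≫ e ▷ Xᘁ ≫ (λ_ Xᘁ).hom

/-- For pairings `e` of `Y` with `X` and `e'` of `Z` with `Y`, this says that the square
formed by `f : X ⟶ Z`, by `d : X ⟶ X^∨^∨` and by the morphisms `Z ⟶ Y^∨` and `X^∨^∨ ⟶ Y^∨`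
induced by `e'` and `e` commutes. When `Y` is a dual of `X` through `e` and `Z` is a dual
of `Y` through `e'`, it says that `f` is `d` under the canonical identification of
`Z` with `X^∨^∨`. -/
def Realizes {X Y Z : D} [RigidCategory D] (d : X ⟶ (Xᘁ)ᘁ) (e : Y ⊗ X ⟶ 𝟙_ D)
    (e' : Z ⊗ Y ⟶ 𝟙_ D) (f : X ⟶ Z) : Prop :=
  f ≫ toDual e' = d ≫ (toDual e)ᘁ

variable (D) in
/-- A pivotal structure: a monoidal natural isomorphism from the identity to the double dual. -/
structure PivotalStructure [RigidCategory D] where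
  iso : ∀ X : D, X ≅ (Xᘁ)ᘁ
  naturality : ∀ {X Y : D} (f : X ⟶ Y), f ≫ (iso Y).hom = (iso X).hom ≫ (fᘁ)ᘁ
  monoidal : ∀ X Y : D,
    Realizes (iso (X ⊗ Y)).hom (ε_ (X ⊗ Y) (Yᘁ ⊗ Xᘁ)) (ε_ (Yᘁ ⊗ Xᘁ) ((Xᘁ)ᘁ ⊗ (Yᘁ)ᘁ))
      ((iso X).hom ⊗ₘ (iso Y).hom)

variable {E : Type*} [Category* E] [MonoidalCategory E]

/-- The pairing of `F(X^∨)` with `F(X)` which makes `F(X^∨)` a dual of `F(X)`. -/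
def mapEvaluation [RigidCategory D] (F : D ⥤ E) [F.Monoidal] (X : D) :
    F.obj (Xᘁ) ⊗ F.obj X ⟶ 𝟙_ E :=
  Functor.LaxMonoidal.μ F (Xᘁ) X ≫ F.map (ε_ X (Xᘁ)) ≫ Functor.OplaxMonoidal.η F

/-- A monoidal functor is pivotal if it sends the pivotal structure to the pivotal structure, where
`F(X^∨^∨)` is identified with `F(X)^∨^∨` canonically. -/
def IsPivotalFunctor [RigidCategory D] [RigidCategory E] (δ : PivotalStructure D)
    (δ' : PivotalStructure E) (F : D ⥤ E) [F.Monoidal] : Prop :=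
  ∀ X : D, Realizes (δ'.iso (F.obj X)).hom (mapEvaluation F X) (mapEvaluation F (Xᘁ))
    (F.map (δ.iso X).hom)

end Pivotal

/-! ### Group actions, gradings, crossed structures and braidings -/

section Crossed

variable {G : Type*} [Group G] {D : Type u} [Category.{v} D] [MonoidalCategory D]

/-- An action of a group `G` on a monoidal category `D` whose underlying functors are `γ g`,
i.e. the structure of a monoidal functor from `G` to the monoidal endofunctors of `D`.
The isomorphisms `γ(g) γ(h) ≅ γ(gh)` are indexed by triples `(g, h, k)` with `gh = k`, so that no
transport along equations in `G` is needed. -/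
class MonoidalAction (γ : G → D ⥤ D) where
  [monoidal : ∀ g, (γ g).Monoidal]
  comp : ∀ {g h k : G}, g * h = k → (γ h ⋙ γ g ≅ γ k)
  one : 𝟭 D ≅ γ 1
  comp_isMonoidal : ∀ {g h k : G} (e : g * h = k), NatTrans.IsMonoidal (comp e).hom
  one_isMonoidal : NatTrans.IsMonoidal one.hom
  comp_assoc : ∀ {a b c ab bc abc : G} (e₁ : a * b = ab) (e₂ : b * c = bc) (e₃ : ab * c = abc)
    (e₄ : a * bc = abc) (X : D),
    (γ a).map ((comp e₂).hom.app X) ≫ (comp e₄).hom.app X =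
      (comp e₁).hom.app ((γ c).obj X) ≫ (comp e₃).hom.app X
  one_comp : ∀ (g : G) (X : D),
    one.hom.app ((γ g).obj X) ≫ (comp (one_mul g)).hom.app X = 𝟙 ((γ g).obj X)
  comp_one : ∀ (g : G) (X : D),
    (γ g).map (one.hom.app X) ≫ (comp (mul_one g)).hom.app X = 𝟙 ((γ g).obj X)

attribute [reducible, instance] MonoidalAction.monoidal

/-- The isomorphism `γ(g)(γ(h)(X)) ≅ γ(gh)(X)`. -/
abbrev actComp (γ : G → D ⥤ D) [MonoidalAction γ] {g h k : G} (e : g * h = k) (X : D) :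
    (γ g).obj ((γ h).obj X) ≅ (γ k).obj X :=
  (MonoidalAction.comp (γ := γ) e).app X

/-- The isomorphism `X ≅ γ(1)(X)`. -/
abbrev actOne (γ : G → D ⥤ D) [MonoidalAction γ] (X : D) : X ≅ (γ 1).obj X :=
  (MonoidalAction.one (γ := γ)).app X

variable [Preadditive D]

/-- A decomposition of an object into a finite direct sum of homogeneous objects. -/
structure HomogeneousDecomposition (P : G → ObjectProperty D) (X : D) where
  support : Finset G
  component : G → D
  homogeneous : ∀ g, P g (component g)
  ι : ∀ g, component g ⟶ X
  π : ∀ g, X ⟶ component g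
  ι_π_self : ∀ g, ι g ≫ π g = 𝟙 (component g)
  ι_π_ne : ∀ g h, g ≠ h → ι g ≫ π h = 0
  sum_π_ι : ∑ g ∈ support, π g ≫ ι g = 𝟙 X

/-- The full subcategories `P g` form a `G`-grading: `D` is their direct sum, and the tensor product
is compatible with the multiplication of `G`. The subcategories are taken to be closed under
isomorphisms; by the decomposition property they are then closed under finite direct sums,
subobjects and quotients, so that they are abelian. -/
structure IsGrading (P : G → ObjectProperty D) : Prop where
  iso_closed : ∀ (g : G) {X Y : D}, (X ≅ Y) → P g X → P g Y
  zero : ∀ (g : G) {X : D}, IsZero X → P g X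
  hom_eq_zero : ∀ {g h : G} {X Y : D}, g ≠ h → P g X → P h Y → ∀ f : X ⟶ Y, f = 0
  decomposition : ∀ X : D, Nonempty (HomogeneousDecomposition P X)
  tensor : ∀ {g h : G} {X Y : D}, P g X → P h Y → P (g * h) (X ⊗ Y)

/-- A `G`-crossed multitensor category over `k`: a pivotal `G`-graded multitensor category with a
pivotal action of `G` by tensor autoequivalences such that `γ(g)` maps `D_h` to `D_{ghg⁻¹}`. -/
structure IsGCrossed (k : Type w) [Field k] [Linear k D] [RigidCategory D]
    (γ : G → D ⥤ D) [MonoidalAction γ] (P : G → ObjectProperty D) (δ : PivotalStructure D) :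
    Prop where
  multitensor : IsMultitensorCategory k D
  grading : IsGrading P
  additive : ∀ g, (γ g).Additive
  linear : ∀ g, (γ g).Linear k
  pivotal : ∀ g, IsPivotalFunctor δ δ (γ g)
  conj : ∀ (g : G) {h : G} {X : D}, P h X → P (g * h * g⁻¹) ((γ g).obj X)

/-- A `G`-braiding: natural isomorphisms `X ⊗ Y ≅ γ(g)(Y) ⊗ X` for `X` in `D_g`, which are
equivariant and multiplicative in both variables. -/
structure GBraiding (γ : G → D ⥤ D) [MonoidalAction γ] (P : G → ObjectProperty D) where
  iso : ∀ {g : G} {X : D} (_ : P g X) (Y : D), X ⊗ Y ≅ (γ g).obj Y ⊗ X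
  naturality_left : ∀ {g : G} {X X' : D} (hX : P g X) (hX' : P g X') (f : X ⟶ X') (Y : D),
    f ▷ Y ≫ (iso hX' Y).hom = (iso hX Y).hom ≫ (γ g).obj Y ◁ f
  naturality_right : ∀ {g : G} {X : D} (hX : P g X) {Y Y' : D} (f : Y ⟶ Y'),
    X ◁ f ≫ (iso hX Y').hom = (iso hX Y).hom ≫ (γ g).map f ▷ X
  equivariant : ∀ {g h k : G} (e : k * h = h * g) {X : D} (hX : P g X)
    (hX' : P k ((γ h).obj X)) (Y : D),
    Functor.LaxMonoidal.μ (γ h) X Y ≫ (γ h).map (iso hX Y).hom ≫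
        Functor.OplaxMonoidal.δ (γ h) ((γ g).obj Y) X ≫
          (actComp γ rfl Y).hom ▷ (γ h).obj X =
      (iso hX' ((γ h).obj Y)).hom ≫ (actComp γ e Y).hom ▷ (γ h).obj X
  tensor_left : ∀ {g h : G} {X Y : D} (hX : P g X) (hY : P h Y) (hXY : P (g * h) (X ⊗ Y)) (Z : D),
    (iso hXY Z).hom =
      (α_ X Y Z).hom ≫ X ◁ (iso hY Z).hom ≫ (α_ X ((γ h).obj Z) Y).inv ≫
        (iso hX ((γ h).obj Z)).hom ▷ Y ≫ ((actComp γ rfl Z).hom ▷ X) ▷ Y ≫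
          (α_ ((γ (g * h)).obj Z) X Y).hom
  tensor_right : ∀ {g : G} {X : D} (hX : P g X) (Y Z : D),
    (iso hX (Y ⊗ Z)).hom =
      (α_ X Y Z).inv ≫ (iso hX Y).hom ▷ Z ≫ (α_ ((γ g).obj Y) X Z).hom ≫
        (γ g).obj Y ◁ (iso hX Z).hom ≫ (α_ ((γ g).obj Y) ((γ g).obj Z) X).inv ≫
          Functor.LaxMonoidal.μ (γ g) Y Z ▷ X

/-- The dashed crossing labelled by `g`: the `G`-braiding of the component of `X` of degree `g`
with `Y`, as a morphism `X ⊗ Y ⟶ γ(g)(Y) ⊗ X`. It does not depend on the decomposition. -/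
noncomputable def dashedCrossing {γ : G → D ⥤ D} [MonoidalAction γ] {P : G → ObjectProperty D}
    (b : GBraiding γ P) {X : D} (d : HomogeneousDecomposition P X) (g : G) (Y : D) :
    X ⊗ Y ⟶ (γ g).obj Y ⊗ X :=
  d.π g ▷ Y ≫ (b.iso (d.homogeneous g) Y).hom ≫ (γ g).obj Y ◁ d.ι g

/-- `F`, with isomorphisms `η g : F γ(g) ≅ γ'(g) F`, is a `G`-crossed tensor functor: an exact
faithful `k`-linear monoidal functor, with monoidal isomorphisms `η g` which are compatible with the
actions, that preserves the gradings and the pivotal structures. -/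
structure IsGCrossedFunctor (k : Type w) [Field k] [Linear k D] [RigidCategory D]
    {E : Type*} [Category* E] [MonoidalCategory E] [Preadditive E] [Linear k E] [RigidCategory E]
    (γ : G → D ⥤ D) [MonoidalAction γ] (P : G → ObjectProperty D) (δ : PivotalStructure D)
    (γ' : G → E ⥤ E) [MonoidalAction γ'] (P' : G → ObjectProperty E) (δ' : PivotalStructure E)
    (F : D ⥤ E) [F.Monoidal] (η : ∀ g, γ g ⋙ F ≅ F ⋙ γ' g) : Prop where
  additive : F.Additive
  linear : F.Linear k
  left_exact : PreservesFiniteLimits F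
  right_exact : PreservesFiniteColimits F
  faithful : F.Faithful
  η_isMonoidal : ∀ g, NatTrans.IsMonoidal (η g).hom
  η_comp : ∀ {g h k : G} (e : g * h = k) (X : D),
    F.map (actComp γ e X).hom ≫ (η k).hom.app X =
      (η g).hom.app ((γ h).obj X) ≫ (γ' g).map ((η h).hom.app X) ≫ (actComp γ' e (F.obj X)).hom
  η_one : ∀ X : D,
    F.map (actOne γ X).hom ≫ (η 1).hom.app X = (actOne γ' (F.obj X)).hom
  graded : ∀ (g : G) (X : D), P g X → P' g (F.obj X)
  pivotal : IsPivotalFunctor δ δ' F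

end Crossed

/-! ### Equivariant algebras and Frobenius algebras -/

section Algebras

variable {G : Type*} [Group G] {C : Type u} [Category.{v} C] [MonoidalCategory C]

/-- A `G`-equivariant algebra: an algebra `A` with algebra isomorphisms `z g : γ(g)(A) ≅ A`
such that `z (gh) = z g ∘ γ(g)(z h)`. -/
structure EquivariantAlgebra (γ : G → C ⥤ C) [MonoidalAction γ] where
  alg : Mon C
  z : ∀ g, (γ g).obj alg.X ≅ alg.X
  mul_z : ∀ g, Functor.LaxMonoidal.μ (γ g) alg.X alg.X ≫ (γ g).map (MonObj.mul (X := alg.X)) ≫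
    (z g).hom = ((z g).hom ⊗ₘ (z g).hom) ≫ MonObj.mul (X := alg.X)
  one_z : ∀ g, Functor.LaxMonoidal.ε (γ g) ≫ (γ g).map (MonObj.one (X := alg.X)) ≫ (z g).hom =
    MonObj.one (X := alg.X)
  z_comp : ∀ {g h k : G} (e : g * h = k),
    (actComp γ e alg.X).hom ≫ (z k).hom = (γ g).map (z h).hom ≫ (z g).hom

/-- A `G`-equivariant Frobenius algebra: a `G`-equivariant algebra with a coalgebra structure which
satisfies the Frobenius relations and is preserved by the isomorphisms `z g`. -/
structure EquivariantFrobeniusAlgebra (γ : G → C ⥤ C) [MonoidalAction γ] extends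
    EquivariantAlgebra γ where
  coalg : ComonObj alg.X
  frobenius_left : alg.X ◁ ComonObj.comul (X := alg.X) ≫ (α_ alg.X alg.X alg.X).inv ≫
    MonObj.mul (X := alg.X) ▷ alg.X = MonObj.mul (X := alg.X) ≫ ComonObj.comul (X := alg.X)
  frobenius_right : ComonObj.comul (X := alg.X) ▷ alg.X ≫ (α_ alg.X alg.X alg.X).hom ≫
    alg.X ◁ MonObj.mul (X := alg.X) = MonObj.mul (X := alg.X) ≫ ComonObj.comul (X := alg.X)
  z_comul : ∀ g, (z g).hom ≫ ComonObj.comul (X := alg.X) =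
    (γ g).map (ComonObj.comul (X := alg.X)) ≫ Functor.OplaxMonoidal.δ (γ g) alg.X alg.X ≫
      ((z g).hom ⊗ₘ (z g).hom)
  z_counit : ∀ g, (z g).hom ≫ ComonObj.counit (X := alg.X) =
    (γ g).map (ComonObj.counit (X := alg.X)) ≫ Functor.OplaxMonoidal.η (γ g)

attribute [instance] EquivariantFrobeniusAlgebra.coalg

variable {γ : G → C ⥤ C} [MonoidalAction γ]

/-- The Frobenius form `A ⊗ A ⟶ 𝟙`, through which `A` is a dual of itself. -/
def EquivariantFrobeniusAlgebra.form (A : EquivariantFrobeniusAlgebra γ) :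
    A.alg.X ⊗ A.alg.X ⟶ 𝟙_ C :=
  MonObj.mul (X := A.alg.X) ≫ ComonObj.counit (X := A.alg.X)

/-- `A` is special: `m ∘ Δ` and `ε ∘ η` are invertible scalars. -/
def EquivariantFrobeniusAlgebra.IsSpecial (k : Type w) [Field k] [Preadditive C] [Linear k C]
    (A : EquivariantFrobeniusAlgebra γ) : Prop :=
  (∃ c : k, c ≠ 0 ∧
    ComonObj.comul (X := A.alg.X) ≫ MonObj.mul (X := A.alg.X) = c • 𝟙 A.alg.X) ∧
  ∃ c : k, c ≠ 0 ∧
    MonObj.one (X := A.alg.X) ≫ ComonObj.counit (X := A.alg.X) = c • 𝟙 (𝟙_ C)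

/-- `A` is symmetric: the pivotal structure of `A` is the identity when the dual of `A` is taken to
be `A`, through the Frobenius form. -/
def EquivariantFrobeniusAlgebra.IsSymmetric [RigidCategory C] (δ : PivotalStructure C)
    (A : EquivariantFrobeniusAlgebra γ) : Prop :=
  Realizes (δ.iso A.alg.X).hom A.form A.form (𝟙 A.alg.X)

end Algebras

/-! ### The category of bimodules -/

section Bimodules

variable {C : Type u} [Category.{v} C] [MonoidalCategory C]

section Linear

variable [Preadditive C] [MonoidalPreadditive C] {A B : Mon C}

instance (M N : Bimod A B) : Zero (M ⟶ N) where
  zero := { hom := 0 }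

instance (M N : Bimod A B) : Add (M ⟶ N) where
  add f g :=
    { hom := f.hom + g.hom
      left_act_hom := by simp
      right_act_hom := by simp }

instance (M N : Bimod A B) : Neg (M ⟶ N) where
  neg f :=
    { hom := -f.hom
      left_act_hom := by
        have h : A.X ◁ (-f.hom) = -(A.X ◁ f.hom) := (tensorLeft A.X).map_neg
        simp [h]
      right_act_hom := by
        have h : (-f.hom) ▷ B.X = -(f.hom ▷ B.X) := (tensorRight B.X).map_neg
        simp [h] }

@[simp] lemma bimod_zero_hom (M N : Bimod A B) : (0 : M ⟶ N).hom = 0 := rfl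
@[simp] lemma bimod_add_hom {M N : Bimod A B} (f g : M ⟶ N) : (f + g).hom = f.hom + g.hom := rfl
@[simp] lemma bimod_neg_hom {M N : Bimod A B} (f : M ⟶ N) : (-f).hom = -f.hom := rfl

instance (M N : Bimod A B) : AddCommGroup (M ⟶ N) where
  add_assoc f g h := by ext; simp [add_assoc]
  zero_add f := by ext; simp
  add_zero f := by ext; simp
  nsmul := nsmulRec
  zsmul := zsmulRec
  neg_add_cancel f := by ext; simp
  add_comm f g := by ext; simp [add_comm]

instance : Preadditive (Bimod A B) where
  add_comp _ _ _ f f' g := by ext; simp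
  comp_add _ _ _ f g g' := by ext; simp

variable {k : Type w} [Field k] [Linear k C] [MonoidalLinear k C]

instance (M N : Bimod A B) : SMul k (M ⟶ N) where
  smul c f :=
    { hom := c • f.hom
      left_act_hom := by simp
      right_act_hom := by simp }

@[simp] lemma bimod_smul_hom {M N : Bimod A B} (c : k) (f : M ⟶ N) :
    (c • f).hom = c • f.hom := rfl

instance (M N : Bimod A B) : Module k (M ⟶ N) where
  one_smul f := by ext; simp
  mul_smul c d f := by ext; simp [mul_smul]
  smul_zero c := by ext; simp
  smul_add c f g := by ext; simp
  add_smul c d f := by ext; simp [add_smul]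
  zero_smul f := by ext; simp

instance : Linear k (Bimod A B) where
  smul_comp _ _ _ c f g := by ext; simp
  comp_smul _ _ _ f c g := by ext; simp

end Linear

instance [RigidCategory C] (X : C) : PreservesColimitsOfSize.{0, 0} (tensorLeft X) :=
  (tensorLeftAdjunction (ᘁX) X).leftAdjoint_preservesColimits

instance [RigidCategory C] (X : C) : PreservesColimitsOfSize.{0, 0} (tensorRight X) :=
  (tensorRightAdjunction X (Xᘁ)).leftAdjoint_preservesColimits

variable [HasCoequalizers C] [RigidCategory C]

/-- The monoidal category of endomorphisms of `A` in Mathlib's bicategory of algebras and bimodules,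
used for the coherence laws in the next definition. -/
@[reducible]
noncomputable def bimodEndMonoidal (A : Mon C) : MonoidalCategory (Bimod A A) :=
  @instMonoidalCategoryHom (Mon C) Bimod.monBicategory A

/-- The monoidal category of `A`-bimodules: the product is the relative tensor product `M ⊗_A N`,
i.e. the coequalizer of the two actions `M ⊗ A ⊗ N ⇉ M ⊗ N`, and the unit is `A`. -/
noncomputable instance (A : Mon C) : MonoidalCategory (Bimod A A) where
  tensorObj M N := M.tensorBimod N
  whiskerLeft M _ _ f := Bimod.whiskerLeft M f
  whiskerRight f N := Bimod.whiskerRight f N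
  tensorUnit := Bimod.regular A
  associator M N L := Bimod.associatorBimod M N L
  leftUnitor M := Bimod.leftUnitorBimod M
  rightUnitor M := Bimod.rightUnitorBimod M
  tensorHom_comp_tensorHom f g h j :=
    (bimodEndMonoidal A).tensorHom_comp_tensorHom f g h j
  id_tensorHom_id M N := (bimodEndMonoidal A).id_tensorHom_id M N
  whiskerLeft_id M N := (bimodEndMonoidal A).whiskerLeft_id M N
  id_whiskerRight M N := (bimodEndMonoidal A).id_whiskerRight M N
  associator_naturality f g h := (bimodEndMonoidal A).associator_naturality f g h
  leftUnitor_naturality f := (bimodEndMonoidal A).leftUnitor_naturality f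
  rightUnitor_naturality f := (bimodEndMonoidal A).rightUnitor_naturality f
  pentagon M N L K := (bimodEndMonoidal A).pentagon M N L K
  triangle M N := (bimodEndMonoidal A).triangle M N

/-- The canonical projection `M ⊗ N ⟶ M ⊗_A N`. -/
noncomputable def bimodProj {A : Mon C} (M N : Bimod A A) : M.X ⊗ N.X ⟶ (M ⊗ N).X :=
  coequalizer.π (M.actRight ▷ N.X) ((α_ M.X A.X N.X).hom ≫ M.X ◁ N.actLeft)

end Bimodules


/-! ### The action and the grading on the category of bimodules -/

section BimoduleAction

variable {G : Type*} [Group G] {C : Type u} [Category.{v} C] [MonoidalCategory C]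
  {γ : G → C ⥤ C} [MonoidalAction γ]

/-- The bimodule `γ(g)(M)`, whose module structures are `γ(g)` of those of `M`, composed with the
inverse of `z g : γ(g)(A) ≅ A`. -/
def EquivariantAlgebra.actObj (A : EquivariantAlgebra γ) (g : G) (M : Bimod A.alg A.alg) :
    Bimod A.alg A.alg where
  X := (γ g).obj M.X
  actLeft := (A.z g).inv ▷ (γ g).obj M.X ≫ Functor.LaxMonoidal.μ (γ g) A.alg.X M.X ≫
    (γ g).map M.actLeft
  one_actLeft := by
    have h : MonObj.one (X := A.alg.X) ≫ (A.z g).inv =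
        Functor.LaxMonoidal.ε (γ g) ≫ (γ g).map (MonObj.one (X := A.alg.X)) := by
      rw [Iso.comp_inv_eq, Category.assoc, A.one_z]
    rw [← comp_whiskerRight_assoc, h, comp_whiskerRight_assoc,
      Functor.LaxMonoidal.μ_natural_left_assoc, ← Functor.map_comp, M.one_actLeft]
    exact (Functor.LaxMonoidal.left_unitality (γ g) M.X).symm
  left_assoc := by
    have h : MonObj.mul (X := A.alg.X) ≫ (A.z g).inv =
        ((A.z g).inv ⊗ₘ (A.z g).inv) ≫ Functor.LaxMonoidal.μ (γ g) A.alg.X A.alg.X ≫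
          (γ g).map (MonObj.mul (X := A.alg.X)) := by
      rw [Iso.comp_inv_eq]
      simp only [Category.assoc]
      rw [A.mul_z]
      simp
    rw [← comp_whiskerRight_assoc, h]
    simp only [comp_whiskerRight, Category.assoc, whiskerLeft_comp]
    rw [Functor.LaxMonoidal.μ_natural_left_assoc, ← Functor.map_comp, M.left_assoc,
      Functor.map_comp, Functor.map_comp, Functor.LaxMonoidal.associativity_assoc,
      whisker_exchange_assoc (A.z g).inv ((γ g).map M.actLeft),
      Functor.LaxMonoidal.μ_natural_right_assoc,
      whisker_exchange_assoc (A.z g).inv (Functor.LaxMonoidal.μ (γ g) A.alg.X M.X)]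
    simp [MonoidalCategory.tensorHom_def']
  actRight := (γ g).obj M.X ◁ (A.z g).inv ≫ Functor.LaxMonoidal.μ (γ g) M.X A.alg.X ≫
    (γ g).map M.actRight
  actRight_one := by
    have h : MonObj.one (X := A.alg.X) ≫ (A.z g).inv =
        Functor.LaxMonoidal.ε (γ g) ≫ (γ g).map (MonObj.one (X := A.alg.X)) := by
      rw [Iso.comp_inv_eq, Category.assoc, A.one_z]
    rw [← whiskerLeft_comp_assoc, h, whiskerLeft_comp_assoc,
      Functor.LaxMonoidal.μ_natural_right_assoc, ← Functor.map_comp, M.actRight_one]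
    exact (Functor.LaxMonoidal.right_unitality (γ g) M.X).symm
  right_assoc := by
    have h : MonObj.mul (X := A.alg.X) ≫ (A.z g).inv =
        ((A.z g).inv ⊗ₘ (A.z g).inv) ≫ Functor.LaxMonoidal.μ (γ g) A.alg.X A.alg.X ≫
          (γ g).map (MonObj.mul (X := A.alg.X)) := by
      rw [Iso.comp_inv_eq]
      simp only [Category.assoc]
      rw [A.mul_z]
      simp
    rw [← whiskerLeft_comp_assoc, h]
    simp only [comp_whiskerRight, Category.assoc, whiskerLeft_comp]
    rw [Functor.LaxMonoidal.μ_natural_right_assoc, ← Functor.map_comp, M.right_assoc,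
      Functor.map_comp, Functor.map_comp, Functor.LaxMonoidal.associativity_inv_assoc,
      ← whisker_exchange_assoc ((γ g).map M.actRight) (A.z g).inv,
      Functor.LaxMonoidal.μ_natural_left_assoc,
      ← whisker_exchange_assoc (Functor.LaxMonoidal.μ (γ g) M.X A.alg.X) (A.z g).inv]
    simp [MonoidalCategory.tensorHom_def]
  middle_assoc := by
    simp only [comp_whiskerRight, Category.assoc, whiskerLeft_comp]
    rw [← whisker_exchange_assoc ((γ g).map M.actLeft) (A.z g).inv,
      Functor.LaxMonoidal.μ_natural_left_assoc,
      ← whisker_exchange_assoc (Functor.LaxMonoidal.μ (γ g) A.alg.X M.X) (A.z g).inv,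
      ← Functor.map_comp, M.middle_assoc, Functor.map_comp, Functor.map_comp,
      Functor.LaxMonoidal.associativity_assoc,
      whisker_exchange_assoc (A.z g).inv ((γ g).map M.actRight),
      Functor.LaxMonoidal.μ_natural_right_assoc,
      whisker_exchange_assoc (A.z g).inv (Functor.LaxMonoidal.μ (γ g) M.X A.alg.X),
      whisker_exchange_assoc (A.z g).inv ((γ g).obj M.X ◁ (A.z g).inv)]
    simp

/-- The endofunctor `M ↦ γ(g)(M)` of the category of `A`-bimodules. -/
def EquivariantAlgebra.act (A : EquivariantAlgebra γ) (g : G) :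
    Bimod A.alg A.alg ⥤ Bimod A.alg A.alg where
  obj := A.actObj g
  map {M N} f :=
    { hom := (γ g).map f.hom
      left_act_hom := by
        dsimp only [EquivariantAlgebra.actObj]
        simp only [Category.assoc]
        rw [← Functor.map_comp, f.left_act_hom, Functor.map_comp,
          whisker_exchange_assoc, Functor.LaxMonoidal.μ_natural_right_assoc]
      right_act_hom := by
        dsimp only [EquivariantAlgebra.actObj]
        simp only [Category.assoc]
        rw [← Functor.map_comp, f.right_act_hom, Functor.map_comp,
          ← whisker_exchange_assoc, Functor.LaxMonoidal.μ_natural_left_assoc] }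
  map_id M := by ext; exact (γ g).map_id M.X
  map_comp f h := by ext; exact (γ g).map_comp f.hom h.hom

/-- The grading on bimodules: a bimodule has degree `g` iff its underlying object has. -/
def EquivariantAlgebra.grading (A : EquivariantAlgebra γ) (P : G → ObjectProperty C) :
    G → ObjectProperty (Bimod A.alg A.alg) :=
  fun g M => P g M.X

end BimoduleAction

/-! ### Equivariant alpha-induction -/

section Extend

variable {C : Type u} [Category.{v} C] [MonoidalCategory C]

/-- For a morphism `s : X ⊗ A ⟶ A ⊗ X` compatible with the algebra `A`, the bimodule `A ⊗ X` with
left action `m ⊗ X` and right action `(m ⊗ X) ∘ (A ⊗ s)`. -/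
def extendBimod (A : Mon C) (X : C) (s : X ⊗ A.X ⟶ A.X ⊗ X)
    (hone : X ◁ MonObj.one (X := A.X) ≫ s =
      (ρ_ X).hom ≫ (λ_ X).inv ≫ MonObj.one (X := A.X) ▷ X)
    (hmul : X ◁ MonObj.mul (X := A.X) ≫ s =
      (α_ X A.X A.X).inv ≫ s ▷ A.X ≫ (α_ A.X X A.X).hom ≫ A.X ◁ s ≫ (α_ A.X A.X X).inv ≫
        MonObj.mul (X := A.X) ▷ X) :
    Bimod A A where
  X := A.X ⊗ X
  actLeft := (α_ A.X A.X X).inv ≫ MonObj.mul (X := A.X) ▷ X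
  one_actLeft := by
    rw [associator_inv_naturality_left_assoc, ← comp_whiskerRight, MonObj.one_mul]
    simp
  left_assoc := by
    rw [associator_inv_naturality_left_assoc, ← comp_whiskerRight, MonObj.mul_assoc]
    simp
  actRight := (α_ A.X X A.X).hom ≫ A.X ◁ s ≫ (α_ A.X A.X X).inv ≫ MonObj.mul (X := A.X) ▷ X
  actRight_one := by
    rw [associator_naturality_right_assoc, ← whiskerLeft_comp_assoc, hone]
    simp only [whiskerLeft_comp, Category.assoc]
    rw [associator_inv_naturality_middle_assoc, ← comp_whiskerRight, MonObj.mul_one]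
    monoidal
  right_assoc := by
    rw [associator_naturality_right_assoc, ← whiskerLeft_comp_assoc, hmul]
    simp only [whiskerLeft_comp, comp_whiskerRight, Category.assoc]
    have h₁ := MonObj.mul_assoc (A.X)
    have h₂ : (MonObj.mul (X := A.X) ▷ X) ▷ A.X ≫ (α_ A.X X A.X).hom ≫ A.X ◁ s =
        (α_ (A.X ⊗ A.X) X A.X).hom ≫ (A.X ⊗ A.X) ◁ s ≫ MonObj.mul (X := A.X) ▷ (A.X ⊗ X) := by
      rw [associator_naturality_left_assoc, whisker_exchange]
    rw [reassoc_of% h₂, associator_inv_naturality_left_assoc, ← comp_whiskerRight, h₁,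
      associator_inv_naturality_middle_assoc]
    simp only [comp_whiskerRight]
    monoidal
  middle_assoc := by
    simp only [whiskerLeft_comp, comp_whiskerRight, Category.assoc]
    have h₁ := MonObj.mul_assoc (A.X)
    have h₂ : (MonObj.mul (X := A.X) ▷ X) ▷ A.X ≫ (α_ A.X X A.X).hom ≫ A.X ◁ s =
        (α_ (A.X ⊗ A.X) X A.X).hom ≫ (A.X ⊗ A.X) ◁ s ≫ MonObj.mul (X := A.X) ▷ (A.X ⊗ X) := by
      rw [associator_naturality_left_assoc, whisker_exchange]
    rw [reassoc_of% h₂, associator_inv_naturality_left_assoc, ← comp_whiskerRight, h₁,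
      associator_inv_naturality_middle_assoc]
    simp only [comp_whiskerRight]
    monoidal

lemma extend_one (A : Mon C) (X : C) (s : X ⊗ A.X ⟶ A.X ⊗ X) [Epi s]
    (hmul : X ◁ MonObj.mul (X := A.X) ≫ s =
      (α_ X A.X A.X).inv ≫ s ▷ A.X ≫ (α_ A.X X A.X).hom ≫ A.X ◁ s ≫ (α_ A.X A.X X).inv ≫
        MonObj.mul (X := A.X) ▷ X) :
    X ◁ MonObj.one (X := A.X) ≫ s =
      (ρ_ X).hom ≫ (λ_ X).inv ≫ MonObj.one (X := A.X) ▷ X := by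
  have h₁ : s ≫ (ρ_ (A.X ⊗ X)).inv ≫ (α_ A.X X (𝟙_ C)).hom ≫
      A.X ◁ (X ◁ MonObj.one (X := A.X) ≫ s) ≫ (α_ A.X A.X X).inv ≫
        MonObj.mul (X := A.X) ▷ X = s := by
    have h₂ : X ◁ (A.X ◁ MonObj.one (X := A.X) ≫ MonObj.mul (X := A.X)) ≫ s =
        X ◁ (ρ_ A.X).hom ≫ s := by rw [MonObj.mul_one]
    rw [whiskerLeft_comp, Category.assoc, hmul, associator_inv_naturality_right_assoc,
      whisker_exchange_assoc] at h₂
    rw [whiskerLeft_comp, Category.assoc, ← associator_naturality_right_assoc]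
    rw [← cancel_epi (X ◁ (ρ_ A.X).hom), ← h₂]
    simp
  have h₃ : (ρ_ (A.X ⊗ X)).inv ≫ (α_ A.X X (𝟙_ C)).hom ≫
      A.X ◁ (X ◁ MonObj.one (X := A.X) ≫ s) ≫ (α_ A.X A.X X).inv ≫
        MonObj.mul (X := A.X) ▷ X = 𝟙 _ := by
    rw [← cancel_epi s, h₁, Category.comp_id]
  have h₄ := congrArg (fun t => (ρ_ X).hom ≫ (λ_ X).inv ≫ MonObj.one (X := A.X) ▷ X ≫ t) h₃
  simp only [Category.comp_id] at h₄
  rw [← h₄]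
  have h₅ : MonObj.one (X := A.X) ▷ X ≫ (ρ_ (A.X ⊗ X)).inv ≫ (α_ A.X X (𝟙_ C)).hom ≫
      A.X ◁ (X ◁ MonObj.one (X := A.X) ≫ s) =
      (λ_ X).hom ≫ (ρ_ X).inv ≫ (X ◁ MonObj.one (X := A.X) ≫ s) ≫ (λ_ (A.X ⊗ X)).inv ≫
        MonObj.one (X := A.X) ▷ (A.X ⊗ X) := by
    have : (ρ_ (A.X ⊗ X)).inv ≫ (α_ A.X X (𝟙_ C)).hom = A.X ◁ (ρ_ X).inv := by simp
    rw [reassoc_of% this, ← whiskerLeft_comp, ← whisker_exchange, id_whiskerLeft]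
    simp only [Category.assoc]
  rw [reassoc_of% h₅, associator_inv_naturality_left_assoc, ← comp_whiskerRight, MonObj.one_mul]
  simp

/-- The functor `X ↦ A ⊗ X` from `C` to the `A`-bimodules, for a natural `s X : X ⊗ A ⟶ A ⊗ X`. -/
def extendFunctor (A : Mon C) (s : ∀ X : C, X ⊗ A.X ⟶ A.X ⊗ X)
    (hone : ∀ X, X ◁ MonObj.one (X := A.X) ≫ s X =
      (ρ_ X).hom ≫ (λ_ X).inv ≫ MonObj.one (X := A.X) ▷ X)
    (hmul : ∀ X, X ◁ MonObj.mul (X := A.X) ≫ s X =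
      (α_ X A.X A.X).inv ≫ s X ▷ A.X ≫ (α_ A.X X A.X).hom ≫ A.X ◁ s X ≫ (α_ A.X A.X X).inv ≫
        MonObj.mul (X := A.X) ▷ X)
    (hnat : ∀ {X Y : C} (f : X ⟶ Y), f ▷ A.X ≫ s Y = s X ≫ A.X ◁ f) :
    C ⥤ Bimod A A where
  obj X := extendBimod A X (s X) (hone X) (hmul X)
  map {X Y} f :=
    { hom := A.X ◁ f
      left_act_hom := by
        dsimp only [extendBimod]
        simp only [Category.assoc]
        rw [← whisker_exchange, associator_inv_naturality_right_assoc]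
      right_act_hom := by
        dsimp only [extendBimod]
        simp only [Category.assoc]
        rw [← whisker_exchange, associator_naturality_middle_assoc, ← whiskerLeft_comp_assoc,
          hnat, whiskerLeft_comp_assoc, associator_inv_naturality_right_assoc] }
  map_id X := by ext; exact whiskerLeft_id A.X X
  map_comp f h := by ext; exact whiskerLeft_comp A.X f h

end Extend

section Cross

set_option linter.unusedSectionVars false

variable {G : Type*} [Group G] {C : Type u} [Category.{v} C] [MonoidalCategory C]
  {γ : G → C ⥤ C} [MonoidalAction γ] {P : G → ObjectProperty C} [Preadditive C]

/-- The morphism `X ⊗ A ⟶ A ⊗ X` of the positive alpha-induction: the sum over `g` of the dashed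
crossing `X ⊗ A ⟶ γ(g)(A) ⊗ X` followed by `z g ⊗ X`. Only the finitely many `g` in the support of
a homogeneous decomposition of `X` contribute. -/
noncomputable def EquivariantAlgebra.crossPos (A : EquivariantAlgebra γ) (b : GBraiding γ P)
    (hP : IsGrading P) (X : C) : X ⊗ A.alg.X ⟶ A.alg.X ⊗ X :=
  ∑ g ∈ (hP.decomposition X).some.support,
    dashedCrossing b (hP.decomposition X).some g A.alg.X ≫ (A.z g).hom ▷ X

/-- The morphism `X ⊗ A ⟶ A ⊗ X` of the negative alpha-induction: the reverse of the braiding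
`A ⊗ X ⟶ γ(1)(X) ⊗ A`, which is defined since `A` is neutral. -/
def EquivariantAlgebra.crossNeg (A : EquivariantAlgebra γ) (b : GBraiding γ P)
    (hA : P 1 A.alg.X) (X : C) : X ⊗ A.alg.X ⟶ A.alg.X ⊗ X :=
  (actOne γ X).hom ▷ A.alg.X ≫ (b.iso hA X).inv

/-- The crossing with `A` of a homogeneous object. -/
def EquivariantAlgebra.crossHom (A : EquivariantAlgebra γ) (b : GBraiding γ P)
    {g : G} {X : C} (hX : P g X) : X ⊗ A.alg.X ⟶ A.alg.X ⊗ X :=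
  (b.iso hX A.alg.X).hom ≫ (A.z g).hom ▷ X

lemma EquivariantAlgebra.crossHom_mul (A : EquivariantAlgebra γ) (b : GBraiding γ P)
    {g : G} {X : C} (hX : P g X) : X ◁ MonObj.mul (X := A.alg.X) ≫ A.crossHom b hX =
      (α_ X A.alg.X A.alg.X).inv ≫ A.crossHom b hX ▷ A.alg.X ≫ (α_ A.alg.X X A.alg.X).hom ≫
        A.alg.X ◁ A.crossHom b hX ≫ (α_ A.alg.X A.alg.X X).inv ≫
          MonObj.mul (X := A.alg.X) ▷ X := by
  have hz := A.mul_z g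
  rw [crossHom, reassoc_of% (b.naturality_right hX (MonObj.mul (X := A.alg.X))),
    b.tensor_right hX]
  simp only [Category.assoc, comp_whiskerRight, whiskerLeft_comp]
  rw [← comp_whiskerRight, ← comp_whiskerRight, hz, associator_naturality_left_assoc,
    ← whisker_exchange_assoc]
  simp [MonoidalCategory.tensorHom_def]

lemma EquivariantAlgebra.crossHom_natural (A : EquivariantAlgebra γ) (b : GBraiding γ P)
    {g : G} {X Y : C} (hX : P g X) (hY : P g Y) (f : X ⟶ Y) :
    f ▷ A.alg.X ≫ A.crossHom b hY = A.crossHom b hX ≫ A.alg.X ◁ f := by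
  rw [crossHom, crossHom, reassoc_of% (b.naturality_left hX hY f), whisker_exchange]
  simp only [Category.assoc]

section

variable [MonoidalPreadditive C]

lemma EquivariantAlgebra.crossPos_eq (A : EquivariantAlgebra γ) (b : GBraiding γ P)
    (hP : IsGrading P) {g : G} {X Y : C} (hY : P g Y) (f : Y ⟶ X) :
    f ▷ A.alg.X ≫ A.crossPos b hP X = A.crossHom b hY ≫ A.alg.X ◁ f := by
  have h : ∀ h, f ▷ A.alg.X ≫ dashedCrossing b (hP.decomposition X).some h A.alg.X ≫
      (A.z h).hom ▷ X = A.crossHom b hY ≫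
        A.alg.X ◁ (f ≫ (hP.decomposition X).some.π h ≫ (hP.decomposition X).some.ι h) := by
    intro h
    by_cases e : g = h
    · subst e
      have h₁ := A.crossHom_natural b hY ((hP.decomposition X).some.homogeneous g)
        (f ≫ (hP.decomposition X).some.π g)
      rw [← Category.assoc f, whiskerLeft_comp, ← reassoc_of% h₁]
      simp only [dashedCrossing, crossHom, comp_whiskerRight, Category.assoc]
      rw [whisker_exchange]
    · have h₁ := hP.hom_eq_zero e hY ((hP.decomposition X).some.homogeneous h)
        (f ≫ (hP.decomposition X).some.π h)
      rw [dashedCrossing, reassoc_of% h₁, Category.assoc, ← comp_whiskerRight_assoc, h₁]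
      simp
  rw [crossPos, Preadditive.comp_sum, Finset.sum_congr rfl (fun g _ => h g),
    ← Preadditive.comp_sum, ← whiskerLeft_sum, ← Preadditive.comp_sum,
    (hP.decomposition X).some.sum_π_ι, Category.comp_id]

/-- Morphisms out of `X ⊗ Y` may be compared on homogeneous components of `X`. -/
lemma homogeneous_ext (hP : IsGrading P) {X Y Z : C} {f f' : X ⊗ Y ⟶ Z}
    (h : ∀ (g : G) (X' : C) (_ : P g X') (i : X' ⟶ X), i ▷ Y ≫ f = i ▷ Y ≫ f') : f = f' := by
  obtain ⟨d⟩ := hP.decomposition X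
  have h₁ : 𝟙 (X ⊗ Y) = ∑ g ∈ d.support, (d.π g ▷ Y ≫ d.ι g ▷ Y) := by
    simp only [← comp_whiskerRight]
    rw [← sum_whiskerRight, d.sum_π_ι, id_whiskerRight]
  rw [← Category.id_comp f, ← Category.id_comp f', h₁, Preadditive.sum_comp, Preadditive.sum_comp]
  refine Finset.sum_congr rfl fun g _ => ?_
  rw [Category.assoc, Category.assoc, h g _ (d.homogeneous g) (d.ι g)]

lemma EquivariantAlgebra.crossPos_natural (A : EquivariantAlgebra γ) (b : GBraiding γ P)
    (hP : IsGrading P) {X Y : C} (f : X ⟶ Y) :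
    f ▷ A.alg.X ≫ A.crossPos b hP Y = A.crossPos b hP X ≫ A.alg.X ◁ f := by
  refine homogeneous_ext hP fun g X' hX' i => ?_
  rw [← comp_whiskerRight_assoc, A.crossPos_eq b hP hX', reassoc_of% (A.crossPos_eq b hP hX' i),
    whiskerLeft_comp]

lemma EquivariantAlgebra.crossPos_mul (A : EquivariantAlgebra γ) (b : GBraiding γ P)
    (hP : IsGrading P) (X : C) : X ◁ MonObj.mul (X := A.alg.X) ≫ A.crossPos b hP X =
      (α_ X A.alg.X A.alg.X).inv ≫ A.crossPos b hP X ▷ A.alg.X ≫ (α_ A.alg.X X A.alg.X).hom ≫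
        A.alg.X ◁ A.crossPos b hP X ≫ (α_ A.alg.X A.alg.X X).inv ≫
          MonObj.mul (X := A.alg.X) ▷ X := by
  refine homogeneous_ext hP fun g X' hX' i => ?_
  rw [← whisker_exchange_assoc, A.crossPos_eq b hP hX', reassoc_of% (A.crossHom_mul b hX'),
    associator_inv_naturality_left_assoc, ← comp_whiskerRight_assoc, A.crossPos_eq b hP hX',
    comp_whiskerRight_assoc, associator_naturality_middle_assoc, ← whiskerLeft_comp_assoc,
    A.crossPos_eq b hP hX', whiskerLeft_comp_assoc, associator_inv_naturality_right_assoc,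
    whisker_exchange]

lemma EquivariantAlgebra.crossPos_one (A : EquivariantAlgebra γ) (b : GBraiding γ P)
    (hP : IsGrading P) (X : C) : X ◁ MonObj.one (X := A.alg.X) ≫ A.crossPos b hP X =
      (ρ_ X).hom ≫ (λ_ X).inv ≫ MonObj.one (X := A.alg.X) ▷ X := by
  refine homogeneous_ext hP fun g X' hX' i => ?_
  have : Epi (A.crossHom b hX') := by unfold crossHom; infer_instance
  rw [← whisker_exchange_assoc, A.crossPos_eq b hP hX',
    reassoc_of% (extend_one A.alg X' _ (A.crossHom_mul b hX')), rightUnitor_naturality_assoc,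
    leftUnitor_inv_naturality_assoc i, whisker_exchange]
  try simp only [Category.assoc]

end

lemma GBraiding.tensor_left' (b : GBraiding γ P) {g h k : G} (e : g * h = k) {X Y : C}
    (hX : P g X) (hY : P h Y) (hXY : P k (X ⊗ Y)) (Z : C) :
    (b.iso hXY Z).hom =
      (α_ X Y Z).hom ≫ X ◁ (b.iso hY Z).hom ≫ (α_ X ((γ h).obj Z) Y).inv ≫
        (b.iso hX ((γ h).obj Z)).hom ▷ Y ≫ ((actComp γ e Z).hom ▷ X) ▷ Y ≫
          (α_ ((γ k).obj Z) X Y).hom := by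
  subst e
  exact b.tensor_left hX hY hXY Z

/-- The crossing `A ⊗ X ⟶ X ⊗ A`, for a neutral `A`. -/
def EquivariantAlgebra.crossOver (A : EquivariantAlgebra γ) (b : GBraiding γ P)
    (hA : P 1 A.alg.X) (X : C) : A.alg.X ⊗ X ≅ X ⊗ A.alg.X :=
  b.iso hA X ≪≫ whiskerRightIso (actOne γ X).symm A.alg.X

lemma EquivariantAlgebra.crossOver_mul (A : EquivariantAlgebra γ) (b : GBraiding γ P)
    (hP : IsGrading P) (hA : P 1 A.alg.X) (X : C) :
    MonObj.mul (X := A.alg.X) ▷ X ≫ (A.crossOver b hA X).hom =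
      (α_ _ _ _).hom ≫ A.alg.X ◁ (A.crossOver b hA X).hom ≫ (α_ _ _ _).inv ≫
        (A.crossOver b hA X).hom ▷ A.alg.X ≫ (α_ _ _ _).hom ≫ X ◁ MonObj.mul (X := A.alg.X) := by
  have hAA : P 1 (A.alg.X ⊗ A.alg.X) := by simpa using hP.tensor hA hA
  have h₁ := MonoidalAction.comp_one (γ := γ) 1 X
  have h₂ := b.naturality_right hA (actOne γ X).hom
  have h₃ : (actComp γ (mul_one 1) X).hom = (γ 1).map (actOne γ X).inv := by
    rw [← cancel_epi ((γ 1).map (actOne γ X).hom), ← Functor.map_comp, Iso.hom_inv_id]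
    simpa using h₁
  have h₄ : (b.iso hA ((γ 1).obj X)).hom ≫ (γ 1).map (actOne γ X).inv ▷ A.alg.X =
      A.alg.X ◁ (actOne γ X).inv ≫ (b.iso hA X).hom := (b.naturality_right hA _).symm
  simp only [crossOver, Iso.trans_hom, whiskerRightIso_hom, Iso.symm_hom, Category.assoc,
    comp_whiskerRight, whiskerLeft_comp]
  rw [reassoc_of% (b.naturality_left hAA hA (MonObj.mul (X := A.alg.X)) X),
    b.tensor_left' (mul_one 1) hA hA hAA, h₃]
  simp only [Category.assoc]
  rw [← comp_whiskerRight_assoc (b.iso hA ((γ 1).obj X)).hom, h₄, whisker_exchange,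
    comp_whiskerRight_assoc, associator_inv_naturality_middle_assoc,
    associator_naturality_left_assoc]

lemma EquivariantAlgebra.crossNeg_eq (A : EquivariantAlgebra γ) (b : GBraiding γ P)
    (hA : P 1 A.alg.X) (X : C) : A.crossNeg b hA X = (A.crossOver b hA X).inv := by
  simp [crossNeg, crossOver]

lemma EquivariantAlgebra.crossNeg_mul (A : EquivariantAlgebra γ) (b : GBraiding γ P)
    (hP : IsGrading P) (hA : P 1 A.alg.X) (X : C) :
    X ◁ MonObj.mul (X := A.alg.X) ≫ A.crossNeg b hA X =
      (α_ X A.alg.X A.alg.X).inv ≫ A.crossNeg b hA X ▷ A.alg.X ≫ (α_ A.alg.X X A.alg.X).hom ≫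
        A.alg.X ◁ A.crossNeg b hA X ≫ (α_ A.alg.X A.alg.X X).inv ≫
          MonObj.mul (X := A.alg.X) ▷ X := by
  rw [crossNeg_eq, Iso.comp_inv_eq]
  simp only [Category.assoc]
  rw [A.crossOver_mul b hP hA X, Iso.inv_hom_id_assoc, whiskerLeft_inv_hom_assoc,
    Iso.hom_inv_id_assoc, inv_hom_whiskerRight_assoc, Iso.inv_hom_id_assoc]

lemma EquivariantAlgebra.crossNeg_one (A : EquivariantAlgebra γ) (b : GBraiding γ P)
    (hP : IsGrading P) (hA : P 1 A.alg.X) (X : C) :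
    X ◁ MonObj.one (X := A.alg.X) ≫ A.crossNeg b hA X =
      (ρ_ X).hom ≫ (λ_ X).inv ≫ MonObj.one (X := A.alg.X) ▷ X := by
  have : Epi (A.crossNeg b hA X) := by rw [crossNeg_eq]; infer_instance
  exact extend_one A.alg X _ (A.crossNeg_mul b hP hA X)

lemma EquivariantAlgebra.crossNeg_natural (A : EquivariantAlgebra γ) (b : GBraiding γ P)
    (hA : P 1 A.alg.X) {X Y : C} (f : X ⟶ Y) :
    f ▷ A.alg.X ≫ A.crossNeg b hA Y = A.crossNeg b hA X ≫ A.alg.X ◁ f := by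
  have h : f ≫ (actOne γ Y).hom = (actOne γ X).hom ≫ (γ 1).map f :=
    (MonoidalAction.one (γ := γ)).hom.naturality f
  have h' : (γ 1).map f ▷ A.alg.X ≫ (b.iso hA Y).inv = (b.iso hA X).inv ≫ A.alg.X ◁ f := by
    rw [Iso.comp_inv_eq, Category.assoc, b.naturality_right hA f, Iso.inv_hom_id_assoc]
  rw [crossNeg, crossNeg, ← comp_whiskerRight_assoc, h, comp_whiskerRight_assoc, Category.assoc,
    h']

end Cross

section Alpha

variable {G : Type*} [Group G] {C : Type u} [Category.{v} C] [MonoidalCategory C]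
  {γ : G → C ⥤ C} [MonoidalAction γ] {P : G → ObjectProperty C} [Preadditive C]

/-- The positive equivariant alpha-induction `X ↦ A ⊗ X`, `f ↦ A ◁ f`. -/
noncomputable def EquivariantAlgebra.alphaPos [MonoidalPreadditive C] (A : EquivariantAlgebra γ)
    (b : GBraiding γ P) (hP : IsGrading P) : C ⥤ Bimod A.alg A.alg :=
  extendFunctor A.alg (A.crossPos b hP) (A.crossPos_one b hP) (A.crossPos_mul b hP)
    (A.crossPos_natural b hP)

/-- The negative equivariant alpha-induction `X ↦ A ⊗ X`, `f ↦ A ◁ f`, for a neutral `A`. -/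
def EquivariantAlgebra.alphaNeg (A : EquivariantAlgebra γ) (b : GBraiding γ P)
    (hP : IsGrading P) (hA : P 1 A.alg.X) : C ⥤ Bimod A.alg A.alg :=
  extendFunctor A.alg (A.crossNeg b hA) (A.crossNeg_one b hP hA) (A.crossNeg_mul b hP hA)
    (A.crossNeg_natural b hA)

end Alpha

/-! ### The induced structures on bimodules and on alpha-induction -/

section Induced

variable {G : Type*} [Group G] {C : Type u} [Category.{v} C] [MonoidalCategory C]
  {γ : G → C ⥤ C} [MonoidalAction γ] [HasCoequalizers C] [RigidCategory C]

/-- The action of `G` on the category of `A`-bimodules by the functors `M ↦ γ(g)(M)` is the one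
induced by the action on `C`: its tensor structure is induced by that of `γ(g)`, its unit
isomorphism `A ⟶ γ(g)(A)` is the inverse of `z g`, and `γ(g)γ(h) ≅ γ(gh)` and `id ≅ γ(1)` are
those of `C`. -/
structure EquivariantAlgebra.IsInducedAction (A : EquivariantAlgebra γ) [MonoidalAction A.act] :
    Prop where
  tensor : ∀ (g : G) (M N : Bimod A.alg A.alg),
    bimodProj ((A.act g).obj M) ((A.act g).obj N) ≫ (Functor.LaxMonoidal.μ (A.act g) M N).hom =
      Functor.LaxMonoidal.μ (γ g) M.X N.X ≫ (γ g).map (bimodProj M N)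
  unit : ∀ g : G, (Functor.LaxMonoidal.ε (A.act g)).hom = (A.z g).inv
  comp : ∀ {g h k : G} (e : g * h = k) (M : Bimod A.alg A.alg),
    (actComp A.act e M).hom.hom = (actComp γ e M.X).hom
  one : ∀ M : Bimod A.alg A.alg, (actOne A.act M).hom.hom = (actOne γ M.X).hom

/-- For a Frobenius algebra `A` and an `A`-bimodule `M`, the pairing of the dual bimodule of `M`
with `M` obtained from its evaluation `M^∨ ⊗_A M ⟶ A` and the counit of `A`. Through it, the
underlying object of the dual bimodule is a dual of the underlying object of `M`. -/
noncomputable def EquivariantFrobeniusAlgebra.bimodPairing (A : EquivariantFrobeniusAlgebra γ)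
    [RigidCategory (Bimod A.alg A.alg)] (M : Bimod A.alg A.alg) :
    (Mᘁ : Bimod A.alg A.alg).X ⊗ M.X ⟶ 𝟙_ C :=
  bimodProj (Mᘁ) M ≫ (ε_ M (Mᘁ)).hom ≫ ComonObj.counit (X := A.alg.X)

/-- The pivotal structure `δ'` of the category of `A`-bimodules is that of `C`. -/
def EquivariantFrobeniusAlgebra.IsInducedPivotal (A : EquivariantFrobeniusAlgebra γ)
    (δ : PivotalStructure C) [RigidCategory (Bimod A.alg A.alg)]
    (δ' : PivotalStructure (Bimod A.alg A.alg)) : Prop :=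
  ∀ M : Bimod A.alg A.alg, Realizes (δ.iso M.X).hom (A.bimodPairing M) (A.bimodPairing (Mᘁ))
    (δ'.iso M).hom.hom

/-- The tensor structure of an alpha-induction `α` and the isomorphisms
`η g : α(γ(g)(X)) ≅ γ(g)(α(X))` are the standard ones: `α(X) ⊗_A α(Y) ≅ α(X ⊗ Y)` is induced by the
right action `α(X) ⊗ A ⟶ α(X)`, the unit isomorphism is `A ≅ A ⊗ 𝟙`, and `η g` is induced by the
inverse of `z g` and the tensor structure of `γ(g)`. -/
structure EquivariantAlgebra.IsStandard (A : EquivariantAlgebra γ)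
    {s : ∀ X : C, X ⊗ A.alg.X ⟶ A.alg.X ⊗ X}
    {hone : ∀ X, X ◁ MonObj.one (X := A.alg.X) ≫ s X =
      (ρ_ X).hom ≫ (λ_ X).inv ≫ MonObj.one (X := A.alg.X) ▷ X}
    {hmul : ∀ X, X ◁ MonObj.mul (X := A.alg.X) ≫ s X =
      (α_ X A.alg.X A.alg.X).inv ≫ s X ▷ A.alg.X ≫ (α_ A.alg.X X A.alg.X).hom ≫
        A.alg.X ◁ s X ≫ (α_ A.alg.X A.alg.X X).inv ≫ MonObj.mul (X := A.alg.X) ▷ X}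
    {hnat : ∀ {X Y : C} (f : X ⟶ Y), f ▷ A.alg.X ≫ s Y = s X ≫ A.alg.X ◁ f}
    (m : (extendFunctor A.alg s hone hmul hnat).Monoidal)
    (η : ∀ g, γ g ⋙ extendFunctor A.alg s hone hmul hnat ≅
      extendFunctor A.alg s hone hmul hnat ⋙ A.act g) : Prop where
  tensor : ∀ X Y : C,
    bimodProj (extendBimod A.alg X (s X) (hone X) (hmul X))
        (extendBimod A.alg Y (s Y) (hone Y) (hmul Y)) ≫ (m.μ X Y).hom =
      (α_ (A.alg.X ⊗ X) A.alg.X Y).inv ≫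
        (extendBimod A.alg X (s X) (hone X) (hmul X)).actRight ▷ Y ≫ (α_ A.alg.X X Y).hom
  unit : m.ε.hom = (ρ_ A.alg.X).inv
  action : ∀ (g : G) (X : C), ((η g).hom.app X).hom =
    (A.z g).inv ▷ (γ g).obj X ≫ Functor.LaxMonoidal.μ (γ g) A.alg.X X

end Induced

end EquivariantTensor

open EquivariantTensor

/-!
The proof has three parts.

*Bimodules.* Tensoring with an object of a rigid category preserves kernels and cokernels, so those
of bimodule morphisms are computed in `C`. Bimodules therefore form an abelian monoidal category
with bilinear tensor product, and it inherits finiteness and, as `A` is neutral, the grading from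
`C`. A Frobenius algebra is its own dual through `ε ∘ m`. This turns the evaluation of the object
`M^∨` with `M` into an `A`-valued pairing (`evalAlg`), which makes `M^∨` a bimodule (`dualBimod`).
The zigzag composites of the evident evaluation and coevaluation over `A` are the scalar `m ∘ Δ`
(`evalAlg_zigzag`), so that `M^∨` is a dual of `M` in the category of bimodules as soon as this
scalar is invertible (`bimodExactPairing`). The functor `γ(g)` is an equivalence, so it preserves
the coequalizer `M ⊗_A N`, and the action of `G` on `C` carries over to bimodules (`bimodAction`).

*Pivotal structures.* A pivotal structure rotates a pairing `Y ⊗ X ⟶ 𝟙` to a pairing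
`X ⊗ Y ⟶ 𝟙` (`PivotalStructure.rotate`). In these terms `Realizes` says that a morphism carries a
given pairing to a rotated one (`PivotalStructure.realizes_iff`), monoidality says that two objects
can be rotated one after the other (`PivotalStructure.rotate_tensor`), and `A` is symmetric when its
form is invariant under rotation. A pairing of bimodules is determined by the pairing of objects
obtained from it by the counit of `A` (`pairing_injective`), because the Frobenius form is
nondegenerate. So every statement about the pivotal structure of bimodules becomes one about
rotation in `C` (`realizes_bimod_iff`). Symmetry of the form makes the pivotal isomorphism of the
object `M` a morphism of bimodules (`pivotal_actLeft`, `pivotal_actRight`).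

*Alpha-induction.* Both `s⁺` and `s⁻` are natural, compatible with the algebra structure of `A`,
with tensor products and with the action of `G` (`IsEquivariantCrossing`); this is the content of
the two hexagon identities and of the equivariance of the braiding. From these properties alone,
`X ↦ A ⊗ X` is a monoidal functor with the standard isomorphisms `η g`. It is exact because its
composite with the forgetful functor is `A ⊗ -`, and faithful because `ε ∘ η` is an invertible
scalar. This scalar also allows one to deduce that the crossing respects the counit from its
naturality with respect to the endomorphism `η ∘ ε` of `A` (`crossing_counit`). Pivotality is then
the fact that rotation commutes with the passage from a pairing of `Y` with `X` to the pairing of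
`A ⊗ Y` with `A ⊗ X` (`rotate_extendPairing`), which follows from the symmetry of the form.
-/

namespace EquivariantTensor

-- The underlying objects `γ(g)(M)` and `A ⊗ X` of these bimodules, and their actions, have to be
-- visible to `rw` and `simp`.
attribute [reducible] EquivariantAlgebra.act EquivariantAlgebra.actObj extendBimod

/-! ### The relative tensor product of bimodules -/

section RelativeTensor

variable {C : Type u} [Category.{v} C] [MonoidalCategory C]

instance whiskerLeft_epi [RigidCategory C] (X : C) {Y Z : C} (f : Y ⟶ Z) [Epi f] :
    Epi (X ◁ f) :=
  inferInstanceAs (Epi ((tensorLeft X).map f))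

instance whiskerRight_epi [RigidCategory C] (X : C) {Y Z : C} (f : Y ⟶ Z) [Epi f] :
    Epi (f ▷ X) :=
  inferInstanceAs (Epi ((tensorRight X).map f))

variable [HasCoequalizers C] [RigidCategory C] {A : Mon C}

instance (M N : Bimod A A) : Epi (bimodProj M N) :=
  coequalizer.π_epi

/-- `M ⊗_A N` identifies the right action on `M` with the left action on `N`. -/
lemma bimodProj_balanced (M N : Bimod A A) :
    M.actRight ▷ N.X ≫ bimodProj M N = (α_ M.X A.X N.X).hom ≫ M.X ◁ N.actLeft ≫ bimodProj M N := by
  rw [← Category.assoc (α_ M.X A.X N.X).hom]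
  exact coequalizer.condition (M.actRight ▷ N.X) ((α_ M.X A.X N.X).hom ≫ M.X ◁ N.actLeft)

/-- The morphism out of `M ⊗_A N` induced by a balanced morphism out of `M ⊗ N`. -/
noncomputable def bimodDesc {M N : Bimod A A} {Z : C} (f : M.X ⊗ N.X ⟶ Z)
    (hf : M.actRight ▷ N.X ≫ f = (α_ M.X A.X N.X).hom ≫ M.X ◁ N.actLeft ≫ f) :
    (M ⊗ N).X ⟶ Z :=
  coequalizer.desc f (by simpa using hf)

@[simp]
lemma bimodProj_desc {M N : Bimod A A} {Z : C} (f : M.X ⊗ N.X ⟶ Z)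
    (hf : M.actRight ▷ N.X ≫ f = (α_ M.X A.X N.X).hom ≫ M.X ◁ N.actLeft ≫ f) :
    bimodProj M N ≫ bimodDesc f hf = f :=
  coequalizer.π_desc _ _

lemma bimodProj_actLeft (M N : Bimod A A) :
    A.X ◁ bimodProj M N ≫ (M ⊗ N).actLeft =
      (α_ A.X M.X N.X).inv ≫ M.actLeft ▷ N.X ≫ bimodProj M N :=
  Bimod.TensorBimod.whiskerLeft_π_actLeft M N

lemma bimodProj_actRight (M N : Bimod A A) :
    bimodProj M N ▷ A.X ≫ (M ⊗ N).actRight =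
      (α_ M.X N.X A.X).hom ≫ M.X ◁ N.actRight ≫ bimodProj M N :=
  Bimod.TensorBimod.π_tensor_id_actRight M N

lemma bimodProj_whiskerLeft (M : Bimod A A) {N N' : Bimod A A} (f : N ⟶ N') :
    bimodProj M N ≫ (M ◁ f).hom = M.X ◁ f.hom ≫ bimodProj M N' :=
  ι_colimMap _ _

lemma bimodProj_whiskerRight {M M' : Bimod A A} (f : M ⟶ M') (N : Bimod A A) :
    bimodProj M N ≫ (f ▷ N).hom = f.hom ▷ N.X ≫ bimodProj M' N :=
  ι_colimMap _ _

lemma bimodProj_tensorHom {M M' N N' : Bimod A A} (f : M ⟶ M') (g : N ⟶ N') :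
    bimodProj M N ≫ (f ⊗ₘ g).hom = (f.hom ⊗ₘ g.hom) ≫ bimodProj M' N' := by
  rw [MonoidalCategory.tensorHom_def, Bimod.comp_hom', reassoc_of% bimodProj_whiskerRight,
    bimodProj_whiskerLeft, MonoidalCategory.tensorHom_def, Category.assoc]

lemma bimodProj_associator (M N L : Bimod A A) :
    bimodProj M N ▷ L.X ≫ bimodProj (M ⊗ N) L ≫ (α_ M N L).hom.hom =
      (α_ M.X N.X L.X).hom ≫ M.X ◁ bimodProj N L ≫ bimodProj M (N ⊗ L) := by
  have h : bimodProj (M ⊗ N) L ≫ (α_ M N L).hom.hom = Bimod.AssociatorBimod.homAux M N L :=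
    coequalizer.π_desc _ _
  rw [h]
  exact π_tensor_id_preserves_coequalizer_inv_desc _ _ _ _

lemma bimodProj_associator_inv (M N L : Bimod A A) :
    M.X ◁ bimodProj N L ≫ bimodProj M (N ⊗ L) ≫ (α_ M N L).inv.hom =
      (α_ M.X N.X L.X).inv ≫ bimodProj M N ▷ L.X ≫ bimodProj (M ⊗ N) L := by
  have h : bimodProj M (N ⊗ L) ≫ (α_ M N L).inv.hom = Bimod.AssociatorBimod.invAux M N L :=
    coequalizer.π_desc _ _
  rw [h]
  exact id_tensor_π_preserves_coequalizer_inv_desc _ _ _ _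

lemma bimodProj_leftUnitor (M : Bimod A A) :
    bimodProj (𝟙_ (Bimod A A)) M ≫ (λ_ M).hom.hom = M.actLeft :=
  coequalizer.π_desc _ _

lemma bimodProj_rightUnitor (M : Bimod A A) :
    bimodProj M (𝟙_ (Bimod A A)) ≫ (ρ_ M).hom.hom = M.actRight :=
  coequalizer.π_desc _ _

lemma leftUnitor_inv_hom (M : Bimod A A) :
    (λ_ M).inv.hom = (λ_ M.X).inv ≫ MonObj.one (X := A.X) ▷ M.X ≫ bimodProj (𝟙_ (Bimod A A)) M :=
  rfl

lemma rightUnitor_inv_hom (M : Bimod A A) :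
    (ρ_ M).inv.hom = (ρ_ M.X).inv ≫ M.X ◁ MonObj.one (X := A.X) ≫ bimodProj M (𝟙_ (Bimod A A)) :=
  rfl

end RelativeTensor

/-! ### The abelian category of bimodules -/

section SubQuotient

variable {C : Type u} [Category.{v} C] [MonoidalCategory C] {A : Mon C}

/-- The bimodule structure on a subobject of a bimodule which is stable under both actions. -/
def subBimod (M : Bimod A A) {K : C} (i : K ⟶ M.X) [Mono i] (l : A.X ⊗ K ⟶ K) (r : K ⊗ A.X ⟶ K)
    (hl : l ≫ i = A.X ◁ i ≫ M.actLeft) (hr : r ≫ i = i ▷ A.X ≫ M.actRight) : Bimod A A where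
  X := K
  actLeft := l
  actRight := r
  one_actLeft := by
    rw [← cancel_mono i, Category.assoc, hl, ← whisker_exchange_assoc, M.one_actLeft,
      leftUnitor_naturality]
  left_assoc := by
    rw [← cancel_mono i]
    simp only [Category.assoc, hl]
    rw [← whisker_exchange_assoc, M.left_assoc, ← whiskerLeft_comp_assoc, hl]
    simp
  actRight_one := by
    rw [← cancel_mono i, Category.assoc, hr, whisker_exchange_assoc, M.actRight_one,
      rightUnitor_naturality]
  right_assoc := by
    rw [← cancel_mono i]
    simp only [Category.assoc, hr]
    rw [whisker_exchange_assoc, M.right_assoc, ← comp_whiskerRight_assoc, hr]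
    simp
  middle_assoc := by
    rw [← cancel_mono i]
    simp only [Category.assoc, hr, hl]
    rw [← comp_whiskerRight_assoc, hl, ← whiskerLeft_comp_assoc, hr]
    simp

/-- The inclusion of a stable subobject. -/
def subBimodι (M : Bimod A A) {K : C} (i : K ⟶ M.X) [Mono i] (l : A.X ⊗ K ⟶ K) (r : K ⊗ A.X ⟶ K)
    (hl : l ≫ i = A.X ◁ i ≫ M.actLeft) (hr : r ≫ i = i ▷ A.X ≫ M.actRight) :
    subBimod M i l r hl hr ⟶ M :=
  ({ hom := i, left_act_hom := hl, right_act_hom := hr } : Bimod.Hom _ _)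

/-- The bimodule structure on a quotient of a bimodule to which both actions descend. -/
def quotBimod [RigidCategory C] (M : Bimod A A) {K : C} (p : M.X ⟶ K) [Epi p] (l : A.X ⊗ K ⟶ K)
    (r : K ⊗ A.X ⟶ K) (hl : M.actLeft ≫ p = A.X ◁ p ≫ l) (hr : M.actRight ≫ p = p ▷ A.X ≫ r) :
    Bimod A A where
  X := K
  actLeft := l
  actRight := r
  one_actLeft := by
    rw [← cancel_epi (𝟙_ C ◁ p), whisker_exchange_assoc, ← hl, M.one_actLeft_assoc,
      leftUnitor_naturality]
  left_assoc := by
    rw [← cancel_epi ((A.X ⊗ A.X) ◁ p), whisker_exchange_assoc, ← hl, M.left_assoc_assoc, hl,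
      ← whiskerLeft_comp_assoc, hl]
    simp
  actRight_one := by
    rw [← cancel_epi (p ▷ 𝟙_ C), ← whisker_exchange_assoc, ← hr, M.actRight_one_assoc,
      rightUnitor_naturality]
  right_assoc := by
    rw [← cancel_epi (p ▷ (A.X ⊗ A.X)), ← whisker_exchange_assoc, ← hr, M.right_assoc_assoc, hr,
      ← comp_whiskerRight_assoc, hr]
    simp
  middle_assoc := by
    rw [← cancel_epi ((A.X ◁ p) ▷ A.X), ← comp_whiskerRight_assoc, ← hl, comp_whiskerRight_assoc,
      ← hr, M.middle_assoc_assoc, hl, ← whiskerLeft_comp_assoc, hr]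
    simp

/-- The projection to a quotient bimodule. -/
def quotBimodπ [RigidCategory C] (M : Bimod A A) {K : C} (p : M.X ⟶ K) [Epi p] (l : A.X ⊗ K ⟶ K)
    (r : K ⊗ A.X ⟶ K) (hl : M.actLeft ≫ p = A.X ◁ p ≫ l) (hr : M.actRight ≫ p = p ▷ A.X ≫ r) :
    M ⟶ quotBimod M p l r hl hr :=
  ({ hom := p, left_act_hom := hl, right_act_hom := hr } : Bimod.Hom _ _)

/-- A morphism of bimodules lifts along a monomorphism if the underlying morphism does. -/
def bimodLift {K M N : Bimod A A} (i : K ⟶ M) [Mono i.hom] (f : N ⟶ M) (g : N.X ⟶ K.X)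
    (h : g ≫ i.hom = f.hom) : N ⟶ K :=
  ({ hom := g
     left_act_hom := by
       rw [← cancel_mono i.hom, Category.assoc, Category.assoc, h, i.left_act_hom,
         ← whiskerLeft_comp_assoc, h, f.left_act_hom]
     right_act_hom := by
       rw [← cancel_mono i.hom, Category.assoc, Category.assoc, h, i.right_act_hom,
         ← comp_whiskerRight_assoc, h, f.right_act_hom] } : Bimod.Hom _ _)

/-- A morphism of bimodules descends along an epimorphism if the underlying morphism does. -/
def bimodDescend [RigidCategory C] {K M N : Bimod A A} (p : M ⟶ K) [Epi p.hom] (f : M ⟶ N)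
    (g : K.X ⟶ N.X) (h : p.hom ≫ g = f.hom) : K ⟶ N :=
  ({ hom := g
     left_act_hom := by
       rw [← cancel_epi (A.X ◁ p.hom), ← p.left_act_hom_assoc, h, f.left_act_hom,
         ← whiskerLeft_comp_assoc, h]
     right_act_hom := by
       rw [← cancel_epi (p.hom ▷ A.X), ← p.right_act_hom_assoc, h, f.right_act_hom,
         ← comp_whiskerRight_assoc, h] } : Bimod.Hom _ _)

lemma bimod_mono_of_mono_hom {M N : Bimod A A} (f : M ⟶ N) [Mono f.hom] : Mono f where
  right_cancellation g h e := by
    ext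
    rw [← cancel_mono f.hom]
    exact congrArg Bimod.Hom.hom e

lemma bimod_epi_of_epi_hom {M N : Bimod A A} (f : M ⟶ N) [Epi f.hom] : Epi f where
  left_cancellation g h e := by
    ext
    rw [← cancel_epi f.hom]
    exact congrArg Bimod.Hom.hom e

end SubQuotient

section Abelian

open ZeroObject

variable {C : Type u} [Category.{v} C] [MonoidalCategory C] [Abelian C] [MonoidalPreadditive C]
  [RigidCategory C] {A : Mon C}

section Kernel

variable {M N : Bimod A A} (f : M ⟶ N)

/-- The kernel of the underlying morphism, as a bimodule. -/
noncomputable def kernelBimod : Bimod A A :=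
  subBimod M (kernel.ι f.hom)
    (kernel.lift f.hom (A.X ◁ kernel.ι f.hom ≫ M.actLeft) (by
      rw [Category.assoc, f.left_act_hom, ← whiskerLeft_comp_assoc, kernel.condition]; simp))
    (kernel.lift f.hom (kernel.ι f.hom ▷ A.X ≫ M.actRight) (by
      rw [Category.assoc, f.right_act_hom, ← comp_whiskerRight_assoc, kernel.condition]; simp))
    (kernel.lift_ι _ _ _) (kernel.lift_ι _ _ _)

/-- The inclusion of the kernel. -/
noncomputable def kernelBimodι : kernelBimod f ⟶ M :=
  subBimodι M (kernel.ι f.hom) _ _ _ _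

instance : Mono (kernelBimodι f).hom := inferInstanceAs (Mono (kernel.ι f.hom))

/-- The kernel of the underlying morphism is a kernel in the category of bimodules. -/
noncomputable def kernelBimodIsLimit :
    IsLimit (KernelFork.ofι (f := f) (kernelBimodι f)
      (by ext; exact kernel.condition f.hom)) :=
  KernelFork.IsLimit.ofι _ _
    (fun g e => bimodLift (kernelBimodι f) g (kernel.lift f.hom g.hom (congrArg Bimod.Hom.hom e))
      (kernel.lift_ι _ _ _))
    (fun g e => by ext; exact kernel.lift_ι _ _ _)
    (fun g e m hm => by
      ext
      rw [← cancel_mono (kernelBimodι f).hom]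
      exact (congrArg Bimod.Hom.hom hm).trans (kernel.lift_ι _ _ _).symm)

/-- The left action descends to the cokernel, since `A ⊗ -` preserves cokernels. -/
lemma exists_cokernel_actLeft : ∃ l : A.X ⊗ cokernel f.hom ⟶ cokernel f.hom,
    N.actLeft ≫ cokernel.π f.hom = A.X ◁ cokernel.π f.hom ≫ l := by
  have h : A.X ◁ f.hom ≫ N.actLeft ≫ cokernel.π f.hom = 0 := by
    rw [← f.left_act_hom_assoc, cokernel.condition, comp_zero]
  exact ⟨(isColimitOfHasCokernelOfPreservesColimit (tensorLeft A.X) f.hom).desc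
    (CokernelCofork.ofπ _ h), ((isColimitOfHasCokernelOfPreservesColimit
      (tensorLeft A.X) f.hom).fac (CokernelCofork.ofπ _ h) WalkingParallelPair.one).symm⟩

/-- The right action descends to the cokernel, since `- ⊗ A` preserves cokernels. -/
lemma exists_cokernel_actRight : ∃ r : cokernel f.hom ⊗ A.X ⟶ cokernel f.hom,
    N.actRight ≫ cokernel.π f.hom = cokernel.π f.hom ▷ A.X ≫ r := by
  have h : f.hom ▷ A.X ≫ N.actRight ≫ cokernel.π f.hom = 0 := by
    rw [← f.right_act_hom_assoc, cokernel.condition, comp_zero]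
  exact ⟨(isColimitOfHasCokernelOfPreservesColimit (tensorRight A.X) f.hom).desc
    (CokernelCofork.ofπ _ h), ((isColimitOfHasCokernelOfPreservesColimit
      (tensorRight A.X) f.hom).fac (CokernelCofork.ofπ _ h) WalkingParallelPair.one).symm⟩

/-- The cokernel of the underlying morphism, as a bimodule. -/
noncomputable def cokernelBimod : Bimod A A :=
  quotBimod N (cokernel.π f.hom) _ _ (exists_cokernel_actLeft f).choose_spec
    (exists_cokernel_actRight f).choose_spec

/-- The projection to the cokernel. -/
noncomputable def cokernelBimodπ : N ⟶ cokernelBimod f :=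
  quotBimodπ N (cokernel.π f.hom) _ _ (exists_cokernel_actLeft f).choose_spec
    (exists_cokernel_actRight f).choose_spec

instance : Epi (cokernelBimodπ f).hom := inferInstanceAs (Epi (cokernel.π f.hom))

/-- The cokernel of the underlying morphism is a cokernel in the category of bimodules. -/
noncomputable def cokernelBimodIsColimit :
    IsColimit (CokernelCofork.ofπ (f := f) (cokernelBimodπ f)
      (by ext; exact cokernel.condition f.hom)) :=
  CokernelCofork.IsColimit.ofπ _ _
    (fun g e => bimodDescend (cokernelBimodπ f) g
      (cokernel.desc f.hom g.hom (congrArg Bimod.Hom.hom e)) (cokernel.π_desc _ _ _))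
    (fun g e => by ext; exact cokernel.π_desc _ _ _)
    (fun g e m hm => by
      ext
      rw [← cancel_epi (cokernelBimodπ f).hom]
      exact (congrArg Bimod.Hom.hom hm).trans (cokernel.π_desc _ _ _).symm)

omit [RigidCategory C] in
/-- Monomorphisms of bimodules are monomorphisms of objects, because kernels are computed on
underlying objects. -/
lemma bimod_mono_hom [Mono f] : Mono f.hom := by
  have h : kernelBimodι f = 0 := zero_of_comp_mono f (by ext; exact kernel.condition f.hom)
  exact Preadditive.mono_of_kernel_zero (congrArg Bimod.Hom.hom h)

/-- Epimorphisms of bimodules are epimorphisms of objects, because cokernels are computed on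
underlying objects. -/
lemma bimod_epi_hom [Epi f] : Epi f.hom := by
  have h : cokernelBimodπ f = 0 := zero_of_epi_comp f (by ext; exact cokernel.condition f.hom)
  exact Preadditive.epi_of_cokernel_zero (congrArg Bimod.Hom.hom h)

end Kernel

instance : HasKernels (Bimod A A) where
  has_limit f := ⟨⟨_, kernelBimodIsLimit f⟩⟩

instance : HasCokernels (Bimod A A) where
  has_colimit f := ⟨⟨_, cokernelBimodIsColimit f⟩⟩

/-- The direct sum of two bimodules. -/
noncomputable def biprodBimod (M N : Bimod A A) : Bimod A A where
  X := M.X ⊞ N.X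
  actLeft := biprod.lift (A.X ◁ biprod.fst ≫ M.actLeft) (A.X ◁ biprod.snd ≫ N.actLeft)
  actRight := biprod.lift (biprod.fst ▷ A.X ≫ M.actRight) (biprod.snd ▷ A.X ≫ N.actRight)
  one_actLeft := by
    ext <;> simp [← whisker_exchange_assoc]
  left_assoc := by
    ext
    · simp only [Category.assoc, biprod.lift_fst, ← whisker_exchange_assoc, M.left_assoc,
        ← whiskerLeft_comp_assoc]
      simp
    · simp only [Category.assoc, biprod.lift_snd, ← whisker_exchange_assoc, N.left_assoc,
        ← whiskerLeft_comp_assoc]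
      simp
  actRight_one := by
    ext <;> simp [whisker_exchange_assoc]
  right_assoc := by
    ext
    · simp only [Category.assoc, biprod.lift_fst, whisker_exchange_assoc, M.right_assoc,
        ← comp_whiskerRight_assoc]
      simp
    · simp only [Category.assoc, biprod.lift_snd, whisker_exchange_assoc, N.right_assoc,
        ← comp_whiskerRight_assoc]
      simp
  middle_assoc := by
    ext
    · simp only [Category.assoc, biprod.lift_fst, ← comp_whiskerRight_assoc,
        ← whiskerLeft_comp_assoc]
      simp
    · simp only [Category.assoc, biprod.lift_snd, ← comp_whiskerRight_assoc,
        ← whiskerLeft_comp_assoc]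
      simp

/-- The direct sum of the underlying objects is a direct sum of bimodules. -/
noncomputable def biprodBimodFan (M N : Bimod A A) : BinaryFan M N :=
  BinaryFan.mk (P := biprodBimod M N)
    ({ hom := biprod.fst, left_act_hom := biprod.lift_fst _ _,
       right_act_hom := biprod.lift_fst _ _ } : Bimod.Hom _ _)
    ({ hom := biprod.snd, left_act_hom := biprod.lift_snd _ _,
       right_act_hom := biprod.lift_snd _ _ } : Bimod.Hom _ _)

instance : HasBinaryProducts (Bimod A A) := by
  refine @hasBinaryProducts_of_hasLimit_pair _ _ fun {M N} => ⟨⟨biprodBimodFan M N, ?_⟩⟩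
  refine BinaryFan.IsLimit.mk _ (fun f g =>
    ({ hom := biprod.lift f.hom g.hom
       left_act_hom := ?_
       right_act_hom := ?_ } : Bimod.Hom _ _)) ?_ ?_ ?_
  · dsimp [biprodBimodFan, biprodBimod]
    ext <;> simp [← whiskerLeft_comp_assoc]
  · dsimp [biprodBimodFan, biprodBimod]
    ext <;> simp [← comp_whiskerRight_assoc]
  · intro T f g; ext; exact biprod.lift_fst _ _
  · intro T f g; ext; exact biprod.lift_snd _ _
  · intro T f g m h₁ h₂
    ext
    refine biprod.hom_ext _ _ ?_ ?_
    · exact (congrArg Bimod.Hom.hom h₁).trans (biprod.lift_fst _ _).symm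
    · exact (congrArg Bimod.Hom.hom h₂).trans (biprod.lift_snd _ _).symm

/-- The zero bimodule. -/
noncomputable def zeroBimod (A : Mon C) : Bimod A A where
  X := 0
  actLeft := 0
  actRight := 0
  one_actLeft := (isZero_zero C).eq_of_tgt _ _
  left_assoc := (isZero_zero C).eq_of_tgt _ _
  actRight_one := (isZero_zero C).eq_of_tgt _ _
  right_assoc := (isZero_zero C).eq_of_tgt _ _
  middle_assoc := (isZero_zero C).eq_of_tgt _ _

omit [RigidCategory C] in
lemma bimod_isZero {M : Bimod A A} (h : IsZero M.X) : IsZero M :=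
  (IsZero.iff_id_eq_zero M).2 (by ext; exact h.eq_of_tgt _ _)

omit [RigidCategory C] in
lemma bimod_isZero_X {M : Bimod A A} (h : IsZero M) : IsZero M.X :=
  (IsZero.iff_id_eq_zero M.X).2 (congrArg Bimod.Hom.hom ((IsZero.iff_id_eq_zero M).1 h))

instance : HasFiniteProducts (Bimod A A) := by
  have : HasTerminal (Bimod A A) :=
    (bimod_isZero (M := zeroBimod A) (isZero_zero C)).isTerminal.hasTerminal
  exact hasFiniteProducts_of_has_binary_and_terminal

noncomputable instance : Abelian (Bimod A A) where
  normalMonoOfMono f _ := by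
    have := bimod_mono_hom f
    have hc := Abelian.monoIsKernelOfCokernel (f := f.hom) _ (cokernelIsCokernel f.hom)
    exact ⟨{
      Z := cokernelBimod f
      g := cokernelBimodπ f
      w := by ext; exact cokernel.condition f.hom
      isLimit := KernelFork.IsLimit.ofι _ _
        (fun g e => bimodLift f g (hc.lift (KernelFork.ofι g.hom (congrArg Bimod.Hom.hom e)))
          (hc.fac (KernelFork.ofι g.hom (congrArg Bimod.Hom.hom e)) WalkingParallelPair.zero))
        (fun g e => by
          ext
          exact hc.fac (KernelFork.ofι g.hom (congrArg Bimod.Hom.hom e)) WalkingParallelPair.zero)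
        (fun g e m hm => by
          have := bimod_mono_of_mono_hom f
          rw [← cancel_mono f, hm]
          ext
          exact (hc.fac (KernelFork.ofι g.hom (congrArg Bimod.Hom.hom e))
            WalkingParallelPair.zero).symm) }⟩
  normalEpiOfEpi f _ := by
    have := bimod_epi_hom f
    have hc := Abelian.epiIsCokernelOfKernel (f := f.hom) _ (kernelIsKernel f.hom)
    exact ⟨{
      W := kernelBimod f
      g := kernelBimodι f
      w := by ext; exact kernel.condition f.hom
      isColimit := CokernelCofork.IsColimit.ofπ _ _
        (fun g e => bimodDescend f g
          (hc.desc (CokernelCofork.ofπ g.hom (congrArg Bimod.Hom.hom e)))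
          (hc.fac (CokernelCofork.ofπ g.hom (congrArg Bimod.Hom.hom e)) WalkingParallelPair.one))
        (fun g e => by
          ext
          exact hc.fac (CokernelCofork.ofπ g.hom (congrArg Bimod.Hom.hom e))
            WalkingParallelPair.one)
        (fun g e m hm => by
          have := bimod_epi_of_epi_hom f
          rw [← cancel_epi f, hm]
          ext
          exact (hc.fac (CokernelCofork.ofπ g.hom (congrArg Bimod.Hom.hom e))
            WalkingParallelPair.one).symm) }⟩

instance : MonoidalPreadditive (Bimod A A) where
  whiskerLeft_zero := by
    intros; ext; rw [← cancel_epi (bimodProj _ _), bimodProj_whiskerLeft]; simp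
  zero_whiskerRight := by
    intros; ext; rw [← cancel_epi (bimodProj _ _), bimodProj_whiskerRight]; simp
  whiskerLeft_add := by
    intros; ext; rw [← cancel_epi (bimodProj _ _), bimodProj_whiskerLeft]
    simp [bimodProj_whiskerLeft]
  add_whiskerRight := by
    intros; ext; rw [← cancel_epi (bimodProj _ _), bimodProj_whiskerRight]
    simp [bimodProj_whiskerRight]

instance (k : Type w) [Field k] [Linear k C] [MonoidalLinear k C] :
    MonoidalLinear k (Bimod A A) where
  whiskerLeft_smul := by
    intros; ext; rw [← cancel_epi (bimodProj _ _), bimodProj_whiskerLeft]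
    simp [bimodProj_whiskerLeft]
  smul_whiskerRight := by
    intros; ext; rw [← cancel_epi (bimodProj _ _), bimodProj_whiskerRight]
    simp [bimodProj_whiskerRight]

/-- Subobjects of a bimodule are subobjects of the underlying object. -/
noncomputable def subobjectBimod (M : Bimod A A) : Subobject M ↪o Subobject M.X :=
  have (S : Subobject M) : Mono S.arrow.hom := bimod_mono_hom S.arrow
  OrderEmbedding.ofMapLEIff (fun S => Subobject.mk S.arrow.hom) fun S T => by
    refine ⟨fun h => ?_, fun h => ?_⟩
    · refine Subobject.le_of_comm (bimodLift T.arrow S.arrow (Subobject.ofMkLEMk _ _ h)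
        (Subobject.ofMkLEMk_comp h)) ?_
      ext
      exact Subobject.ofMkLEMk_comp h
    · exact Subobject.mk_le_mk_of_comm (Subobject.ofLE S T h).hom
        (congrArg Bimod.Hom.hom (Subobject.ofLE_arrow h))

/-- Local finiteness is inherited from `C`: morphisms of bimodules are morphisms of objects, and
subobjects of a bimodule are subobjects of its underlying object. -/
lemma bimod_isMultitensor (k : Type w) [Field k] [Linear k C] [MonoidalLinear k C]
    (hC : IsMultitensorCategory k C) (hr : Nonempty (RigidCategory (Bimod A A))) :
    IsMultitensorCategory k (Bimod A A) where
  abelian := ⟨inferInstance, rfl⟩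
  bilinear := ⟨inferInstance, inferInstance⟩
  rigid := hr
  finite_hom M N := by
    have := hC.finite_hom M.X N.X
    exact Module.Finite.of_injective
      ({ toFun := fun f => f.hom, map_add' := fun _ _ => rfl, map_smul' := fun _ _ => rfl } :
        (M ⟶ N) →ₗ[k] (M.X ⟶ N.X)) fun f g h => by ext; exact h
  finite_length M := by
    have h₁ := (hC.finite_length M.X).1
    have h₂ := (hC.finite_length M.X).2
    exact ⟨⟨(subobjectBimod M).wellFoundedGT⟩, ⟨(subobjectBimod M).wellFoundedLT⟩⟩

end Abelian

/-! ### The grading of the category of bimodules -/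

section Grading

variable {G : Type*} [Group G] {C : Type u} [Category.{v} C] [MonoidalCategory C]
  [Preadditive C] {P : G → ObjectProperty C}

/-- A morphism from an object of degree `g` factors through the component of degree `g`. -/
lemma IsGrading.comp_π_ι (hP : IsGrading P) {X Y : C} (d : HomogeneousDecomposition P X) {g : G}
    (hY : P g Y) (f : Y ⟶ X) : f ≫ d.π g ≫ d.ι g = f := by
  conv_rhs => rw [← Category.comp_id f, ← d.sum_π_ι, Preadditive.comp_sum]
  rw [Finset.sum_eq_single g]
  · intro h _ hne
    rw [← Category.assoc, hP.hom_eq_zero hne.symm hY (d.homogeneous h) (f ≫ d.π h), zero_comp]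
  · intro hg
    have : d.ι g = 0 := by
      rw [← Category.comp_id (d.ι g), ← d.sum_π_ι, Preadditive.comp_sum]
      refine Finset.sum_eq_zero fun h hh => ?_
      rw [← Category.assoc, d.ι_π_ne g h (by rintro rfl; exact hg hh), zero_comp]
    rw [this, comp_zero, comp_zero]

/-- Quotients of objects of degree `g` have degree `g`. -/
lemma IsGrading.of_epi (hP : IsGrading P) {X Y : C} {g : G} (p : X ⟶ Y) [Epi p] (hX : P g X) :
    P g Y := by
  obtain ⟨d⟩ := hP.decomposition Y
  have h : d.π g ≫ d.ι g = 𝟙 Y := by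
    rw [← cancel_epi p, hP.comp_π_ι d hX, Category.comp_id]
  exact hP.iso_closed g ⟨d.ι g, d.π g, d.ι_π_self g, h⟩ (d.homogeneous g)

/-- Morphisms out of `Y ⊗ X` may be compared on homogeneous components of `X`. -/
lemma IsGrading.whiskerLeft_ext [MonoidalPreadditive C] (hP : IsGrading P) {X Y Z : C}
    {f f' : Y ⊗ X ⟶ Z}
    (h : ∀ (g : G) (X' : C) (_ : P g X') (i : X' ⟶ X), Y ◁ i ≫ f = Y ◁ i ≫ f') : f = f' := by
  obtain ⟨d⟩ := hP.decomposition X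
  have h₁ : 𝟙 (Y ⊗ X) = ∑ g ∈ d.support, (Y ◁ d.π g ≫ Y ◁ d.ι g) := by
    simp only [← whiskerLeft_comp]
    rw [← whiskerLeft_sum, d.sum_π_ι, whiskerLeft_id]
  rw [← Category.id_comp f, ← Category.id_comp f', h₁, Preadditive.sum_comp, Preadditive.sum_comp]
  refine Finset.sum_congr rfl fun g _ => ?_
  rw [Category.assoc, Category.assoc, h g _ (d.homogeneous g) (d.ι g)]

variable [MonoidalPreadditive C] {A : Mon C}

omit [MonoidalPreadditive C] in
lemma IsGrading.component_actLeft (hP : IsGrading P) (hA : P 1 A.X) (M : Bimod A A)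
    (d : HomogeneousDecomposition P M.X) (g : G) :
    (A.X ◁ d.ι g ≫ M.actLeft ≫ d.π g) ≫ d.ι g = A.X ◁ d.ι g ≫ M.actLeft := by
  have h := hP.tensor hA (d.homogeneous g)
  rw [one_mul] at h
  simpa using hP.comp_π_ι d h (A.X ◁ d.ι g ≫ M.actLeft)

omit [MonoidalPreadditive C] in
lemma IsGrading.component_actRight (hP : IsGrading P) (hA : P 1 A.X) (M : Bimod A A)
    (d : HomogeneousDecomposition P M.X) (g : G) :
    (d.ι g ▷ A.X ≫ M.actRight ≫ d.π g) ≫ d.ι g = d.ι g ▷ A.X ≫ M.actRight := by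
  have h := hP.tensor (d.homogeneous g) hA
  rw [mul_one] at h
  simpa using hP.comp_π_ι d h (d.ι g ▷ A.X ≫ M.actRight)

/-- The homogeneous component of degree `g` of a bimodule over a neutral algebra. -/
def componentBimod (hP : IsGrading P) (hA : P 1 A.X) (M : Bimod A A)
    (d : HomogeneousDecomposition P M.X) (g : G) : Bimod A A :=
  have : Mono (d.ι g) := mono_of_mono_fac (d.ι_π_self g)
  subBimod M (d.ι g) _ _ (hP.component_actLeft hA M d g) (hP.component_actRight hA M d g)

/-- The inclusion of a homogeneous component. -/
def componentBimodι (hP : IsGrading P) (hA : P 1 A.X) (M : Bimod A A)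
    (d : HomogeneousDecomposition P M.X) (g : G) : componentBimod hP hA M d g ⟶ M :=
  ({ hom := d.ι g
     left_act_hom := hP.component_actLeft hA M d g
     right_act_hom := hP.component_actRight hA M d g } : Bimod.Hom _ _)

/-- The projection to a homogeneous component. -/
def componentBimodπ (hP : IsGrading P) (hA : P 1 A.X) (M : Bimod A A)
    (d : HomogeneousDecomposition P M.X) (g : G) : M ⟶ componentBimod hP hA M d g :=
  ({ hom := d.π g
     left_act_hom := by
       refine hP.whiskerLeft_ext fun h X' hX' i => ?_
       dsimp only [componentBimod, subBimod]
       rcases eq_or_ne h g with rfl | hne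
       · simp only [← whiskerLeft_comp_assoc, hP.comp_π_ι d hX']
       · have h₁ := hP.tensor hA hX'
         rw [one_mul] at h₁
         rw [hP.hom_eq_zero hne h₁ (d.homogeneous g) (A.X ◁ i ≫ M.actLeft ≫ d.π g),
           ← whiskerLeft_comp_assoc, hP.hom_eq_zero hne hX' (d.homogeneous g) (i ≫ d.π g)]
         simp
     right_act_hom := by
       refine homogeneous_ext hP fun h X' hX' i => ?_
       dsimp only [componentBimod, subBimod]
       rcases eq_or_ne h g with rfl | hne
       · simp only [← comp_whiskerRight_assoc, hP.comp_π_ι d hX']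
       · have h₁ := hP.tensor hX' hA
         rw [mul_one] at h₁
         rw [hP.hom_eq_zero hne h₁ (d.homogeneous g) (i ▷ A.X ≫ M.actRight ≫ d.π g),
           ← comp_whiskerRight_assoc, hP.hom_eq_zero hne hX' (d.homogeneous g) (i ≫ d.π g)]
         simp } : Bimod.Hom _ _)

end Grading

/-- The category of bimodules over a neutral algebra is graded by the degree of the underlying
objects: `M ⊗_A N` is a quotient of `M ⊗ N`, and homogeneous components are stable under `A`. -/
lemma EquivariantAlgebra.isGrading {G : Type*} [Group G] {C : Type u} [Category.{v} C]
    [MonoidalCategory C] [Abelian C] [MonoidalPreadditive C] [RigidCategory C]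
    {P : G → ObjectProperty C} {γ : G → C ⥤ C} [MonoidalAction γ]
    (A : EquivariantAlgebra γ) (hP : IsGrading P) (hA : P 1 A.alg.X) :
    IsGrading (A.grading P) where
  iso_closed g M N e h := hP.iso_closed g ((Bimod.forget A.alg).mapIso e) h
  zero g M h := hP.zero g (bimod_isZero_X h)
  hom_eq_zero hne hM hN f := by ext; exact hP.hom_eq_zero hne hM hN f.hom
  decomposition M := by
    obtain ⟨d⟩ := hP.decomposition M.X
    refine ⟨{
      support := d.support
      component := componentBimod hP hA M d
      homogeneous := d.homogeneous
      ι := componentBimodι hP hA M d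
      π := componentBimodπ hP hA M d
      ι_π_self := fun g => by ext; exact d.ι_π_self g
      ι_π_ne := fun g h hne => by ext; exact d.ι_π_ne g h hne
      sum_π_ι := ?_ }⟩
    have h (s : Finset G) : (∑ g ∈ s, componentBimodπ hP hA M d g ≫
        componentBimodι hP hA M d g).hom = ∑ g ∈ s, d.π g ≫ d.ι g := by
      classical
      induction s using Finset.induction_on with
      | empty => rfl
      | insert a s ha ih =>
        rw [Finset.sum_insert ha, Finset.sum_insert ha, bimod_add_hom, ih]
        rfl
    ext
    rw [h, d.sum_π_ι]
    rfl
  tensor {g h M N} hM hN := hP.of_epi (bimodProj M N) (hP.tensor hM hN)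

/-! ### Rotation of pairings in a pivotal category -/

section Duals

variable {D : Type u} [Category.{v} D] [MonoidalCategory D]

/-- Pairings of `Y` with `X` correspond to morphisms from `Y` to the dual of `X`; this lemma and
`evaluation_left_ext` are the two halves of the correspondence. -/
lemma toDual_evaluation {X Y : D} [HasRightDual X] (e : Y ⊗ X ⟶ 𝟙_ D) :
    toDual e ▷ X ≫ ε_ X Xᘁ = e := by
  have h := (tensorRightHomEquiv Y X Xᘁ (𝟙_ D)).left_inv e
  have h' : (tensorRightHomEquiv Y X Xᘁ (𝟙_ D)).invFun
      ((tensorRightHomEquiv Y X Xᘁ (𝟙_ D)).toFun e) = toDual e ▷ X ≫ ε_ X Xᘁ := by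
    dsimp [tensorRightHomEquiv, toDual]
    monoidal
  rw [← h', h]

lemma evaluation_left_ext {X X' Y : D} [ExactPairing X X'] {f g : Y ⟶ X'}
    (h : f ▷ X ≫ ε_ X X' = g ▷ X ≫ ε_ X X') : f = g := by
  have h₁ (f : Y ⟶ X') : (tensorRightHomEquiv Y X X' (𝟙_ D)) (f ▷ X ≫ ε_ X X') =
      f ≫ (λ_ X').inv := by
    dsimp [tensorRightHomEquiv]
    have := ExactPairing.coevaluation_evaluation X X'
    rw [comp_whiskerRight, ← associator_inv_naturality_left_assoc, whisker_exchange_assoc, this]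
    simp
  have h₂ := h₁ f
  rw [h, h₁ g] at h₂
  simpa using h₂.symm

lemma exists_evaluation_eq {X X' Y : D} [ExactPairing X X'] (e : Y ⊗ X ⟶ 𝟙_ D) :
    ∃ t : Y ⟶ X', t ▷ X ≫ ε_ X X' = e := by
  let : HasRightDual X := ⟨X'⟩
  exact ⟨toDual e, toDual_evaluation e⟩

lemma toDual_whiskerRight {X Y Y' : D} [HasRightDual X] (h : Y' ⟶ Y) (e : Y ⊗ X ⟶ 𝟙_ D) :
    toDual (h ▷ X ≫ e) = h ≫ toDual e :=
  evaluation_left_ext (X := X) (by rw [toDual_evaluation, comp_whiskerRight, Category.assoc,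
    toDual_evaluation])

lemma toDual_whiskerLeft {X X' Y : D} [HasRightDual X] [HasRightDual X'] (f : X ⟶ X')
    (e : Y ⊗ X' ⟶ 𝟙_ D) : toDual (Y ◁ f ≫ e) = toDual e ≫ fᘁ :=
  evaluation_left_ext (X := X) (by
    rw [toDual_evaluation, comp_whiskerRight, Category.assoc, rightAdjointMate_comp_evaluation,
      ← whisker_exchange_assoc, toDual_evaluation])

lemma toDual_self {X : D} [HasRightDual X] : toDual (ε_ X Xᘁ) = 𝟙 (Xᘁ) :=
  evaluation_left_ext (X := X) (by rw [toDual_evaluation]; simp)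

/-- `Realizes` in terms of pairings instead of morphisms to duals: `f` followed by the pairing `e'`
is the pairing of `X` with `Y` that `d` and `e` define. -/
lemma realizes_iff [RigidCategory D] {X Y Z : D} (d : X ⟶ (Xᘁ)ᘁ) (e : Y ⊗ X ⟶ 𝟙_ D)
    (e' : Z ⊗ Y ⟶ 𝟙_ D) (f : X ⟶ Z) :
    Realizes d e e' f ↔ f ▷ Y ≫ e' = d ▷ Y ≫ (Xᘁ)ᘁ ◁ toDual e ≫ ε_ (Xᘁ) ((Xᘁ)ᘁ) := by
  have h₁ : (f ≫ toDual e') ▷ Y ≫ ε_ Y Yᘁ = f ▷ Y ≫ e' := by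
    rw [comp_whiskerRight, Category.assoc, toDual_evaluation]
  have h₂ : (d ≫ (toDual e)ᘁ) ▷ Y ≫ ε_ Y Yᘁ =
      d ▷ Y ≫ (Xᘁ)ᘁ ◁ toDual e ≫ ε_ (Xᘁ) ((Xᘁ)ᘁ) := by
    rw [comp_whiskerRight, Category.assoc, rightAdjointMate_comp_evaluation]
  rw [← h₁, ← h₂]
  exact ⟨fun h => by rw [show f ≫ toDual e' = _ from h], evaluation_left_ext⟩

variable [RigidCategory D] (δ : PivotalStructure D)

/-- The rotation `X ⊗ Y ⟶ 𝟙` of a pairing `Y ⊗ X ⟶ 𝟙` by the pivotal structure. -/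
def PivotalStructure.rotate {X Y : D} (e : Y ⊗ X ⟶ 𝟙_ D) : X ⊗ Y ⟶ 𝟙_ D :=
  (δ.iso X).hom ▷ Y ≫ (Xᘁ)ᘁ ◁ toDual e ≫ ε_ (Xᘁ) ((Xᘁ)ᘁ)

namespace PivotalStructure

lemma realizes_iff {X Y Z : D} (e : Y ⊗ X ⟶ 𝟙_ D) (e' : Z ⊗ Y ⟶ 𝟙_ D) (f : X ⟶ Z) :
    Realizes (δ.iso X).hom e e' f ↔ f ▷ Y ≫ e' = δ.rotate e :=
  EquivariantTensor.realizes_iff _ _ _ _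

lemma rotate_whiskerRight {X Y Y' : D} (h : Y' ⟶ Y) (e : Y ⊗ X ⟶ 𝟙_ D) :
    δ.rotate (h ▷ X ≫ e) = X ◁ h ≫ δ.rotate e := by
  rw [rotate, rotate, toDual_whiskerRight, whiskerLeft_comp, Category.assoc,
    whisker_exchange_assoc]

lemma rotate_whiskerLeft {X X' Y : D} (f : X ⟶ X') (e : Y ⊗ X' ⟶ 𝟙_ D) :
    δ.rotate (Y ◁ f ≫ e) = f ▷ Y ≫ δ.rotate e := by
  rw [rotate, rotate, toDual_whiskerLeft, whiskerLeft_comp, Category.assoc,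
    ← rightAdjointMate_comp_evaluation, whisker_exchange_assoc, ← comp_whiskerRight_assoc,
    ← δ.naturality, comp_whiskerRight_assoc]

/-- The rotation of the evaluation of `X` determines the pivotal structure at `X`. -/
lemma rotate_evaluation (X : D) :
    δ.rotate (ε_ X Xᘁ) = (δ.iso X).hom ▷ Xᘁ ≫ ε_ (Xᘁ) ((Xᘁ)ᘁ) := by
  rw [rotate, toDual_self, whiskerLeft_id, Category.id_comp]

/-- Rotating `X ⊗ Y` past `Z` is the same as rotating first `Y` past `Z ⊗ X` and then `X` past
`Y ⊗ Z`. This is the monoidality of the pivotal structure. -/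
lemma rotate_tensor {X Y Z : D} (e : Z ⊗ (X ⊗ Y) ⟶ 𝟙_ D) :
    δ.rotate e = (α_ X Y Z).hom ≫
      δ.rotate ((α_ Y Z X).hom ≫ δ.rotate ((α_ Z X Y).hom ≫ e)) := by
  -- Every pairing is pulled back from an evaluation, and rotation commutes with the pullback.
  obtain ⟨t, rfl⟩ := exists_evaluation_eq (X := X ⊗ Y) (X' := Yᘁ ⊗ Xᘁ) e
  have hN : (α_ (Yᘁ ⊗ Xᘁ) X Y).hom ≫ ε_ (X ⊗ Y) (Yᘁ ⊗ Xᘁ) =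
      ((α_ Yᘁ Xᘁ X).hom ≫ Yᘁ ◁ ε_ X Xᘁ ≫ (ρ_ Yᘁ).hom) ▷ Y ≫ ε_ Y Yᘁ := by
    rw [ExactPairing.tensor_evaluation]
    monoidal
  have hN' : (α_ Y (Yᘁ ⊗ Xᘁ) X).hom ≫ Y ◁ ((α_ Yᘁ Xᘁ X).hom ≫ Yᘁ ◁ ε_ X Xᘁ ≫ (ρ_ Yᘁ).hom) ≫
      δ.rotate (ε_ Y Yᘁ) =
      ((α_ Y Yᘁ Xᘁ).inv ≫ δ.rotate (ε_ Y Yᘁ) ▷ Xᘁ ≫ (λ_ Xᘁ).hom) ▷ X ≫ ε_ X Xᘁ := by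
    calc _ = 𝟙 _ ⊗≫ ((Y ⊗ Yᘁ) ◁ ε_ X Xᘁ ≫ δ.rotate (ε_ Y Yᘁ) ▷ 𝟙_ D) ⊗≫ 𝟙 _ := by monoidal
      _ = 𝟙 _ ⊗≫ (δ.rotate (ε_ Y Yᘁ) ▷ (Xᘁ ⊗ X) ≫ 𝟙_ D ◁ ε_ X Xᘁ) ⊗≫ 𝟙 _ := by
        rw [whisker_exchange]
      _ = _ := by monoidal
  have hm := (δ.realizes_iff _ _ _).1 (δ.monoidal X Y)
  rw [rotate_whiskerRight, ← associator_naturality_left_assoc, rotate_whiskerRight,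
    ← associator_naturality_middle_assoc, rotate_whiskerRight, hN, rotate_whiskerRight, hN',
    rotate_whiskerRight, ← associator_naturality_right_assoc, ← hm]
  congr 1
  rw [ExactPairing.tensor_evaluation, rotate_evaluation, rotate_evaluation]
  calc _ = 𝟙 _ ⊗≫ (δ.iso X).hom ▷ (Y ⊗ Yᘁ ⊗ Xᘁ) ⊗≫ (Xᘁ)ᘁ ◁ ((δ.iso Y).hom ▷ Yᘁ ≫
        ε_ Yᘁ (Yᘁ)ᘁ) ▷ Xᘁ ⊗≫ ε_ Xᘁ (Xᘁ)ᘁ := by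
        rw [MonoidalCategory.tensorHom_def]
        monoidal
    _ = 𝟙 _ ⊗≫ ((δ.iso X).hom ▷ ((Y ⊗ Yᘁ) ⊗ Xᘁ) ≫ (Xᘁ)ᘁ ◁ (((δ.iso Y).hom ▷ Yᘁ ≫
        ε_ Yᘁ (Yᘁ)ᘁ) ▷ Xᘁ)) ⊗≫ ε_ Xᘁ (Xᘁ)ᘁ := by monoidal
    _ = 𝟙 _ ⊗≫ (X ◁ (((δ.iso Y).hom ▷ Yᘁ ≫ ε_ Yᘁ (Yᘁ)ᘁ) ▷ Xᘁ) ≫ (δ.iso X).hom ▷ (𝟙_ D ⊗ Xᘁ)) ⊗≫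
        ε_ Xᘁ (Xᘁ)ᘁ := by rw [← whisker_exchange]
    _ = _ := by monoidal

end PivotalStructure

end Duals

/-! ### Frobenius algebras and dual bimodules -/

namespace EquivariantFrobeniusAlgebra

variable {G : Type*} [Group G] {C : Type u} [Category.{v} C] [MonoidalCategory C]
  {γ : G → C ⥤ C} [MonoidalAction γ] (A : EquivariantFrobeniusAlgebra γ)

lemma one_form : MonObj.one (X := A.alg.X) ▷ A.alg.X ≫ A.form =
    (λ_ A.alg.X).hom ≫ ComonObj.counit (X := A.alg.X) := by
  rw [form, MonObj.one_mul_assoc]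

lemma form_one : A.alg.X ◁ MonObj.one (X := A.alg.X) ≫ A.form =
    (ρ_ A.alg.X).hom ≫ ComonObj.counit (X := A.alg.X) := by
  rw [form, MonObj.mul_one_assoc]

lemma mul_form : MonObj.mul (X := A.alg.X) ▷ A.alg.X ≫ A.form =
    (α_ _ _ _).hom ≫ A.alg.X ◁ MonObj.mul (X := A.alg.X) ≫ A.form := by
  rw [form, MonObj.mul_assoc_assoc]

/-- The Frobenius form makes `A` a dual of itself, with coevaluation `Δ ∘ η`. -/
@[reducible]
def exactPairing : ExactPairing A.alg.X A.alg.X where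
  coevaluation' := MonObj.one (X := A.alg.X) ≫ ComonObj.comul (X := A.alg.X)
  evaluation' := A.form
  coevaluation_evaluation' := by
    have h := A.frobenius_left
    have h₁ := ComonObj.counit_comul (A.alg.X)
    calc _ = A.alg.X ◁ MonObj.one (X := A.alg.X) ≫ (A.alg.X ◁ ComonObj.comul (X := A.alg.X) ≫
        (α_ _ _ _).inv ≫ MonObj.mul (X := A.alg.X) ▷ A.alg.X) ≫
          ComonObj.counit (X := A.alg.X) ▷ A.alg.X := by
          rw [form]; simp only [whiskerLeft_comp, comp_whiskerRight, Category.assoc]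
      _ = _ := by rw [h, Category.assoc, h₁, MonObj.mul_one_assoc]
  evaluation_coevaluation' := by
    have h := A.frobenius_right
    have h₁ := ComonObj.comul_counit (A.alg.X)
    calc _ = MonObj.one (X := A.alg.X) ▷ A.alg.X ≫ (ComonObj.comul (X := A.alg.X) ▷ A.alg.X ≫
        (α_ _ _ _).hom ≫ A.alg.X ◁ MonObj.mul (X := A.alg.X)) ≫
          A.alg.X ◁ ComonObj.counit (X := A.alg.X) := by
          rw [form]; simp only [whiskerLeft_comp, comp_whiskerRight, Category.assoc]
      _ = _ := by rw [h, Category.assoc, h₁, MonObj.one_mul_assoc]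

/-- The Frobenius form is nondegenerate. -/
lemma form_left_ext {Y : C} {f g : Y ⟶ A.alg.X} (h : f ▷ A.alg.X ≫ A.form = g ▷ A.alg.X ≫ A.form) :
    f = g :=
  let := A.exactPairing
  evaluation_left_ext h

/-- The morphism `Y ⟶ A` which corresponds to a pairing of `Y` with `A` under the form. -/
def toAlg {Y : C} (f : Y ⊗ A.alg.X ⟶ 𝟙_ C) : Y ⟶ A.alg.X :=
  let : HasRightDual A.alg.X := { rightDual := A.alg.X, exact := A.exactPairing }
  toDual f

lemma toAlg_form {Y : C} (f : Y ⊗ A.alg.X ⟶ 𝟙_ C) : A.toAlg f ▷ A.alg.X ≫ A.form = f :=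
  let : HasRightDual A.alg.X := { rightDual := A.alg.X, exact := A.exactPairing }
  toDual_evaluation f

/-- Morphisms to `A` which are linear for a right action are determined by their composites with
the counit: `ε(f(y) a) = ε(f(y a))`, and the form is nondegenerate. -/
lemma comp_counit_ext_right {Y : C} (r : Y ⊗ A.alg.X ⟶ Y) {f g : Y ⟶ A.alg.X}
    (hf : r ≫ f = f ▷ A.alg.X ≫ MonObj.mul (X := A.alg.X))
    (hg : r ≫ g = g ▷ A.alg.X ≫ MonObj.mul (X := A.alg.X))
    (h : f ≫ ComonObj.counit (X := A.alg.X) = g ≫ ComonObj.counit (X := A.alg.X)) : f = g := by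
  apply A.form_left_ext
  rw [form, ← reassoc_of% hf, h, reassoc_of% hg]

variable [RigidCategory C] (M : Bimod A.alg A.alg)

/-- The `A`-valued evaluation `⟨φ, x⟩_A` of `M^∨` and `M`, defined by `ε(⟨φ, x⟩_A a) = φ(x a)`. -/
def evalAlg : M.Xᘁ ⊗ M.X ⟶ A.alg.X :=
  A.toAlg ((α_ _ _ _).hom ≫ (M.Xᘁ : C) ◁ M.actRight ≫ ε_ M.X M.Xᘁ)

/-- The defining property `ε(⟨φ, x⟩_A a) = φ(x a)` of the `A`-valued evaluation. -/
lemma evalAlg_form : A.evalAlg M ▷ A.alg.X ≫ A.form =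
    (α_ _ _ _).hom ≫ (M.Xᘁ : C) ◁ M.actRight ≫ ε_ M.X M.Xᘁ :=
  A.toAlg_form _

lemma evalAlg_counit : A.evalAlg M ≫ ComonObj.counit (X := A.alg.X) = ε_ M.X M.Xᘁ := by
  have h := congrArg (fun t => (ρ_ _).inv ≫ ((M.Xᘁ : C) ⊗ M.X) ◁ MonObj.one (X := A.alg.X) ≫ t)
    (A.evalAlg_form M)
  rw [whisker_exchange_assoc, form_one, associator_naturality_right_assoc,
    ← whiskerLeft_comp_assoc, M.actRight_one] at h
  rw [← rightUnitor_inv_naturality_assoc, Iso.inv_hom_id_assoc] at h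
  rw [h]
  monoidal

lemma evalAlg_actRight : (α_ _ _ _).hom ≫ (M.Xᘁ : C) ◁ M.actRight ≫ A.evalAlg M =
    A.evalAlg M ▷ A.alg.X ≫ MonObj.mul (X := A.alg.X) := by
  apply A.form_left_ext
  have h : ((M.Xᘁ : C) ⊗ M.X) ◁ MonObj.mul (X := A.alg.X) ≫ (α_ _ _ _).hom ≫
      (M.Xᘁ : C) ◁ M.actRight =
      (α_ _ _ _).inv ≫ ((α_ _ _ _).hom ≫ (M.Xᘁ : C) ◁ M.actRight) ▷ A.alg.X ≫ (α_ _ _ _).hom ≫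
        (M.Xᘁ : C) ◁ M.actRight := by
    rw [associator_naturality_right_assoc, ← whiskerLeft_comp, M.right_assoc]
    monoidal
  have e := A.evalAlg_form M
  simp only [comp_whiskerRight, Category.assoc]
  rw [mul_form, associator_naturality_left_assoc, ← whisker_exchange_assoc, e,
    reassoc_of% h]
  simp only [comp_whiskerRight, Category.assoc, Iso.hom_inv_id_assoc]

/-- The right action on the dual of a bimodule, `(φ a)(x) = φ(a x)`. -/
def dualActRight : M.Xᘁ ⊗ A.alg.X ⟶ M.Xᘁ :=
  toDual ((α_ _ _ _).hom ≫ (M.Xᘁ : C) ◁ M.actLeft ≫ ε_ M.X M.Xᘁ)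

/-- The left action on the dual of a bimodule, `(a φ)(x) = ε(a ⟨φ, x⟩_A)`. For a symmetric form this
is `φ(x a)`; without symmetry it differs from it by the Nakayama automorphism of `A`. -/
def dualActLeft : A.alg.X ⊗ M.Xᘁ ⟶ M.Xᘁ :=
  toDual ((α_ _ _ _).hom ≫ A.alg.X ◁ A.evalAlg M ≫ A.form)

lemma dualActRight_evaluation : A.dualActRight M ▷ M.X ≫ ε_ M.X M.Xᘁ =
    (α_ _ _ _).hom ≫ (M.Xᘁ : C) ◁ M.actLeft ≫ ε_ M.X M.Xᘁ :=
  toDual_evaluation _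

lemma dualActLeft_evaluation : A.dualActLeft M ▷ M.X ≫ ε_ M.X M.Xᘁ =
    (α_ _ _ _).hom ≫ A.alg.X ◁ A.evalAlg M ≫ A.form :=
  toDual_evaluation _

lemma dualActRight_evalAlg : A.dualActRight M ▷ M.X ≫ A.evalAlg M =
    (α_ _ _ _).hom ≫ (M.Xᘁ : C) ◁ M.actLeft ≫ A.evalAlg M := by
  apply A.form_left_ext
  have e := A.evalAlg_form M
  simp only [comp_whiskerRight, Category.assoc]
  rw [e, associator_naturality_left_assoc, ← whisker_exchange_assoc, dualActRight_evaluation,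
    associator_naturality_middle_assoc, ← whiskerLeft_comp_assoc, M.middle_assoc]
  monoidal

lemma dualActLeft_evalAlg : A.dualActLeft M ▷ M.X ≫ A.evalAlg M =
    (α_ _ _ _).hom ≫ A.alg.X ◁ A.evalAlg M ≫ MonObj.mul (X := A.alg.X) := by
  apply A.form_left_ext
  have e := A.evalAlg_form M
  have e' := A.evalAlg_actRight M
  simp only [comp_whiskerRight, Category.assoc]
  rw [e, associator_naturality_left_assoc, ← whisker_exchange_assoc, dualActLeft_evaluation,
    mul_form, associator_naturality_middle_assoc, ← whiskerLeft_comp_assoc _ (_ ▷ _), ← e']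
  monoidal

/-- The dual of a bimodule over a Frobenius algebra. -/
abbrev dualBimod : Bimod A.alg A.alg where
  X := M.Xᘁ
  actLeft := A.dualActLeft M
  actRight := A.dualActRight M
  one_actLeft := by
    apply evaluation_left_ext (X := M.X)
    rw [comp_whiskerRight_assoc, dualActLeft_evaluation, associator_naturality_left_assoc,
      ← whisker_exchange_assoc, one_form, leftUnitor_naturality_assoc, evalAlg_counit]
    monoidal
  left_assoc := by
    apply evaluation_left_ext (X := M.X)
    have e := A.dualActLeft_evalAlg M
    simp only [comp_whiskerRight, Category.assoc]
    rw [dualActLeft_evaluation, associator_naturality_left_assoc, ← whisker_exchange_assoc,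
      mul_form, associator_naturality_middle_assoc, ← whiskerLeft_comp_assoc _ (_ ▷ _), e]
    monoidal
  actRight_one := by
    apply evaluation_left_ext (X := M.X)
    rw [comp_whiskerRight_assoc, dualActRight_evaluation, associator_naturality_middle_assoc,
      ← whiskerLeft_comp_assoc, M.one_actLeft]
    monoidal
  right_assoc := by
    apply evaluation_left_ext (X := M.X)
    simp only [comp_whiskerRight, Category.assoc]
    rw [dualActRight_evaluation, associator_naturality_middle_assoc,
      ← whiskerLeft_comp_assoc, M.left_assoc, associator_naturality_left_assoc,
      ← whisker_exchange_assoc, dualActRight_evaluation]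
    monoidal
  middle_assoc := by
    apply evaluation_left_ext (X := M.X)
    have e := A.dualActRight_evalAlg M
    simp only [comp_whiskerRight, Category.assoc]
    rw [dualActRight_evaluation, associator_naturality_left_assoc, ← whisker_exchange_assoc,
      dualActLeft_evaluation, associator_naturality_middle_assoc,
      ← whiskerLeft_comp_assoc _ (_ ▷ _), e]
    monoidal

end EquivariantFrobeniusAlgebra

/-! ### Rigidity of the category of bimodules -/

section Unit

variable {C : Type u} [Category.{v} C] [MonoidalCategory C] [HasCoequalizers C] [RigidCategory C]
  {A : Mon C}

/-- The morphism to the unit bimodule `A` given by a bilinear morphism of objects. -/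
def homToUnit {Q : Bimod A A} (f : Q.X ⟶ A.X)
    (hl : Q.actLeft ≫ f = A.X ◁ f ≫ MonObj.mul (X := A.X))
    (hr : Q.actRight ≫ f = f ▷ A.X ≫ MonObj.mul (X := A.X)) : Q ⟶ 𝟙_ (Bimod A A) :=
  ({ hom := f, left_act_hom := hl, right_act_hom := hr } : Bimod.Hom Q (Bimod.regular A))

/-- The morphism from the unit bimodule `A` given by a bilinear morphism of objects. -/
def homFromUnit {Q : Bimod A A} (f : A.X ⟶ Q.X)
    (hl : MonObj.mul (X := A.X) ≫ f = A.X ◁ f ≫ Q.actLeft)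
    (hr : MonObj.mul (X := A.X) ≫ f = f ▷ A.X ≫ Q.actRight) : 𝟙_ (Bimod A A) ⟶ Q :=
  ({ hom := f, left_act_hom := hl, right_act_hom := hr } : Bimod.Hom (Bimod.regular A) Q)

/-- The morphism of objects underlying a morphism to the unit bimodule `A`. It is stated separately
because the underlying object of the unit bimodule is `A` only by unfolding, which `rw` does not
see. -/
def toUnitHom {Q : Bimod A A} (f : Q ⟶ 𝟙_ (Bimod A A)) : Q.X ⟶ A.X := f.hom

/-- The morphism of objects underlying a morphism from the unit bimodule `A`. -/
def fromUnitHom {Q : Bimod A A} (f : 𝟙_ (Bimod A A) ⟶ Q) : A.X ⟶ Q.X := f.hom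

@[simp]
lemma toUnitHom_homToUnit {Q : Bimod A A} (f : Q.X ⟶ A.X)
    (hl : Q.actLeft ≫ f = A.X ◁ f ≫ MonObj.mul (X := A.X))
    (hr : Q.actRight ≫ f = f ▷ A.X ≫ MonObj.mul (X := A.X)) : toUnitHom (homToUnit f hl hr) = f :=
  rfl

@[simp]
lemma fromUnitHom_homFromUnit {Q : Bimod A A} (f : A.X ⟶ Q.X)
    (hl : MonObj.mul (X := A.X) ≫ f = A.X ◁ f ≫ Q.actLeft)
    (hr : MonObj.mul (X := A.X) ≫ f = f ▷ A.X ≫ Q.actRight) :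
    fromUnitHom (homFromUnit f hl hr) = f :=
  rfl

lemma toUnitHom_comp {Q Q' : Bimod A A} (g : Q ⟶ Q') (f : Q' ⟶ 𝟙_ (Bimod A A)) :
    toUnitHom (g ≫ f) = g.hom ≫ toUnitHom f := rfl

lemma toUnitHom_actLeft {Q : Bimod A A} (f : Q ⟶ 𝟙_ (Bimod A A)) :
    Q.actLeft ≫ toUnitHom f = A.X ◁ toUnitHom f ≫ MonObj.mul (X := A.X) := f.left_act_hom

lemma toUnitHom_actRight {Q : Bimod A A} (f : Q ⟶ 𝟙_ (Bimod A A)) :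
    Q.actRight ≫ toUnitHom f = toUnitHom f ▷ A.X ≫ MonObj.mul (X := A.X) := f.right_act_hom

lemma toUnitHom_ext {Q : Bimod A A} {f g : Q ⟶ 𝟙_ (Bimod A A)} (h : toUnitHom f = toUnitHom g) :
    f = g := Bimod.hom_ext _ _ h

lemma bimodProj_toUnitHom_left {Q : Bimod A A} (f : Q ⟶ 𝟙_ (Bimod A A)) (N : Bimod A A) :
    bimodProj Q N ≫ (f ▷ N).hom ≫ (λ_ N).hom.hom = toUnitHom f ▷ N.X ≫ N.actLeft := by
  rw [reassoc_of% bimodProj_whiskerRight]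
  exact congrArg (f.hom ▷ N.X ≫ ·) (bimodProj_leftUnitor N)

lemma bimodProj_toUnitHom_right {Q : Bimod A A} (f : Q ⟶ 𝟙_ (Bimod A A)) (N : Bimod A A) :
    bimodProj N Q ≫ (N ◁ f).hom ≫ (ρ_ N).hom.hom = N.X ◁ toUnitHom f ≫ N.actRight := by
  rw [reassoc_of% bimodProj_whiskerLeft]
  exact congrArg (N.X ◁ f.hom ≫ ·) (bimodProj_rightUnitor N)

lemma leftUnitor_inv_fromUnitHom {Q : Bimod A A} (f : 𝟙_ (Bimod A A) ⟶ Q) (N : Bimod A A) :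
    (λ_ N).inv.hom ≫ (f ▷ N).hom =
      (λ_ N.X).inv ≫ (MonObj.one (X := A.X) ≫ fromUnitHom f) ▷ N.X ≫ bimodProj Q N := by
  conv_rhs => rw [comp_whiskerRight, Category.assoc]
  rw [leftUnitor_inv_hom]
  exact ((Category.assoc _ _ _).trans (congrArg _ (Category.assoc _ _ _))).trans
    (congrArg (fun t => (λ_ N.X).inv ≫ MonObj.one (X := A.X) ▷ N.X ≫ t)
      (bimodProj_whiskerRight f N))

lemma rightUnitor_inv_fromUnitHom {Q : Bimod A A} (f : 𝟙_ (Bimod A A) ⟶ Q) (N : Bimod A A) :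
    (ρ_ N).inv.hom ≫ (N ◁ f).hom =
      (ρ_ N.X).inv ≫ N.X ◁ (MonObj.one (X := A.X) ≫ fromUnitHom f) ≫ bimodProj N Q := by
  conv_rhs => rw [whiskerLeft_comp, Category.assoc]
  rw [rightUnitor_inv_hom]
  exact ((Category.assoc _ _ _).trans (congrArg _ (Category.assoc _ _ _))).trans
    (congrArg (fun t => (ρ_ N.X).inv ≫ N.X ◁ MonObj.one (X := A.X) ≫ t)
      (bimodProj_whiskerLeft N f))

end Unit

namespace EquivariantFrobeniusAlgebra

variable {G : Type*} [Group G] {C : Type u} [Category.{v} C] [MonoidalCategory C]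
  {γ : G → C ⥤ C} [MonoidalAction γ] (A : EquivariantFrobeniusAlgebra γ) [RigidCategory C]
  (M : Bimod A.alg A.alg)

/-- The coevaluation `a ↦ ∑ a xᵢ ⊗ φᵢ` of `M` and `M^∨`, before it is projected to `M ⊗_A M^∨`. -/
def coevalAlg : A.alg.X ⟶ M.X ⊗ M.Xᘁ :=
  (ρ_ A.alg.X).inv ≫ A.alg.X ◁ η_ M.X M.Xᘁ ≫ (α_ _ _ _).inv ≫ M.actLeft ▷ (M.Xᘁ : C)

lemma one_coevalAlg : MonObj.one (X := A.alg.X) ≫ A.coevalAlg M = η_ M.X M.Xᘁ := by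
  rw [coevalAlg, rightUnitor_inv_naturality_assoc, ← whisker_exchange_assoc,
    associator_inv_naturality_left_assoc, ← comp_whiskerRight, M.one_actLeft]
  monoidal

/-- `∑ a xᵢ ⊗ φᵢ = ∑ xᵢ ⊗ φᵢ a`. -/
lemma coevalAlg_eq : A.coevalAlg M = (λ_ A.alg.X).inv ≫ η_ M.X M.Xᘁ ▷ A.alg.X ≫ (α_ _ _ _).hom ≫
    M.X ◁ A.dualActRight M := by
  have h (f : A.alg.X ⟶ M.X ⊗ M.Xᘁ) : (tensorRightHomEquiv A.alg.X M.X M.Xᘁ M.X).symm f =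
      f ▷ M.X ≫ (α_ _ _ _).hom ≫ M.X ◁ ε_ M.X M.Xᘁ ≫ (ρ_ _).hom := rfl
  apply (tensorRightHomEquiv A.alg.X M.X M.Xᘁ M.X).symm.injective
  rw [h, h]
  have z := ExactPairing.evaluation_coevaluation M.X (M.Xᘁ : C)
  have z' := ExactPairing.evaluation_coevaluation'' M.X (M.Xᘁ : C)
  trans M.actLeft
  · rw [coevalAlg]
    calc _ = 𝟙 _ ⊗≫ A.alg.X ◁ η_ M.X M.Xᘁ ▷ M.X ⊗≫ (M.actLeft ▷ ((M.Xᘁ : C) ⊗ M.X) ≫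
          M.X ◁ ε_ M.X M.Xᘁ) ⊗≫ 𝟙 _ := by monoidal
      _ = 𝟙 _ ⊗≫ A.alg.X ◁ (η_ M.X M.Xᘁ ▷ M.X ⊗≫ M.X ◁ ε_ M.X M.Xᘁ) ⊗≫ M.actLeft := by
        rw [← whisker_exchange]; monoidal
      _ = _ := by rw [z']; monoidal
  · have e := A.dualActRight_evaluation M
    calc M.actLeft = 𝟙 _ ⊗≫ M.actLeft ⊗≫ (η_ M.X M.Xᘁ ▷ M.X ⊗≫ M.X ◁ ε_ M.X M.Xᘁ) ⊗≫ 𝟙 _ := by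
          rw [z']; monoidal
      _ = 𝟙 _ ⊗≫ (𝟙_ C ◁ M.actLeft ≫ η_ M.X M.Xᘁ ▷ M.X) ⊗≫ M.X ◁ ε_ M.X M.Xᘁ ⊗≫ 𝟙 _ := by
          monoidal
      _ = 𝟙 _ ⊗≫ η_ M.X M.Xᘁ ▷ (A.alg.X ⊗ M.X) ⊗≫ M.X ◁ ((α_ _ _ _).hom ≫
          (M.Xᘁ : C) ◁ M.actLeft ≫ ε_ M.X M.Xᘁ) ⊗≫ 𝟙 _ := by
          rw [whisker_exchange]; monoidal
      _ = _ := by rw [← e]; monoidal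

lemma coevalAlg_mul_left : MonObj.mul (X := A.alg.X) ≫ A.coevalAlg M =
    A.alg.X ◁ A.coevalAlg M ≫ (α_ _ _ _).inv ≫ M.actLeft ▷ (M.Xᘁ : C) := by
  have h := M.left_assoc
  rw [coevalAlg]
  calc _ = 𝟙 _ ⊗≫ (MonObj.mul (X := A.alg.X) ▷ 𝟙_ C ≫ A.alg.X ◁ η_ M.X M.Xᘁ) ⊗≫
        M.actLeft ▷ (M.Xᘁ : C) := by monoidal
    _ = 𝟙 _ ⊗≫ (A.alg.X ⊗ A.alg.X) ◁ η_ M.X M.Xᘁ ⊗≫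
        (MonObj.mul (X := A.alg.X) ▷ M.X ≫ M.actLeft) ▷ (M.Xᘁ : C) := by
        rw [← whisker_exchange]; monoidal
    _ = _ := by rw [h]; monoidal

lemma coevalAlg_mul_right : MonObj.mul (X := A.alg.X) ≫ A.coevalAlg M =
    A.coevalAlg M ▷ A.alg.X ≫ (α_ _ _ _).hom ≫ M.X ◁ A.dualActRight M := by
  have h := (A.dualBimod M).right_assoc
  rw [coevalAlg_eq]
  calc _ = 𝟙 _ ⊗≫ (𝟙_ C ◁ MonObj.mul (X := A.alg.X) ≫ η_ M.X M.Xᘁ ▷ A.alg.X) ⊗≫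
        M.X ◁ A.dualActRight M := by monoidal
    _ = 𝟙 _ ⊗≫ η_ M.X M.Xᘁ ▷ (A.alg.X ⊗ A.alg.X) ⊗≫
        M.X ◁ ((M.Xᘁ : C) ◁ MonObj.mul (X := A.alg.X) ≫ A.dualActRight M) := by
        rw [whisker_exchange]; monoidal
    _ = 𝟙 _ ⊗≫ η_ M.X M.Xᘁ ▷ (A.alg.X ⊗ A.alg.X) ⊗≫
        M.X ◁ ((α_ (M.Xᘁ : C) _ _).inv ≫ A.dualActRight M ▷ A.alg.X ≫ A.dualActRight M) :=
        congrArg (fun t => 𝟙 _ ⊗≫ η_ M.X M.Xᘁ ▷ (A.alg.X ⊗ A.alg.X) ⊗≫ M.X ◁ t) h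
    _ = _ := by monoidal

/-- `⟨φ, x⟩_A = ∑ φ(x e'ⱼ) eⱼ`, where `Δ ∘ η = ∑ e'ⱼ ⊗ eⱼ`. -/
lemma evalAlg_eq : A.evalAlg M = (M.Xᘁ : C) ◁ ((ρ_ _).inv ≫
    M.X ◁ (MonObj.one (X := A.alg.X) ≫ ComonObj.comul (X := A.alg.X)) ≫ (α_ _ _ _).inv ≫
      M.actRight ▷ A.alg.X) ≫ (α_ _ _ _).inv ≫ ε_ M.X M.Xᘁ ▷ A.alg.X ≫ (λ_ _).hom := by
  have h : A.evalAlg M = (ρ_ _).inv ≫ (_ ◁ (MonObj.one (X := A.alg.X) ≫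
      ComonObj.comul (X := A.alg.X)) ≫ (α_ _ _ _).inv ≫
        ((α_ _ _ _).hom ≫ (M.Xᘁ : C) ◁ M.actRight ≫ ε_ M.X M.Xᘁ) ▷ A.alg.X ≫ (λ_ _).hom) := rfl
  rw [h]
  monoidal

section Zigzag

variable {k : Type w} [Field k] [Preadditive C] [Linear k C] [MonoidalPreadditive C]
  [MonoidalLinear k C] {c : k}
  (hc : ComonObj.comul (X := A.alg.X) ≫ MonObj.mul (X := A.alg.X) = c • 𝟙 A.alg.X)

include hc

/-- `∑ xᵢ ⟨φᵢ, x⟩_A = c x`: the scalar is that of `m ∘ Δ`, because `⟨φ, x⟩_A` is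
`∑ φ(x e'ⱼ) eⱼ` for `Δ ∘ η = ∑ e'ⱼ ⊗ eⱼ`. -/
lemma evalAlg_zigzag : (λ_ _).inv ≫ η_ M.X M.Xᘁ ▷ M.X ≫ (α_ _ _ _).hom ≫ M.X ◁ A.evalAlg M ≫
    M.actRight = c • 𝟙 M.X := by
  have z' := ExactPairing.evaluation_coevaluation'' M.X (M.Xᘁ : C)
  rw [evalAlg_eq]
  set q := (ρ_ _).inv ≫ M.X ◁ (MonObj.one (X := A.alg.X) ≫ ComonObj.comul (X := A.alg.X)) ≫
    (α_ _ _ _).inv ≫ M.actRight ▷ A.alg.X with hq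
  calc _ = 𝟙 _ ⊗≫ (η_ M.X M.Xᘁ ▷ M.X ≫ (M.X ⊗ (M.Xᘁ : C)) ◁ q) ⊗≫
        M.X ◁ (ε_ M.X M.Xᘁ ▷ A.alg.X) ⊗≫ M.actRight := by monoidal
    _ = 𝟙 _ ⊗≫ q ⊗≫ (η_ M.X M.Xᘁ ▷ M.X ⊗≫ M.X ◁ ε_ M.X M.Xᘁ) ▷ A.alg.X ⊗≫ M.actRight := by
        rw [← whisker_exchange]; monoidal
    _ = q ≫ M.actRight := by rw [z']; monoidal
    _ = c • 𝟙 M.X := by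
      have h := M.right_assoc
      have h' : ((α_ _ _ _).inv ≫ M.actRight ▷ A.alg.X ≫ M.actRight) =
        M.X ◁ MonObj.mul (X := A.alg.X) ≫ M.actRight := h.symm
      simp only [hq, Category.assoc]
      rw [h', ← whiskerLeft_comp_assoc, Category.assoc, hc]
      simp

/-- `∑ ⟨φ, xᵢ⟩_A φᵢ = c φ`. -/
lemma evalAlg_zigzag_dual : (ρ_ (M.Xᘁ : C)).inv ≫ (M.Xᘁ : C) ◁ η_ M.X M.Xᘁ ≫ (α_ _ _ _).inv ≫
    A.evalAlg M ▷ (M.Xᘁ : C) ≫ A.dualActLeft M = c • 𝟙 (M.Xᘁ : C) := by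
  have z := A.evalAlg_zigzag M hc
  apply evaluation_left_ext (X := M.X)
  have e := A.evalAlg_form M
  have e' := A.dualActLeft_evaluation M
  trans (M.Xᘁ : C) ◁ (c • 𝟙 M.X) ≫ ε_ M.X M.Xᘁ
  · rw [← z]
    simp only [comp_whiskerRight, Category.assoc]
    rw [e', associator_naturality_left_assoc, ← whisker_exchange_assoc, e]
    monoidal
  · simp

end Zigzag

section Evaluation

variable [HasCoequalizers C]

/-- The evaluation `M^∨ ⊗_A M ⟶ A` of bimodules. -/
noncomputable def bimodEval : A.dualBimod M ⊗ M ⟶ 𝟙_ (Bimod A.alg A.alg) :=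
  homToUnit (bimodDesc (M := A.dualBimod M) (A.evalAlg M) (A.dualActRight_evalAlg M))
    (by
      rw [← cancel_epi (A.alg.X ◁ bimodProj (A.dualBimod M) M), reassoc_of% bimodProj_actLeft,
        bimodProj_desc, ← whiskerLeft_comp_assoc, bimodProj_desc, Iso.inv_comp_eq]
      exact A.dualActLeft_evalAlg M)
    (by
      rw [← cancel_epi (bimodProj (A.dualBimod M) M ▷ A.alg.X), reassoc_of% bimodProj_actRight,
        bimodProj_desc, ← comp_whiskerRight_assoc, bimodProj_desc]
      exact A.evalAlg_actRight M)

/-- The coevaluation `A ⟶ M ⊗_A M^∨` of bimodules, up to the scalar `m ∘ Δ`. -/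
noncomputable def bimodCoeval : 𝟙_ (Bimod A.alg A.alg) ⟶ M ⊗ A.dualBimod M :=
  homFromUnit (A.coevalAlg M ≫ bimodProj M (A.dualBimod M))
    (by
      have h := A.coevalAlg_mul_left M
      rw [whiskerLeft_comp_assoc, bimodProj_actLeft]
      exact (reassoc_of% h) _)
    (by
      have h := A.coevalAlg_mul_right M
      rw [comp_whiskerRight_assoc, bimodProj_actRight]
      exact (reassoc_of% h) _)

end Evaluation

/-- The dual bimodule is a dual in the category of bimodules. -/
@[reducible]
noncomputable def bimodExactPairing {k : Type w} [Field k] [Abelian C] [Linear k C]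
    [MonoidalPreadditive C] [MonoidalLinear k C] {c : k} (hc₀ : c ≠ 0)
    (hc : ComonObj.comul (X := A.alg.X) ≫ MonObj.mul (X := A.alg.X) = c • 𝟙 A.alg.X) :
    ExactPairing M (A.dualBimod M) where
  -- The zigzag composites of `bimodCoeval` with `bimodEval` are `m ∘ Δ = c` times the identity.
  coevaluation' := c⁻¹ • A.bimodCoeval M
  evaluation' := A.bimodEval M
  coevaluation_evaluation' := by
    rw [MonoidalLinear.whiskerLeft_smul, Linear.smul_comp, ← cancel_epi (ρ_ (A.dualBimod M)).inv,
      ← cancel_mono (λ_ (A.dualBimod M)).hom]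
    have z := A.evalAlg_zigzag_dual M hc
    simp only [Category.assoc, Iso.inv_hom_id_assoc, Iso.inv_hom_id]
    ext
    simp only [Linear.comp_smul, Linear.smul_comp, bimod_smul_hom, Bimod.comp_hom',
      Category.assoc]
    rw [reassoc_of% rightUnitor_inv_fromUnitHom, bimodCoeval, fromUnitHom_homFromUnit,
      reassoc_of% one_coevalAlg, whiskerLeft_comp_assoc, reassoc_of% bimodProj_associator_inv,
      bimodProj_toUnitHom_left, ← comp_whiskerRight_assoc, bimodEval, toUnitHom_homToUnit,
      bimodProj_desc, z, smul_smul, inv_mul_cancel₀ hc₀, one_smul]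
    rfl
  evaluation_coevaluation' := by
    rw [MonoidalLinear.smul_whiskerRight, Linear.smul_comp, ← cancel_epi (λ_ M).inv,
      ← cancel_mono (ρ_ M).hom]
    have z := A.evalAlg_zigzag M hc
    simp only [Category.assoc, Iso.inv_hom_id_assoc, Iso.inv_hom_id]
    ext
    simp only [Linear.comp_smul, Linear.smul_comp, bimod_smul_hom, Bimod.comp_hom',
      Category.assoc]
    rw [reassoc_of% leftUnitor_inv_fromUnitHom, bimodCoeval, fromUnitHom_homFromUnit,
      reassoc_of% one_coevalAlg, comp_whiskerRight_assoc, reassoc_of% bimodProj_associator,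
      bimodProj_toUnitHom_right, ← whiskerLeft_comp_assoc, bimodEval, toUnitHom_homToUnit,
      bimodProj_desc, z, smul_smul, inv_mul_cancel₀ hc₀, one_smul]
    rfl

end EquivariantFrobeniusAlgebra

/-! ### Pairings of bimodules -/

namespace EquivariantFrobeniusAlgebra

variable {G : Type*} [Group G] {C : Type u} [Category.{v} C] [MonoidalCategory C]
  {γ : G → C ⥤ C} [MonoidalAction γ] (A : EquivariantFrobeniusAlgebra γ) [RigidCategory C]
  [HasCoequalizers C]

/-- The `A`-valued pairing of objects which corresponds to a pairing of bimodules. -/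
noncomputable def pairingAlg {N M : Bimod A.alg A.alg} (e : N ⊗ M ⟶ 𝟙_ (Bimod A.alg A.alg)) :
    N.X ⊗ M.X ⟶ A.alg.X :=
  bimodProj N M ≫ toUnitHom e

/-- The pairing of objects which corresponds to a pairing of bimodules, by the counit of `A`. -/
noncomputable def pairing {N M : Bimod A.alg A.alg} (e : N ⊗ M ⟶ 𝟙_ (Bimod A.alg A.alg)) :
    N.X ⊗ M.X ⟶ 𝟙_ C :=
  A.pairingAlg e ≫ ComonObj.counit (X := A.alg.X)

variable {A}

lemma pairingAlg_whiskerRight {N N' M : Bimod A.alg A.alg} (f : N' ⟶ N)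
    (e : N ⊗ M ⟶ 𝟙_ (Bimod A.alg A.alg)) :
    A.pairingAlg (f ▷ M ≫ e) = f.hom ▷ M.X ≫ A.pairingAlg e := by
  rw [pairingAlg, pairingAlg, toUnitHom_comp, reassoc_of% bimodProj_whiskerRight]

lemma pairingAlg_whiskerLeft {N M M' : Bimod A.alg A.alg} (f : M' ⟶ M)
    (e : N ⊗ M ⟶ 𝟙_ (Bimod A.alg A.alg)) :
    A.pairingAlg (N ◁ f ≫ e) = N.X ◁ f.hom ≫ A.pairingAlg e := by
  rw [pairingAlg, pairingAlg, toUnitHom_comp, reassoc_of% bimodProj_whiskerLeft]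

lemma pairing_whiskerRight {N N' M : Bimod A.alg A.alg} (f : N' ⟶ N)
    (e : N ⊗ M ⟶ 𝟙_ (Bimod A.alg A.alg)) :
    A.pairing (f ▷ M ≫ e) = f.hom ▷ M.X ≫ A.pairing e := by
  rw [pairing, pairing, pairingAlg_whiskerRight, Category.assoc]

lemma pairing_whiskerLeft {N M M' : Bimod A.alg A.alg} (f : M' ⟶ M)
    (e : N ⊗ M ⟶ 𝟙_ (Bimod A.alg A.alg)) :
    A.pairing (N ◁ f ≫ e) = N.X ◁ f.hom ≫ A.pairing e := by
  rw [pairing, pairing, pairingAlg_whiskerLeft, Category.assoc]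

lemma pairingAlg_actLeft {N M : Bimod A.alg A.alg} (e : N ⊗ M ⟶ 𝟙_ (Bimod A.alg A.alg)) :
    N.actLeft ▷ M.X ≫ A.pairingAlg e =
      (α_ _ _ _).hom ≫ A.alg.X ◁ A.pairingAlg e ≫ MonObj.mul (X := A.alg.X) := by
  rw [pairingAlg, whiskerLeft_comp, Category.assoc, ← toUnitHom_actLeft,
    reassoc_of% bimodProj_actLeft, Iso.hom_inv_id_assoc]

lemma pairingAlg_actRight {N M : Bimod A.alg A.alg} (e : N ⊗ M ⟶ 𝟙_ (Bimod A.alg A.alg)) :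
    (α_ _ _ _).hom ≫ N.X ◁ M.actRight ≫ A.pairingAlg e =
      A.pairingAlg e ▷ A.alg.X ≫ MonObj.mul (X := A.alg.X) := by
  rw [pairingAlg, comp_whiskerRight, Category.assoc, ← toUnitHom_actRight,
    reassoc_of% bimodProj_actRight]

lemma pairing_balanced {N M : Bimod A.alg A.alg} (e : N ⊗ M ⟶ 𝟙_ (Bimod A.alg A.alg)) :
    N.actRight ▷ M.X ≫ A.pairing e = (α_ _ _ _).hom ≫ N.X ◁ M.actLeft ≫ A.pairing e := by
  rw [pairing, pairingAlg, Category.assoc, reassoc_of% bimodProj_balanced]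

/-- A pairing of bimodules is determined by the pairing of objects, because its `A`-valued pairing
is linear for the right action. -/
lemma pairing_injective {N M : Bimod A.alg A.alg} {e e' : N ⊗ M ⟶ 𝟙_ (Bimod A.alg A.alg)}
    (h : A.pairing e = A.pairing e') : e = e' := by
  apply toUnitHom_ext
  rw [← cancel_epi (bimodProj N M)]
  refine A.comp_counit_ext_right ((α_ _ _ _).hom ≫ N.X ◁ M.actRight) ?_ ?_ h
  · rw [Category.assoc]; exact pairingAlg_actRight e
  · rw [Category.assoc]; exact pairingAlg_actRight e'

lemma bimodPairing_eq [RigidCategory (Bimod A.alg A.alg)] (M : Bimod A.alg A.alg) :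
    A.bimodPairing M = A.pairing (ε_ M Mᘁ) :=
  (Category.assoc _ _ _).symm

section Pivotal

variable (δ : PivotalStructure C) [RigidCategory (Bimod A.alg A.alg)]

/-- The defining property of the induced pivotal morphism `d`, in terms of rotation. -/
lemma hom_comp_bimodPairing {M : Bimod A.alg A.alg} {d : M ⟶ (Mᘁ)ᘁ}
    (hd : Realizes (δ.iso M.X).hom (A.bimodPairing M) (A.bimodPairing (Mᘁ)) d.hom) :
    d.hom ▷ (Mᘁ : Bimod A.alg A.alg).X ≫ A.pairing (ε_ Mᘁ (Mᘁ)ᘁ) =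
      δ.rotate (A.pairing (ε_ M Mᘁ)) := by
  rw [← bimodPairing_eq, ← bimodPairing_eq]
  exact (δ.realizes_iff _ _ _).1 hd

lemma pairing_double_dual {M N : Bimod A.alg A.alg} {d : M ⟶ (Mᘁ)ᘁ}
    (hd : Realizes (δ.iso M.X).hom (A.bimodPairing M) (A.bimodPairing (Mᘁ)) d.hom)
    (t : N ⟶ Mᘁ) :
    A.pairing (d ▷ N ≫ (Mᘁ)ᘁ ◁ t ≫ ε_ Mᘁ (Mᘁ)ᘁ) = δ.rotate (A.pairing (t ▷ M ≫ ε_ M Mᘁ)) := by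
  rw [pairing_whiskerRight, pairing_whiskerLeft, ← whisker_exchange_assoc,
    hom_comp_bimodPairing δ hd, pairing_whiskerRight, δ.rotate_whiskerRight]

/-- A morphism of bimodules realizes a pivotal morphism iff it does so for the pairings of
objects. -/
lemma realizes_bimod_iff {M N L : Bimod A.alg A.alg} {d : M ⟶ (Mᘁ)ᘁ}
    (hd : Realizes (δ.iso M.X).hom (A.bimodPairing M) (A.bimodPairing (Mᘁ)) d.hom)
    (e : N ⊗ M ⟶ 𝟙_ (Bimod A.alg A.alg)) (e' : L ⊗ N ⟶ 𝟙_ (Bimod A.alg A.alg)) (f : M ⟶ L) :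
    Realizes d e e' f ↔ f.hom ▷ N.X ≫ A.pairing e' = δ.rotate (A.pairing e) := by
  have h := pairing_double_dual δ hd (toDual e)
  rw [toDual_evaluation] at h
  rw [realizes_iff, ← h, ← pairing_whiskerRight]
  exact ⟨congrArg _, pairing_injective⟩

lemma naturality_of_realizes {M N : Bimod A.alg A.alg} {d : M ⟶ (Mᘁ)ᘁ} {d' : N ⟶ (Nᘁ)ᘁ}
    (hd : Realizes (δ.iso M.X).hom (A.bimodPairing M) (A.bimodPairing (Mᘁ)) d.hom)
    (hd' : Realizes (δ.iso N.X).hom (A.bimodPairing N) (A.bimodPairing (Nᘁ)) d'.hom)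
    (f : M ⟶ N) : f ≫ d' = d ≫ (fᘁ)ᘁ := by
  apply evaluation_left_ext (X := Nᘁ)
  apply pairing_injective
  rw [comp_whiskerRight, comp_whiskerRight, Category.assoc, Category.assoc,
    rightAdjointMate_comp_evaluation, pairing_double_dual δ hd,
    rightAdjointMate_comp_evaluation, pairing_whiskerRight, pairing_whiskerRight,
    hom_comp_bimodPairing δ hd', pairing_whiskerLeft, δ.rotate_whiskerLeft]

end Pivotal

/-- The pairing of `N' ⊗ M'` with `M ⊗ N` obtained from two pairings. -/
abbrev nested {D : Type*} [Category* D] [MonoidalCategory D] {M M' N N' : D}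
    (e : M' ⊗ M ⟶ 𝟙_ D) (e' : N' ⊗ N ⟶ 𝟙_ D) : (N' ⊗ M') ⊗ (M ⊗ N) ⟶ 𝟙_ D :=
  (α_ N' M' (M ⊗ N)).hom ≫ N' ◁ ((α_ M' M N).inv ≫ e ▷ N ≫ (λ_ N).hom) ≫ e'

lemma bimodProj_nested {M M' N N' : Bimod A.alg A.alg}
    (e : M' ⊗ M ⟶ 𝟙_ (Bimod A.alg A.alg)) (e' : N' ⊗ N ⟶ 𝟙_ (Bimod A.alg A.alg)) :
    (N'.X ⊗ M'.X) ◁ bimodProj M N ≫ bimodProj N' M' ▷ (M ⊗ N).X ≫ A.pairing (nested e e') =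
      (α_ _ _ _).hom ≫ N'.X ◁ ((α_ _ _ _).inv ≫ A.pairingAlg e ▷ N.X ≫ N.actLeft) ≫
        A.pairing e' := by
  rw [pairing, pairingAlg, nested, toUnitHom_comp, Category.assoc, Category.assoc,
    reassoc_of% bimodProj_associator, toUnitHom_comp, Category.assoc,
    reassoc_of% bimodProj_whiskerLeft, Bimod.comp_hom', Bimod.comp_hom',
    associator_naturality_right_assoc, ← whiskerLeft_comp_assoc _ _ (bimodProj M' _),
    ← whiskerLeft_comp_assoc, Category.assoc, reassoc_of% bimodProj_associator_inv,
    bimodProj_toUnitHom_left]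
  rw [pairing, pairingAlg, pairingAlg, comp_whiskerRight]
  simp only [Category.assoc]

/-- Rotation of a nested pairing of bimodules. Although `A.pairing (nested e e')` is not the nested
pairing of `A.pairing e` and `A.pairing e'`, it can be rotated in two steps by `rotate_tensor`,
first past `N` and then past `M`. -/
lemma rotate_nested (δ : PivotalStructure C) {M M' N N' : Bimod A.alg A.alg}
    {e : M' ⊗ M ⟶ 𝟙_ (Bimod A.alg A.alg)} {e' : N' ⊗ N ⟶ 𝟙_ (Bimod A.alg A.alg)}
    {f : M ⊗ M' ⟶ 𝟙_ (Bimod A.alg A.alg)} {f' : N ⊗ N' ⟶ 𝟙_ (Bimod A.alg A.alg)}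
    (h : A.pairing f = δ.rotate (A.pairing e)) (h' : A.pairing f' = δ.rotate (A.pairing e')) :
    A.pairing (nested f' f) = δ.rotate (A.pairing (nested e e')) := by
  have h₁ : (α_ (N'.X ⊗ M'.X) M.X N.X).hom ≫ bimodProj N' M' ▷ (M.X ⊗ N.X) ≫
      (N' ⊗ M').X ◁ bimodProj M N ≫ A.pairing (nested e e') =
      ((α_ _ _ _).hom ≫ N'.X ◁ A.pairingAlg e ≫ N'.actRight) ▷ N.X ≫ A.pairing e' := by
    rw [← whisker_exchange_assoc, bimodProj_nested, comp_whiskerRight_assoc,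
      comp_whiskerRight_assoc, pairing_balanced]
    monoidal
  have h₂ : (α_ N.X (N'.X ⊗ M'.X) M.X).hom ≫
      N.X ◁ ((α_ _ _ _).hom ≫ N'.X ◁ A.pairingAlg e ≫ N'.actRight) ≫ A.pairing f' =
      ((α_ _ _ _).inv ≫ A.pairingAlg f' ▷ M'.X ≫ M'.actLeft) ▷ M.X ≫ A.pairing e := by
    have h₃ := pairingAlg_actRight f'
    have h₄ := pairingAlg_actLeft e
    calc _ = 𝟙 _ ⊗≫ N.X ◁ N'.X ◁ A.pairingAlg e ⊗≫ ((α_ _ _ _).hom ≫ N.X ◁ N'.actRight ≫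
          A.pairingAlg f') ⊗≫ ComonObj.counit (X := A.alg.X) := by rw [pairing]; monoidal
      _ = 𝟙 _ ⊗≫ ((N.X ⊗ N'.X) ◁ A.pairingAlg e ≫ A.pairingAlg f' ▷ A.alg.X) ⊗≫
          MonObj.mul (X := A.alg.X) ⊗≫ ComonObj.counit (X := A.alg.X) := by rw [h₃]; monoidal
      _ = 𝟙 _ ⊗≫ A.pairingAlg f' ▷ (M'.X ⊗ M.X) ⊗≫ ((α_ _ _ _).hom ≫ A.alg.X ◁ A.pairingAlg e ≫
          MonObj.mul (X := A.alg.X)) ⊗≫ ComonObj.counit (X := A.alg.X) := by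
          rw [whisker_exchange]; monoidal
      _ = _ := by rw [← h₄, pairing]; monoidal
  rw [← cancel_epi (bimodProj M N ▷ (N' ⊗ M').X), ← cancel_epi ((M.X ⊗ N.X) ◁ bimodProj N' M'),
    bimodProj_nested, ← δ.rotate_whiskerLeft, ← δ.rotate_whiskerRight, δ.rotate_tensor, h₁,
    δ.rotate_whiskerRight, ← h', h₂, δ.rotate_whiskerRight, ← h]

end EquivariantFrobeniusAlgebra

/-! ### The pivotal structure of the category of bimodules -/

namespace EquivariantFrobeniusAlgebra

variable {G : Type*} [Group G] {C : Type u} [Category.{v} C] [MonoidalCategory C]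
  {γ : G → C ⥤ C} [MonoidalAction γ] {A : EquivariantFrobeniusAlgebra γ} [RigidCategory C]
  {δ : PivotalStructure C}

lemma IsSymmetric.rotate_form (h : A.IsSymmetric δ) : δ.rotate A.form = A.form := by
  have h' := (δ.realizes_iff _ _ _).1 h
  rw [← h', id_whiskerRight, Category.id_comp]

section

variable (M : Bimod A.alg A.alg)

/-- The `A`-valued evaluation of `M^∨^∨` and `M^∨`, pulled back to `M`, comes from the rotated
evaluation of `M`. -/
lemma pivotal_evalAlg : (δ.iso M.X).hom ▷ (M.Xᘁ : C) ≫ A.evalAlg (A.dualBimod M) =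
    A.toAlg ((α_ _ _ _).hom ≫ M.X ◁ A.dualActRight M ≫ δ.rotate (ε_ M.X M.Xᘁ)) := by
  apply A.form_left_ext
  have h := A.evalAlg_form (A.dualBimod M)
  rw [comp_whiskerRight_assoc, h, toAlg_form, δ.rotate_evaluation, whisker_exchange_assoc,
    associator_naturality_left_assoc]

/-- The pivotal isomorphism of `M` is linear for the right actions. The right action on `M^∨^∨` is
dual to the left action on `M^∨`, which is defined by the Frobenius form; rotating the form in
`φ(x a) = ε(⟨φ, x⟩_A a)` by symmetry compares the two. -/
lemma pivotal_actRight (h : A.IsSymmetric δ) : M.actRight ≫ (δ.iso M.X).hom =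
    (δ.iso M.X).hom ▷ A.alg.X ≫ (A.dualBimod (A.dualBimod M)).actRight := by
  apply evaluation_left_ext (X := (M.Xᘁ : C))
  have h₁ := A.dualActRight_evaluation (A.dualBimod M)
  rw [comp_whiskerRight_assoc, comp_whiskerRight_assoc, ← δ.rotate_evaluation,
    ← δ.rotate_whiskerLeft, δ.rotate_tensor, ← A.evalAlg_form, δ.rotate_whiskerRight, h.rotate_form,
    ← A.dualActLeft_evaluation, δ.rotate_whiskerRight, δ.rotate_evaluation, whisker_exchange_assoc,
    h₁, associator_naturality_left_assoc]

/-- The pivotal isomorphism of `M` is linear for the left actions, by the symmetry of the form. -/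
lemma pivotal_actLeft (h : A.IsSymmetric δ) : M.actLeft ≫ (δ.iso M.X).hom =
    A.alg.X ◁ (δ.iso M.X).hom ≫ (A.dualBimod (A.dualBimod M)).actLeft := by
  apply evaluation_left_ext (X := (M.Xᘁ : C))
  have h₁ := A.dualActLeft_evaluation (A.dualBimod M)
  have h₂ := pivotal_evalAlg (δ := δ) M
  rw [comp_whiskerRight_assoc, comp_whiskerRight_assoc, ← δ.rotate_evaluation,
    ← δ.rotate_whiskerLeft, δ.rotate_tensor, ← dualActRight_evaluation, δ.rotate_whiskerRight,
    ← A.toAlg_form (_ ≫ _ ◁ A.dualActRight M ≫ _), δ.rotate_whiskerRight, h.rotate_form, ← h₂,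
    h₁, whiskerLeft_comp_assoc, associator_naturality_middle_assoc]

end

lemma nested_tensorHom {D : Type*} [Category* D] [MonoidalCategory D] {M M' N N' K L : D}
    [ExactPairing M M'] [ExactPairing N N'] (f : K ⟶ M') (g : L ⟶ N') :
    (f ⊗ₘ g) ▷ (N ⊗ M) ≫ ε_ (N ⊗ M) (M' ⊗ N') = nested (g ▷ N ≫ ε_ N N') (f ▷ M ≫ ε_ M M') := by
  rw [ExactPairing.tensor_evaluation]
  calc _ = 𝟙 _ ⊗≫ K ◁ g ▷ (N ⊗ M) ⊗≫ (f ▷ ((N' ⊗ N) ⊗ M) ≫ M' ◁ (ε_ N N' ▷ M)) ⊗≫ ε_ M M' := by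
        rw [MonoidalCategory.tensorHom_def']; monoidal
    _ = _ := by rw [← whisker_exchange]; dsimp only [nested]; monoidal

lemma tensor_evaluation_eq_nested {D : Type*} [Category* D] [MonoidalCategory D] {M M' N N' : D}
    [ExactPairing M M'] [ExactPairing N N'] :
    ε_ (N ⊗ M) (M' ⊗ N') = nested (ε_ N N') (ε_ M M') := by
  rw [ExactPairing.tensor_evaluation]
  dsimp only [nested]
  monoidal

/-- The pivotal isomorphism of a bimodule is that of the underlying object. -/
noncomputable def pivotalIso (h : A.IsSymmetric δ) (M : Bimod A.alg A.alg) :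
    M ≅ A.dualBimod (A.dualBimod M) :=
  Bimod.isoOfIso (δ.iso M.X) (pivotal_actLeft M h) (pivotal_actRight M h)

variable {k : Type w} [Field k]

section Rigid

variable [Abelian C] [Linear k C] [MonoidalPreadditive C] [MonoidalLinear k C] {c : k}
  (hc₀ : c ≠ 0) (hc : ComonObj.comul (X := A.alg.X) ≫ MonObj.mul (X := A.alg.X) = c • 𝟙 A.alg.X)
  (h : A.IsSymmetric δ)

include hc₀ hc h

/-- The category of bimodules is rigid. The left dual of a bimodule is the right dual, by the
pivotal isomorphism. -/
@[reducible]
noncomputable def bimodRigid : RigidCategory (Bimod A.alg A.alg) where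
  rightDual M := { rightDual := A.dualBimod M, exact := A.bimodExactPairing M hc₀ hc }
  leftDual M :=
    { leftDual := A.dualBimod M
      exact := letI := A.bimodExactPairing (A.dualBimod M) hc₀ hc
        exactPairingCongrRight (pivotalIso h M) }

lemma bimodPairing_bimodRigid (M : Bimod A.alg A.alg) :
    letI := bimodRigid hc₀ hc h
    A.bimodPairing M = ε_ M.X M.Xᘁ := by
  let := bimodRigid hc₀ hc h
  rw [bimodPairing_eq, ← A.evalAlg_counit]
  exact congrArg (· ≫ ComonObj.counit (X := A.alg.X))
    (bimodProj_desc (M := A.dualBimod M) _ (A.dualActRight_evalAlg M))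

lemma realizes_pivotalIso (M : Bimod A.alg A.alg) :
    letI := bimodRigid hc₀ hc h
    Realizes (δ.iso M.X).hom (A.bimodPairing M) (A.bimodPairing (Mᘁ)) (pivotalIso h M).hom.hom := by
  let := bimodRigid hc₀ hc h
  rw [δ.realizes_iff, bimodPairing_bimodRigid hc₀ hc h M, bimodPairing_bimodRigid hc₀ hc h (Mᘁ)]
  exact (δ.rotate_evaluation M.X).symm

/-- The pivotal structure of the category of bimodules. -/
@[reducible]
noncomputable def bimodPivotal :
    letI := bimodRigid hc₀ hc h
    PivotalStructure (Bimod A.alg A.alg) :=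
  letI := bimodRigid hc₀ hc h
  { iso := pivotalIso h
    naturality := fun {M N} f => naturality_of_realizes δ (realizes_pivotalIso hc₀ hc h M)
      (realizes_pivotalIso hc₀ hc h N) f
    monoidal := fun M N => by
      rw [realizes_bimod_iff δ (realizes_pivotalIso hc₀ hc h (M ⊗ N)), ← pairing_whiskerRight,
        nested_tensorHom, tensor_evaluation_eq_nested]
      have hM := hom_comp_bimodPairing δ (realizes_pivotalIso hc₀ hc h M)
      have hN := hom_comp_bimodPairing δ (realizes_pivotalIso hc₀ hc h N)
      rw [← pairing_whiskerRight] at hM hN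
      exact rotate_nested δ hM hN }

end Rigid

end EquivariantFrobeniusAlgebra

/-! ### The action on the category of bimodules -/

section Action

variable {G : Type*} [Group G] {C : Type u} [Category.{v} C] [MonoidalCategory C]
  {γ : G → C ⥤ C} [MonoidalAction γ]

variable (γ) in
/-- The functor `γ(g)` is an equivalence, with quasi-inverse `γ(g⁻¹)`; so it preserves `⊗_A`. -/
lemma isEquivalence_action (g : G) : (γ g).IsEquivalence :=
  (CategoryTheory.Equivalence.mk (γ g) (γ g⁻¹)
    (MonoidalAction.one (γ := γ) ≪≫ (MonoidalAction.comp (γ := γ) (inv_mul_cancel g)).symm)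
    (MonoidalAction.comp (γ := γ) (mul_inv_cancel g) ≪≫
      (MonoidalAction.one (γ := γ)).symm)).isEquivalence_functor

variable (A : EquivariantAlgebra γ)

namespace EquivariantAlgebra

lemma mul_z_inv (g : G) : MonObj.mul (X := A.alg.X) ≫ (A.z g).inv = ((A.z g).inv ⊗ₘ (A.z g).inv) ≫
    Functor.LaxMonoidal.μ (γ g) A.alg.X A.alg.X ≫ (γ g).map (MonObj.mul (X := A.alg.X)) := by
  rw [Iso.comp_inv_eq]
  simp only [Category.assoc]
  rw [A.mul_z]
  simp

variable [HasCoequalizers C] [RigidCategory C] (g : G) (M N : Bimod A.alg A.alg)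

/-- The morphism `γ(g)(M) ⊗ γ(g)(N) ⟶ γ(g)(M ⊗_A N)` is balanced. -/
lemma act_balanced : ((A.act g).obj M).actRight ▷ ((A.act g).obj N).X ≫
      Functor.LaxMonoidal.μ (γ g) M.X N.X ≫ (γ g).map (bimodProj M N) =
    (α_ _ _ _).hom ≫ ((A.act g).obj M).X ◁ ((A.act g).obj N).actLeft ≫
      Functor.LaxMonoidal.μ (γ g) M.X N.X ≫ (γ g).map (bimodProj M N) := by
  simp only [comp_whiskerRight, whiskerLeft_comp, Category.assoc]
  rw [Functor.LaxMonoidal.μ_natural_left_assoc, ← Functor.map_comp, bimodProj_balanced,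
    Functor.map_comp, Functor.map_comp, Functor.LaxMonoidal.associativity_assoc,
    Functor.LaxMonoidal.μ_natural_right_assoc, associator_naturality_middle_assoc]

/-- The morphism `γ(g)(M) ⊗ γ(g)(N) ⟶ γ(g)(M ⊗_A N)` is linear for the left actions. -/
lemma actLeft_map_bimodProj : A.alg.X ◁ (Functor.LaxMonoidal.μ (γ g) M.X N.X ≫
      (γ g).map (bimodProj M N)) ≫ ((A.act g).obj (M ⊗ N)).actLeft =
    (α_ _ _ _).inv ≫ ((A.act g).obj M).actLeft ▷ ((A.act g).obj N).X ≫
      Functor.LaxMonoidal.μ (γ g) M.X N.X ≫ (γ g).map (bimodProj M N) := by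
  simp only [comp_whiskerRight, whiskerLeft_comp, Category.assoc]
  rw [Functor.LaxMonoidal.μ_natural_left_assoc, ← Functor.map_comp,
    whisker_exchange_assoc, Functor.LaxMonoidal.μ_natural_right_assoc, ← Functor.map_comp,
    bimodProj_actLeft, Functor.map_comp, Functor.map_comp, whisker_exchange_assoc,
    Functor.LaxMonoidal.associativity_inv_assoc, associator_inv_naturality_left_assoc]

/-- The morphism `γ(g)(M) ⊗ γ(g)(N) ⟶ γ(g)(M ⊗_A N)` is linear for the right actions. -/
lemma actRight_map_bimodProj : (Functor.LaxMonoidal.μ (γ g) M.X N.X ≫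
      (γ g).map (bimodProj M N)) ▷ A.alg.X ≫ ((A.act g).obj (M ⊗ N)).actRight =
    (α_ _ _ _).hom ≫ ((A.act g).obj M).X ◁ ((A.act g).obj N).actRight ≫
      Functor.LaxMonoidal.μ (γ g) M.X N.X ≫ (γ g).map (bimodProj M N) := by
  simp only [comp_whiskerRight, whiskerLeft_comp, Category.assoc]
  rw [Functor.LaxMonoidal.μ_natural_right_assoc, ← Functor.map_comp,
    ← whisker_exchange_assoc, Functor.LaxMonoidal.μ_natural_left_assoc, ← Functor.map_comp,
    bimodProj_actRight, Functor.map_comp, Functor.map_comp, ← whisker_exchange_assoc,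
    Functor.LaxMonoidal.associativity_assoc, associator_naturality_right_assoc]

instance (g : G) : Epi ((γ g).map (bimodProj M N)) := by
  have := isEquivalence_action γ g
  infer_instance

/-- As `γ(g)` preserves coequalizers, `γ(g)(M ⊗_A N)` is a coequalizer. -/
lemma exists_map_bimodProj_desc {Z : C} (f : (γ g).obj (M.X ⊗ N.X) ⟶ Z)
    (hf : (γ g).map (M.actRight ▷ N.X) ≫ f =
      (γ g).map ((α_ M.X A.alg.X N.X).hom ≫ M.X ◁ N.actLeft) ≫ f) :
    ∃ t : (γ g).obj (M ⊗ N).X ⟶ Z, (γ g).map (bimodProj M N) ≫ t = f := by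
  have := isEquivalence_action γ g
  have h := isColimitCoforkMapOfIsColimit (γ g) _
    (coequalizerIsCoequalizer (M.actRight ▷ N.X) ((α_ M.X A.alg.X N.X).hom ≫ M.X ◁ N.actLeft))
  exact ⟨h.desc (Cofork.ofπ f hf), h.fac _ WalkingParallelPair.one⟩

/-- The inverse of the tensor structure `γ(g)(M) ⊗_A γ(g)(N) ⟶ γ(g)(M ⊗_A N)`. -/
lemma exists_actTensor_inv : ∃ t : (γ g).obj (M ⊗ N).X ⟶
      (((A.act g).obj M) ⊗ ((A.act g).obj N)).X,
    (γ g).map (bimodProj M N) ≫ t =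
      Functor.OplaxMonoidal.δ (γ g) M.X N.X ≫ bimodProj ((A.act g).obj M) ((A.act g).obj N) := by
  apply exists_map_bimodProj_desc
  have h := bimodProj_balanced ((A.act g).obj M) ((A.act g).obj N)
  simp only [comp_whiskerRight, whiskerLeft_comp, Category.assoc] at h
  -- The relation to be checked has source `γ(g)((M ⊗ A) ⊗ N)`; it is pulled back to
  -- `(γ(g)(M) ⊗ A) ⊗ γ(g)(N)`, where it says that the projection is balanced.
  have e : IsIso (((γ g).obj M.X ◁ (A.z g).inv) ▷ (γ g).obj N.X ≫
    Functor.LaxMonoidal.μ (γ g) M.X A.alg.X ▷ (γ g).obj N.X ≫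
      Functor.LaxMonoidal.μ (γ g) (M.X ⊗ A.alg.X) N.X) := inferInstance
  rw [← cancel_epi (((γ g).obj M.X ◁ (A.z g).inv) ▷ (γ g).obj N.X ≫
    Functor.LaxMonoidal.μ (γ g) M.X A.alg.X ▷ (γ g).obj N.X ≫
      Functor.LaxMonoidal.μ (γ g) (M.X ⊗ A.alg.X) N.X)]
  simp only [Category.assoc]
  rw [← Functor.LaxMonoidal.μ_natural_left_assoc, Functor.Monoidal.μ_δ_assoc, h, Functor.map_comp,
    Category.assoc, Functor.LaxMonoidal.associativity_assoc,
    ← Functor.LaxMonoidal.μ_natural_right_assoc, Functor.Monoidal.μ_δ_assoc,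
    associator_naturality_middle_assoc]

/-- The isomorphism `γ(g)(M) ⊗_A γ(g)(N) ≅ γ(g)(M ⊗_A N)` of objects. -/
noncomputable def actTensorX :
    ((A.act g).obj M ⊗ (A.act g).obj N).X ≅ ((A.act g).obj (M ⊗ N)).X where
  hom := bimodDesc (M := (A.act g).obj M) (N := (A.act g).obj N)
    (Functor.LaxMonoidal.μ (γ g) M.X N.X ≫ (γ g).map (bimodProj M N)) (A.act_balanced g M N)
  inv := (A.exists_actTensor_inv g M N).choose
  hom_inv_id := by
    rw [← cancel_epi (bimodProj _ _), reassoc_of% bimodProj_desc, Category.assoc,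
      (A.exists_actTensor_inv g M N).choose_spec, Functor.Monoidal.μ_δ_assoc, Category.comp_id]
  inv_hom_id := by
    have h := (A.exists_actTensor_inv g M N).choose_spec
    rw [← cancel_epi ((γ g).map (bimodProj M N)), reassoc_of% h]
    erw [bimodProj_desc]
    rw [Functor.Monoidal.δ_μ_assoc]
    exact (Category.comp_id _).symm

lemma bimodProj_actTensorX : bimodProj ((A.act g).obj M) ((A.act g).obj N) ≫
    (A.actTensorX g M N).hom = Functor.LaxMonoidal.μ (γ g) M.X N.X ≫ (γ g).map (bimodProj M N) :=
  bimodProj_desc (M := (A.act g).obj M) (N := (A.act g).obj N) _ (A.act_balanced g M N)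

/-- The isomorphism `γ(g)(M) ⊗_A γ(g)(N) ≅ γ(g)(M ⊗_A N)`. -/
noncomputable def actTensor : (A.act g).obj M ⊗ (A.act g).obj N ≅ (A.act g).obj (M ⊗ N) :=
  Bimod.isoOfIso (A.actTensorX g M N)
    (by
      rw [← cancel_epi (A.alg.X ◁ bimodProj _ _), reassoc_of% bimodProj_actLeft,
        bimodProj_actTensorX, ← whiskerLeft_comp_assoc, bimodProj_actTensorX,
        actLeft_map_bimodProj])
    (by
      rw [← cancel_epi (bimodProj _ _ ▷ A.alg.X), reassoc_of% bimodProj_actRight,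
        bimodProj_actTensorX, ← comp_whiskerRight_assoc, bimodProj_actTensorX,
        actRight_map_bimodProj])

lemma bimodProj_actTensor : bimodProj ((A.act g).obj M) ((A.act g).obj N) ≫
    (A.actTensor g M N).hom.hom =
      Functor.LaxMonoidal.μ (γ g) M.X N.X ≫ (γ g).map (bimodProj M N) :=
  A.bimodProj_actTensorX g M N

/-- The isomorphism `A ≅ γ(g)(A)` of bimodules. -/
noncomputable def actUnit : 𝟙_ (Bimod A.alg A.alg) ≅ (A.act g).obj (𝟙_ (Bimod A.alg A.alg)) :=
  Bimod.isoOfIso (P := Bimod.regular A.alg) (Q := (A.act g).obj (Bimod.regular A.alg)) (A.z g).symm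
    (by
      have h := A.mul_z_inv g
      rw [MonoidalCategory.tensorHom_def', Category.assoc] at h
      exact h)
    (by
      have h := A.mul_z_inv g
      rw [MonoidalCategory.tensorHom_def, Category.assoc] at h
      exact h)

/-- The monoidal structure of the functor `M ↦ γ(g)(M)` on bimodules. -/
noncomputable def actCore : (A.act g).CoreMonoidal where
  εIso := A.actUnit g
  μIso M N := A.actTensor g M N
  μIso_hom_natural_left {M M'} f N := by
    ext
    rw [← cancel_epi (bimodProj _ _), Bimod.comp_hom', Bimod.comp_hom',
      reassoc_of% bimodProj_whiskerRight, bimodProj_actTensor, reassoc_of% bimodProj_actTensor]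
    rw [Functor.LaxMonoidal.μ_natural_left_assoc, ← Functor.map_comp, ← Functor.map_comp,
      bimodProj_whiskerRight]
  μIso_hom_natural_right {M M'} N f := by
    ext
    rw [← cancel_epi (bimodProj _ _), Bimod.comp_hom', Bimod.comp_hom',
      reassoc_of% bimodProj_whiskerLeft, bimodProj_actTensor, reassoc_of% bimodProj_actTensor]
    rw [Functor.LaxMonoidal.μ_natural_right_assoc, ← Functor.map_comp, ← Functor.map_comp,
      bimodProj_whiskerLeft]
  associativity M N L := by
    ext
    rw [← cancel_epi (bimodProj _ _), ← cancel_epi (bimodProj _ _ ▷ ((A.act g).obj L).X)]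
    simp only [Bimod.comp_hom']
    rw [reassoc_of% bimodProj_whiskerRight, ← comp_whiskerRight_assoc, bimodProj_actTensor,
      reassoc_of% bimodProj_actTensor,
      (reassoc_of% bimodProj_associator) ((A.act g).obj M) ((A.act g).obj N) ((A.act g).obj L),
      reassoc_of% bimodProj_whiskerLeft,
      bimodProj_actTensor, ← whiskerLeft_comp_assoc, bimodProj_actTensor]
    simp only [comp_whiskerRight, whiskerLeft_comp, Category.assoc]
    rw [Functor.LaxMonoidal.μ_natural_left_assoc, Functor.LaxMonoidal.μ_natural_right_assoc,
      ← Functor.map_comp, ← Functor.map_comp, ← Functor.map_comp, bimodProj_associator,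
      Functor.map_comp, Functor.LaxMonoidal.associativity_assoc]
  left_unitality M := by
    ext
    rw [← cancel_epi (bimodProj _ _), bimodProj_leftUnitor, Bimod.comp_hom', Bimod.comp_hom',
      reassoc_of% bimodProj_whiskerRight, reassoc_of% bimodProj_actTensor, ← Functor.map_comp,
      bimodProj_leftUnitor]
    rfl
  right_unitality M := by
    ext
    rw [← cancel_epi (bimodProj _ _), bimodProj_rightUnitor, Bimod.comp_hom', Bimod.comp_hom',
      reassoc_of% bimodProj_whiskerLeft, reassoc_of% bimodProj_actTensor, ← Functor.map_comp,
      bimodProj_rightUnitor]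
    rfl

end EquivariantAlgebra

end Action

/-! ### Coherence of the action on the category of bimodules -/

section ActionCoherence

variable {G : Type*} [Group G] {C : Type u} [Category.{v} C] [MonoidalCategory C]
  {γ : G → C ⥤ C} [MonoidalAction γ]

lemma actComp_naturality {g h k : G} (e : g * h = k) {X Y : C} (f : X ⟶ Y) :
    (γ g).map ((γ h).map f) ≫ (actComp γ e Y).hom = (actComp γ e X).hom ≫ (γ k).map f :=
  (MonoidalAction.comp (γ := γ) e).hom.naturality f

lemma actOne_naturality {X Y : C} (f : X ⟶ Y) :
    f ≫ (actOne γ Y).hom = (actOne γ X).hom ≫ (γ 1).map f :=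
  (MonoidalAction.one (γ := γ)).hom.naturality f

lemma actComp_tensor {g h k : G} (e : g * h = k) (X Y : C) :
    Functor.LaxMonoidal.μ (γ g) ((γ h).obj X) ((γ h).obj Y) ≫
      (γ g).map (Functor.LaxMonoidal.μ (γ h) X Y) ≫ (actComp γ e (X ⊗ Y)).hom =
    ((actComp γ e X).hom ⊗ₘ (actComp γ e Y).hom) ≫ Functor.LaxMonoidal.μ (γ k) X Y := by
  have h := (MonoidalAction.comp_isMonoidal (γ := γ) e).tensor X Y
  rw [Functor.LaxMonoidal.comp_μ, Category.assoc] at h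
  exact h

lemma actOne_tensor (X Y : C) : (actOne γ (X ⊗ Y)).hom =
    ((actOne γ X).hom ⊗ₘ (actOne γ Y).hom) ≫ Functor.LaxMonoidal.μ (γ 1) X Y := by
  have h := (MonoidalAction.one_isMonoidal (γ := γ)).tensor X Y
  rw [Functor.LaxMonoidal.id_μ, Category.id_comp] at h
  exact h

variable (A : EquivariantAlgebra γ)

namespace EquivariantAlgebra

lemma z_inv_comp {g h k : G} (e : g * h = k) :
    (A.z g).inv ≫ (γ g).map (A.z h).inv ≫ (actComp γ e A.alg.X).hom = (A.z k).inv := by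
  have hz := A.z_comp e
  rw [← cancel_mono (A.z k).hom, Category.assoc, Category.assoc, hz, ← Functor.map_comp_assoc]
  simp

/-- The relation `z (1 * 1) = z 1 ∘ γ(1)(z 1)` forces `z 1` to be the inverse of `A ≅ γ(1)(A)`. -/
lemma z_one_inv : (A.z 1).inv = (actOne γ A.alg.X).hom := by
  have := isEquivalence_action γ 1
  have h := A.z_comp (mul_one 1)
  have h' := MonoidalAction.comp_one (γ := γ) 1 A.alg.X
  rw [cancel_mono] at h
  have h₁ : (γ 1).map ((actOne γ A.alg.X).hom ≫ (A.z 1).hom) = (γ 1).map (𝟙 _) := by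
    rw [Functor.map_comp, ← h, CategoryTheory.Functor.map_id]
    exact h'
  rw [← cancel_mono (A.z 1).hom, Iso.inv_hom_id, (γ 1).map_injective h₁]

/-- The isomorphism `γ(g)(γ(h)(M)) ≅ γ(gh)(M)` of bimodules. -/
def actBimodComp {g h k : G} (e : g * h = k) : A.act h ⋙ A.act g ≅ A.act k :=
  NatIso.ofComponents (fun M => Bimod.isoOfIso (actComp γ e M.X)
    (by
      have hz := A.z_inv_comp e
      simp only [Functor.comp_obj, Functor.map_comp, Category.assoc]
      rw [← hz, actComp_naturality, ← Functor.LaxMonoidal.μ_natural_left_assoc,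
        reassoc_of% actComp_tensor, MonoidalCategory.tensorHom_def, whisker_exchange_assoc]
      simp only [comp_whiskerRight, Category.assoc])
    (by
      have hz := A.z_inv_comp e
      simp only [Functor.comp_obj, Functor.map_comp, Category.assoc]
      rw [← hz, actComp_naturality, ← Functor.LaxMonoidal.μ_natural_right_assoc,
        reassoc_of% actComp_tensor, MonoidalCategory.tensorHom_def', ← whisker_exchange_assoc]
      simp only [whiskerLeft_comp, Category.assoc]))
    (fun f => by ext; exact actComp_naturality e f.hom)

/-- The isomorphism `M ≅ γ(1)(M)` of bimodules. -/
def actBimodOne : 𝟭 _ ≅ A.act 1 :=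
  NatIso.ofComponents (fun M => Bimod.isoOfIso (actOne γ M.X)
    (by
      dsimp only [Functor.id_obj]
      rw [z_one_inv, actOne_naturality, actOne_tensor, MonoidalCategory.tensorHom_def',
        Category.assoc, Category.assoc])
    (by
      dsimp only [Functor.id_obj]
      rw [z_one_inv, actOne_naturality, actOne_tensor, MonoidalCategory.tensorHom_def,
        Category.assoc, Category.assoc]))
    (fun f => by ext; exact actOne_naturality f.hom)

variable [HasCoequalizers C] [RigidCategory C]

/-- The monoidal functor `M ↦ γ(g)(M)` on bimodules. -/
@[reducible]
noncomputable def actMonoidal (g : G) : (A.act g).Monoidal := (A.actCore g).toMonoidal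

/-- The action of `G` on the category of bimodules. -/
@[reducible]
noncomputable def bimodAction : MonoidalAction A.act where
  monoidal g := A.actMonoidal g
  comp e := A.actBimodComp e
  one := A.actBimodOne
  comp_isMonoidal {g h k} e := by
    let := A.actMonoidal
    constructor
    · ext
      rw [Functor.LaxMonoidal.comp_ε, Category.assoc]
      exact A.z_inv_comp e
    · intro M N
      ext
      rw [← cancel_epi (bimodProj _ _), Functor.LaxMonoidal.comp_μ, Category.assoc, Bimod.comp_hom',
        Bimod.comp_hom', Bimod.comp_hom', reassoc_of% bimodProj_tensorHom]
      erw [bimodProj_actTensor, reassoc_of% bimodProj_actTensor]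
      have key (t : ((A.act h).obj M ⊗ (A.act h).obj N).X ⟶ (γ h).obj (M ⊗ N).X)
          (ht : bimodProj _ _ ≫ t =
            Functor.LaxMonoidal.μ (γ h) M.X N.X ≫ (γ h).map (bimodProj M N)) :
          Functor.LaxMonoidal.μ (γ g) ((A.act h).obj M).X ((A.act h).obj N).X ≫
            (γ g).map (bimodProj ((A.act h).obj M) ((A.act h).obj N)) ≫
              (γ g).map t ≫ (actComp γ e (M ⊗ N).X).hom =
          ((actComp γ e M.X).hom ⊗ₘ (actComp γ e N.X).hom) ≫
            Functor.LaxMonoidal.μ (γ k) M.X N.X ≫ (γ k).map (bimodProj M N) := by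
        rw [← Functor.map_comp_assoc, ht, Functor.map_comp_assoc, actComp_naturality,
          reassoc_of% actComp_tensor]
      exact key _ (A.bimodProj_actTensor h M N)
  one_isMonoidal := by
    let := A.actMonoidal
    constructor
    · ext
      rw [Functor.LaxMonoidal.id_ε, Category.id_comp]
      exact A.z_one_inv.symm
    · intro M N
      ext
      rw [← cancel_epi (bimodProj _ _), Functor.LaxMonoidal.id_μ, Category.id_comp, Bimod.comp_hom',
        reassoc_of% bimodProj_tensorHom]
      have key : bimodProj M N ≫ (actOne γ (M ⊗ N).X).hom =
          ((actOne γ M.X).hom ⊗ₘ (actOne γ N.X).hom) ≫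
            Functor.LaxMonoidal.μ (γ 1) M.X N.X ≫ (γ 1).map (bimodProj M N) := by
        rw [actOne_naturality, actOne_tensor, Category.assoc]
      exact key.trans (congrArg _ (A.bimodProj_actTensor 1 M N).symm)
  comp_assoc e₁ e₂ e₃ e₄ M := by
    ext
    exact MonoidalAction.comp_assoc (γ := γ) e₁ e₂ e₃ e₄ M.X
  one_comp g M := by
    ext
    exact MonoidalAction.one_comp (γ := γ) g M.X
  comp_one g M := by
    ext
    exact MonoidalAction.comp_one (γ := γ) g M.X

lemma isInducedAction : letI := A.bimodAction; A.IsInducedAction := by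
  let := A.bimodAction
  exact
    { tensor := fun g M N => A.bimodProj_actTensor g M N
      unit := fun g => rfl
      comp := fun e M => rfl
      one := fun M => rfl }

end EquivariantAlgebra

end ActionCoherence

/-! ### Pivotal functors -/

section MapPairing

variable {D : Type*} [Category* D] [MonoidalCategory D] {E : Type*} [Category* E]
  [MonoidalCategory E]

/-- The image of a pairing under a monoidal functor. -/
def mapPairing (F : D ⥤ E) [F.Monoidal] {X Y : D} (e : Y ⊗ X ⟶ 𝟙_ D) :
    F.obj Y ⊗ F.obj X ⟶ 𝟙_ E :=
  Functor.LaxMonoidal.μ F Y X ≫ F.map e ≫ Functor.OplaxMonoidal.η F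

lemma mapPairing_whiskerRight (F : D ⥤ E) [F.Monoidal] {X Y Y' : D} (f : Y' ⟶ Y)
    (e : Y ⊗ X ⟶ 𝟙_ D) :
    mapPairing F (f ▷ X ≫ e) = F.map f ▷ F.obj X ≫ mapPairing F e := by
  rw [mapPairing, mapPairing, Functor.LaxMonoidal.μ_natural_left_assoc, Functor.map_comp_assoc]

lemma mapPairing_whiskerLeft (F : D ⥤ E) [F.Monoidal] {X X' Y : D} (f : X' ⟶ X)
    (e : Y ⊗ X ⟶ 𝟙_ D) :
    mapPairing F (Y ◁ f ≫ e) = F.obj Y ◁ F.map f ≫ mapPairing F e := by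
  rw [mapPairing, mapPairing, Functor.LaxMonoidal.μ_natural_right_assoc, Functor.map_comp_assoc]

/-- A pivotal functor commutes with the rotation of pairings. -/
lemma IsPivotalFunctor.rotate_mapPairing [RigidCategory D] [RigidCategory E]
    {δ : PivotalStructure D} {δ' : PivotalStructure E} {F : D ⥤ E} [F.Monoidal]
    (h : IsPivotalFunctor δ δ' F) {X Y : D} (e : Y ⊗ X ⟶ 𝟙_ D) :
    δ'.rotate (mapPairing F e) = mapPairing F (δ.rotate e) := by
  have h' : F.map (δ.iso X).hom ▷ F.obj Xᘁ ≫ mapPairing F (ε_ Xᘁ (Xᘁ)ᘁ) =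
    δ'.rotate (mapPairing F (ε_ X Xᘁ)) := (δ'.realizes_iff _ _ _).1 (h X)
  obtain ⟨t, rfl⟩ := exists_evaluation_eq (X := X) (X' := Xᘁ) e
  rw [mapPairing_whiskerRight, δ'.rotate_whiskerRight, ← h', δ.rotate_whiskerRight,
    δ.rotate_evaluation, mapPairing_whiskerLeft, mapPairing_whiskerRight]

end MapPairing

/-! ### The crossed category of bimodules -/

section ActionPivotal

variable {G : Type*} [Group G] {C : Type u} [Category.{v} C] [MonoidalCategory C]
  {γ : G → C ⥤ C} [MonoidalAction γ] [RigidCategory C] [HasCoequalizers C]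
  {A : EquivariantFrobeniusAlgebra γ}

namespace EquivariantFrobeniusAlgebra

/-- The unit isomorphism `γ(g)(A) ≅ A` of the induced action is `z g`. -/
lemma toUnitHom_map_η [MonoidalAction A.act] (hact : A.IsInducedAction) (g : G)
    {Q : Bimod A.alg A.alg} (f : Q ⟶ 𝟙_ (Bimod A.alg A.alg)) :
    toUnitHom ((A.act g).map f ≫ Functor.OplaxMonoidal.η (A.act g)) =
      (γ g).map (toUnitHom f) ≫ (A.z g).hom := by
  have h := congrArg Bimod.Hom.hom (Functor.Monoidal.ε_η (A.act g))
  have h' : (A.z g).inv ≫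
      toUnitHom (Q := (A.act g).obj (𝟙_ _)) (Functor.OplaxMonoidal.η (A.act g)) = 𝟙 _ := by
    rw [← hact.unit]
    exact h
  exact congrArg (fun t => (γ g).map f.hom ≫ t)
    (((Iso.inv_comp_eq (A.z g)).1 h').trans (Category.comp_id _))

/-- The pairings of objects are compatible with the action because `z g` preserves the counit. -/
lemma pairing_mapPairing [MonoidalAction A.act] (hact : A.IsInducedAction) (g : G)
    {M N : Bimod A.alg A.alg} (e : N ⊗ M ⟶ 𝟙_ (Bimod A.alg A.alg)) :
    A.pairing (mapPairing (A.act g) e) = mapPairing (γ g) (A.pairing e) := by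
  rw [pairing, pairingAlg, mapPairing, toUnitHom_comp, toUnitHom_map_η hact, Category.assoc,
    Category.assoc, Category.assoc, reassoc_of% (hact.tensor g N M), A.z_counit, mapPairing,
    pairing, pairingAlg]
  simp only [Functor.map_comp, Category.assoc]

/-- The action on bimodules is pivotal: pivotality is a statement about pairings of objects, where
it is that of `γ(g)`. -/
lemma isPivotalFunctor_act {δ : PivotalStructure C} [RigidCategory (Bimod A.alg A.alg)]
    {δ' : PivotalStructure (Bimod A.alg A.alg)} (hδ' : A.IsInducedPivotal δ δ')
    [MonoidalAction A.act] (hact : A.IsInducedAction) {g : G} (h : IsPivotalFunctor δ δ (γ g)) :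
    IsPivotalFunctor δ' δ' (A.act g) := by
  intro M
  refine (realizes_bimod_iff δ (hδ' ((A.act g).obj M)) _ _ _).2 ?_
  have h₁ := pairing_mapPairing hact g (ε_ M Mᘁ)
  have h₂ := pairing_mapPairing hact g (ε_ Mᘁ (Mᘁ)ᘁ)
  have h₃ := hom_comp_bimodPairing δ (hδ' M)
  refine (congrArg _ h₂).trans (Eq.trans ?_ (congrArg δ.rotate h₁).symm)
  rw [h.rotate_mapPairing, ← h₃, mapPairing_whiskerRight]

end EquivariantFrobeniusAlgebra

end ActionPivotal

section Crossed

variable {k : Type w} [Field k] {G : Type*} [Group G]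
    {C : Type u} [Category.{v} C] [Abelian C] [Linear k C] [MonoidalCategory C]
    [MonoidalPreadditive C] [MonoidalLinear k C] [RigidCategory C]
    {γ : G → C ⥤ C} [MonoidalAction γ] {P : G → ObjectProperty C} {δ : PivotalStructure C}
    {A : EquivariantFrobeniusAlgebra γ}

/-- The category of bimodules with the induced structures is a `G`-crossed multitensor category. -/
lemma EquivariantFrobeniusAlgebra.isGCrossed (hC : IsGCrossed k γ P δ) (hA : P 1 A.alg.X)
    [r : RigidCategory (Bimod A.alg A.alg)]
    {δ' : PivotalStructure (Bimod A.alg A.alg)} (hδ' : A.IsInducedPivotal δ δ')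
    [MonoidalAction A.act] (hact : A.IsInducedAction) :
    IsGCrossed k A.act (A.grading P) δ' where
  multitensor := bimod_isMultitensor k hC.multitensor ⟨r⟩
  grading := A.isGrading hC.grading hA
  additive g := by
    have := hC.additive g
    exact ⟨fun {M N f f'} => by ext; exact (γ g).map_add⟩
  linear g := by
    have := hC.linear g
    exact ⟨fun {M N} f c => by ext; exact (γ g).map_smul c f.hom⟩
  pivotal g := isPivotalFunctor_act hδ' hact (hC.pivotal g)
  conj g _ _ h := hC.conj g h

end Crossed

/-! ### The tensor structure of alpha-induction -/

section Extension

variable {C : Type u} [Category.{v} C] [MonoidalCategory C]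

/-- The properties of the morphisms `s X : X ⊗ A ⟶ A ⊗ X` which make `X ↦ A ⊗ X` a monoidal
functor: the algebra `A` slides under every object, compatibly with its algebra structure. -/
structure IsCrossing (A : Mon C) (s : ∀ X : C, X ⊗ A.X ⟶ A.X ⊗ X) : Prop where
  one : ∀ X, X ◁ MonObj.one (X := A.X) ≫ s X =
    (ρ_ X).hom ≫ (λ_ X).inv ≫ MonObj.one (X := A.X) ▷ X
  mul : ∀ X, X ◁ MonObj.mul (X := A.X) ≫ s X =
    (α_ X A.X A.X).inv ≫ s X ▷ A.X ≫ (α_ A.X X A.X).hom ≫ A.X ◁ s X ≫ (α_ A.X A.X X).inv ≫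
      MonObj.mul (X := A.X) ▷ X
  natural : ∀ {X Y : C} (f : X ⟶ Y), f ▷ A.X ≫ s Y = s X ≫ A.X ◁ f
  tensor : ∀ X Y : C, s (X ⊗ Y) = (α_ X Y A.X).hom ≫ X ◁ s Y ≫ (α_ X A.X Y).inv ≫ s X ▷ Y ≫
    (α_ A.X X Y).hom
  unit : s (𝟙_ C) = (λ_ A.X).hom ≫ (ρ_ A.X).inv

namespace IsCrossing

variable {A : Mon C} {s : ∀ X : C, X ⊗ A.X ⟶ A.X ⊗ X} (h : IsCrossing A s)

/-- The bimodule `A ⊗ X`. -/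
abbrev bimod (X : C) : Bimod A A := extendBimod A X (s X) (h.one X) (h.mul X)

/-- The functor `X ↦ A ⊗ X`. -/
abbrev functor : C ⥤ Bimod A A := extendFunctor A s h.one h.mul h.natural

/-- The product `(A ⊗ X) ⊗ (A ⊗ Y) ⟶ A ⊗ (X ⊗ Y)` which induces the tensor structure. -/
def tensorAux (X Y : C) : (A.X ⊗ X) ⊗ (A.X ⊗ Y) ⟶ A.X ⊗ (X ⊗ Y) :=
  (α_ (A.X ⊗ X) A.X Y).inv ≫ (h.bimod X).actRight ▷ Y ≫ (α_ A.X X Y).hom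

/-- The right action on `A ⊗ (X ⊗ Y)` moves `A` under `Y` and then acts on `A ⊗ X`. -/
lemma actRight_tensor (X Y : C) : (α_ A.X X Y).hom ▷ A.X ≫ (h.bimod (X ⊗ Y)).actRight =
    (α_ _ _ _).hom ≫ (A.X ⊗ X) ◁ s Y ≫ (α_ _ _ _).inv ≫ (h.bimod X).actRight ▷ Y ≫
      (α_ A.X X Y).hom := by
  dsimp only [bimod, extendBimod]
  rw [h.tensor]
  monoidal

lemma tensorAux_balanced (X Y : C) : (h.bimod X).actRight ▷ (A.X ⊗ Y) ≫ h.tensorAux X Y =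
    (α_ _ _ _).hom ≫ (A.X ⊗ X) ◁ (h.bimod Y).actLeft ≫ h.tensorAux X Y := by
  have h₁ := (h.bimod X).right_assoc
  calc _ = 𝟙 _ ⊗≫ ((α_ _ _ _).inv ≫ (h.bimod X).actRight ▷ A.X ≫ (h.bimod X).actRight) ▷ Y ⊗≫
        𝟙 _ := by dsimp only [tensorAux]; monoidal
    _ = _ := by rw [← h₁]; dsimp only [tensorAux, bimod, extendBimod]; monoidal

lemma actLeft_tensorAux (X Y : C) : (h.bimod X).actLeft ▷ (A.X ⊗ Y) ≫ h.tensorAux X Y =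
    (α_ _ _ _).hom ≫ A.X ◁ h.tensorAux X Y ≫ (h.bimod (X ⊗ Y)).actLeft := by
  have h₁ := (h.bimod X).middle_assoc
  calc _ = 𝟙 _ ⊗≫ ((h.bimod X).actLeft ▷ A.X ≫ (h.bimod X).actRight) ▷ Y ⊗≫
        𝟙 _ := by dsimp only [tensorAux]; monoidal
    _ = _ := by rw [h₁]; dsimp only [tensorAux, bimod, extendBimod]; monoidal

lemma tensorAux_actRight (X Y : C) : h.tensorAux X Y ▷ A.X ≫ (h.bimod (X ⊗ Y)).actRight =
    (α_ _ _ _).hom ≫ (A.X ⊗ X) ◁ (h.bimod Y).actRight ≫ h.tensorAux X Y := by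
  have h₁ := (h.bimod X).right_assoc
  have h₂ := h.actRight_tensor X Y
  calc _ = (α_ (A.X ⊗ X) A.X Y).inv ▷ A.X ≫ (h.bimod X).actRight ▷ Y ▷ A.X ≫
        ((α_ A.X X Y).hom ▷ A.X ≫ (h.bimod (X ⊗ Y)).actRight) := by
        dsimp only [tensorAux]; simp only [comp_whiskerRight, Category.assoc]
    _ = 𝟙 _ ⊗≫ ((h.bimod X).actRight ▷ (Y ⊗ A.X) ≫ (A.X ⊗ X) ◁ s Y) ⊗≫
        (h.bimod X).actRight ▷ Y ⊗≫ 𝟙 _ := by rw [h₂]; monoidal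
    _ = 𝟙 _ ⊗≫ ((A.X ⊗ X) ⊗ A.X) ◁ s Y ⊗≫ ((α_ _ _ _).inv ≫ (h.bimod X).actRight ▷ A.X ≫
        (h.bimod X).actRight) ▷ Y ⊗≫ 𝟙 _ := by rw [← whisker_exchange]; monoidal
    _ = _ := by rw [← h₁]; dsimp only [tensorAux, bimod, extendBimod]; monoidal

lemma unit_actRight : (ρ_ A.X).inv ▷ A.X ≫ (h.bimod (𝟙_ C)).actRight =
    MonObj.mul (X := A.X) ≫ (ρ_ A.X).inv := by
  dsimp only [bimod, extendBimod]
  rw [h.unit]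
  monoidal

lemma tensorAux_natural_left {X X' : C} (f : X ⟶ X') (Y : C) :
    (A.X ◁ f) ▷ (A.X ⊗ Y) ≫ h.tensorAux X' Y = h.tensorAux X Y ≫ A.X ◁ (f ▷ Y) := by
  have h₁ : (h.bimod X).actRight ≫ A.X ◁ f = (A.X ◁ f) ▷ A.X ≫ (h.bimod X').actRight :=
    (h.functor.map f).right_act_hom
  calc _ = 𝟙 _ ⊗≫ ((A.X ◁ f) ▷ A.X ≫ (h.bimod X').actRight) ▷ Y ⊗≫ 𝟙 _ := by
        dsimp only [tensorAux]; monoidal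
    _ = _ := by rw [← h₁]; dsimp only [tensorAux]; monoidal

lemma tensorAux_natural_right (X : C) {Y Y' : C} (f : Y ⟶ Y') :
    (A.X ⊗ X) ◁ (A.X ◁ f) ≫ h.tensorAux X Y' = h.tensorAux X Y ≫ A.X ◁ (X ◁ f) := by
  calc _ = 𝟙 _ ⊗≫ (((A.X ⊗ X) ⊗ A.X) ◁ f ≫ (h.bimod X).actRight ▷ Y') ⊗≫ 𝟙 _ := by
        dsimp only [tensorAux]; monoidal
    _ = _ := by rw [whisker_exchange]; dsimp only [tensorAux]; monoidal

lemma tensorAux_assoc (X Y Z : C) :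
    h.tensorAux X Y ▷ (A.X ⊗ Z) ≫ h.tensorAux (X ⊗ Y) Z ≫ A.X ◁ (α_ X Y Z).hom =
      (α_ _ _ _).hom ≫ (A.X ⊗ X) ◁ h.tensorAux Y Z ≫ h.tensorAux X (Y ⊗ Z) := by
  have h₁ := h.tensorAux_actRight X Y
  calc _ = 𝟙 _ ⊗≫ (h.tensorAux X Y ▷ A.X ≫ (h.bimod (X ⊗ Y)).actRight) ▷ Z ⊗≫ 𝟙 _ := by
        dsimp only [tensorAux]; monoidal
    _ = _ := by rw [h₁]; dsimp only [tensorAux]; monoidal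

variable [HasCoequalizers C] [RigidCategory C]

/-- The isomorphism `(A ⊗ X) ⊗_A (A ⊗ Y) ≅ A ⊗ (X ⊗ Y)` of objects. -/
noncomputable def tensorX (X Y : C) : (h.bimod X ⊗ h.bimod Y).X ≅ A.X ⊗ (X ⊗ Y) where
  hom := bimodDesc (M := h.bimod X) (N := h.bimod Y) (h.tensorAux X Y) (h.tensorAux_balanced X Y)
  inv := (α_ A.X X Y).inv ≫ (A.X ⊗ X) ◁ ((λ_ Y).inv ≫ MonObj.one (X := A.X) ▷ Y) ≫
    bimodProj (h.bimod X) (h.bimod Y)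
  hom_inv_id := by
    have h₁ := bimodProj_balanced (h.bimod X) (h.bimod Y)
    rw [← cancel_epi (bimodProj _ _), reassoc_of% bimodProj_desc]
    calc _ = 𝟙 _ ⊗≫ ((h.bimod X).actRight ▷ Y ≫ (A.X ⊗ X) ◁ ((λ_ Y).inv ≫
          MonObj.one (X := A.X) ▷ Y)) ≫ bimodProj (h.bimod X) (h.bimod Y) := by
          dsimp only [tensorAux]; monoidal
      _ = 𝟙 _ ⊗≫ ((A.X ⊗ X) ⊗ A.X) ◁ ((λ_ Y).inv ≫ MonObj.one (X := A.X) ▷ Y) ⊗≫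
          (h.bimod X).actRight ▷ (A.X ⊗ Y) ≫ bimodProj (h.bimod X) (h.bimod Y) := by
          rw [← whisker_exchange]; monoidal
      _ = 𝟙 _ ⊗≫ (A.X ⊗ X) ◁ ((A.X ◁ MonObj.one (X := A.X) ≫ MonObj.mul (X := A.X)) ▷ Y) ⊗≫
          bimodProj (h.bimod X) (h.bimod Y) := by
          rw [h₁]; dsimp only [bimod, extendBimod]; monoidal
      _ = _ := by rw [MonObj.mul_one]; monoidal
  inv_hom_id := by
    rw [Category.assoc, Category.assoc, bimodProj_desc]
    have h₁ := (h.bimod X).actRight_one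
    calc _ = 𝟙 _ ⊗≫ ((A.X ⊗ X) ◁ MonObj.one (X := A.X) ≫ (h.bimod X).actRight) ▷ Y ⊗≫ 𝟙 _ := by
          dsimp only [tensorAux]; monoidal
      _ = _ := by rw [h₁]; monoidal

lemma bimodProj_tensorX (X Y : C) :
    bimodProj (h.bimod X) (h.bimod Y) ≫ (h.tensorX X Y).hom = h.tensorAux X Y :=
  bimodProj_desc (M := h.bimod X) (N := h.bimod Y) _ (h.tensorAux_balanced X Y)

/-- The isomorphism `(A ⊗ X) ⊗_A (A ⊗ Y) ≅ A ⊗ (X ⊗ Y)` of bimodules. -/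
noncomputable def tensorIso (X Y : C) : h.bimod X ⊗ h.bimod Y ≅ h.bimod (X ⊗ Y) :=
  Bimod.isoOfIso (h.tensorX X Y)
    (by
      rw [← cancel_epi (A.X ◁ bimodProj _ _), reassoc_of% bimodProj_actLeft, bimodProj_tensorX,
        ← whiskerLeft_comp_assoc, bimodProj_tensorX, actLeft_tensorAux, Iso.inv_hom_id_assoc])
    (by
      rw [← cancel_epi (bimodProj _ _ ▷ A.X), reassoc_of% bimodProj_actRight, bimodProj_tensorX,
        ← comp_whiskerRight_assoc, bimodProj_tensorX, tensorAux_actRight])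

lemma bimodProj_tensorIso (X Y : C) :
    bimodProj (h.bimod X) (h.bimod Y) ≫ (h.tensorIso X Y).hom.hom = h.tensorAux X Y :=
  h.bimodProj_tensorX X Y

/-- The isomorphism `A ≅ A ⊗ 𝟙` of bimodules. -/
noncomputable def unitIso : 𝟙_ (Bimod A A) ≅ h.bimod (𝟙_ C) :=
  Bimod.isoOfIso (P := Bimod.regular A) (Q := h.bimod (𝟙_ C)) (ρ_ A.X).symm
    (by dsimp [bimod, extendBimod, Bimod.regular]; monoidal)
    h.unit_actRight.symm

/-- The monoidal structure of the functor `X ↦ A ⊗ X`. -/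
noncomputable def core : h.functor.CoreMonoidal where
  εIso := h.unitIso
  μIso X Y := h.tensorIso X Y
  μIso_hom_natural_left f Y := by
    ext
    dsimp only [functor, extendFunctor]
    rw [← cancel_epi (bimodProj _ _), Bimod.comp_hom', Bimod.comp_hom',
      reassoc_of% bimodProj_whiskerRight, bimodProj_tensorIso, reassoc_of% bimodProj_tensorIso,
      tensorAux_natural_left]
  μIso_hom_natural_right X f := by
    ext
    dsimp only [functor, extendFunctor]
    rw [← cancel_epi (bimodProj _ _), Bimod.comp_hom', Bimod.comp_hom',
      reassoc_of% bimodProj_whiskerLeft, bimodProj_tensorIso, reassoc_of% bimodProj_tensorIso,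
      tensorAux_natural_right]
  associativity X Y Z := by
    ext
    dsimp only [functor, extendFunctor]
    rw [← cancel_epi (bimodProj _ _), ← cancel_epi (bimodProj _ _ ▷ (A.X ⊗ Z))]
    simp only [Bimod.comp_hom']
    rw [reassoc_of% bimodProj_whiskerRight, ← comp_whiskerRight_assoc, bimodProj_tensorIso,
      reassoc_of% bimodProj_tensorIso,
      (reassoc_of% bimodProj_associator) (h.bimod X) (h.bimod Y) (h.bimod Z),
      reassoc_of% bimodProj_whiskerLeft, bimodProj_tensorIso, ← whiskerLeft_comp_assoc,
      bimodProj_tensorIso, tensorAux_assoc]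
  left_unitality X := by
    ext
    dsimp only [functor, extendFunctor]
    rw [← cancel_epi (bimodProj _ _), bimodProj_leftUnitor, Bimod.comp_hom', Bimod.comp_hom',
      reassoc_of% bimodProj_whiskerRight, reassoc_of% bimodProj_tensorIso]
    have h₁ := h.unit_actRight
    have h₂ : (α_ A.X A.X X).inv ≫ MonObj.mul (X := A.X) ▷ X =
        (ρ_ A.X).inv ▷ (A.X ⊗ X) ≫ h.tensorAux (𝟙_ C) X ≫ A.X ◁ (λ_ X).hom := by
      calc _ = 𝟙 _ ⊗≫ (MonObj.mul (X := A.X) ≫ (ρ_ A.X).inv) ▷ X ⊗≫ 𝟙 _ := by monoidal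
        _ = _ := by rw [← h₁]; dsimp only [tensorAux]; monoidal
    exact h₂
  right_unitality X := by
    ext
    dsimp only [functor, extendFunctor]
    rw [← cancel_epi (bimodProj _ _), bimodProj_rightUnitor, Bimod.comp_hom', Bimod.comp_hom',
      reassoc_of% bimodProj_whiskerLeft, reassoc_of% bimodProj_tensorIso]
    have h₂ : (h.bimod X).actRight =
        (A.X ⊗ X) ◁ (ρ_ A.X).inv ≫ h.tensorAux X (𝟙_ C) ≫ A.X ◁ (ρ_ X).hom := by
      dsimp only [tensorAux]; monoidal
    exact h₂

end IsCrossing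

end Extension

/-! ### Equivariance of alpha-induction -/

section Equivariance

variable {G : Type*} [Group G] {C : Type u} [Category.{v} C] [MonoidalCategory C]
  {γ : G → C ⥤ C} [MonoidalAction γ]

/-- A crossing which is compatible with the action of `G` on `C` and on the algebra `A`. -/
structure IsEquivariantCrossing (A : EquivariantAlgebra γ)
    (s : ∀ X : C, X ⊗ A.alg.X ⟶ A.alg.X ⊗ X) : Prop extends IsCrossing A.alg s where
  equivariant : ∀ (g : G) (X : C), (γ g).obj X ◁ (A.z g).inv ≫
      Functor.LaxMonoidal.μ (γ g) X A.alg.X ≫ (γ g).map (s X) =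
    s ((γ g).obj X) ≫ (A.z g).inv ▷ (γ g).obj X ≫ Functor.LaxMonoidal.μ (γ g) A.alg.X X

namespace IsEquivariantCrossing

variable {A : EquivariantAlgebra γ} {s : ∀ X : C, X ⊗ A.alg.X ⟶ A.alg.X ⊗ X}
  (h : IsEquivariantCrossing A s)

variable (A) in
/-- The isomorphism `A ⊗ γ(g)(X) ≅ γ(g)(A ⊗ X)` of objects. -/
def _root_.EquivariantTensor.EquivariantAlgebra.twist (g : G) (X : C) :
    A.alg.X ⊗ (γ g).obj X ≅ (γ g).obj (A.alg.X ⊗ X) :=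
  whiskerRightIso (A.z g).symm ((γ g).obj X) ≪≫ Functor.Monoidal.μIso (γ g) A.alg.X X

variable (A) in
lemma _root_.EquivariantTensor.EquivariantAlgebra.twist_hom (g : G) (X : C) :
    (A.twist g X).hom =
      (A.z g).inv ▷ (γ g).obj X ≫ Functor.LaxMonoidal.μ (γ g) A.alg.X X := rfl

lemma actLeft_twist (g : G) (X : C) : (h.bimod ((γ g).obj X)).actLeft ≫ (A.twist g X).hom =
    A.alg.X ◁ (A.twist g X).hom ≫ ((A.act g).obj (h.bimod X)).actLeft := by
  have hm := A.mul_z_inv g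
  dsimp only [IsCrossing.bimod, extendBimod]
  simp only [A.twist_hom, Functor.map_comp, Category.assoc, whiskerLeft_comp]
  rw [← comp_whiskerRight_assoc, hm, comp_whiskerRight_assoc, comp_whiskerRight_assoc,
    Functor.LaxMonoidal.μ_natural_left, whisker_exchange_assoc (A.z g).inv,
    Functor.LaxMonoidal.associativity_inv_assoc, MonoidalCategory.tensorHom_def']
  monoidal

lemma actRight_twist (g : G) (X : C) : (h.bimod ((γ g).obj X)).actRight ≫ (A.twist g X).hom =
    (A.twist g X).hom ▷ A.alg.X ≫ ((A.act g).obj (h.bimod X)).actRight := by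
  have h₁ := h.actLeft_twist g X
  have he := h.equivariant g X
  rw [← A.twist_hom] at he
  have h₂ : (α_ A.alg.X ((γ g).obj X) A.alg.X).hom ≫ A.alg.X ◁ ((γ g).obj X ◁ (A.z g).inv ≫
      Functor.LaxMonoidal.μ (γ g) X A.alg.X) ≫ (A.z g).inv ▷ _ ≫
        Functor.LaxMonoidal.μ (γ g) A.alg.X (X ⊗ A.alg.X) =
      (A.twist g X).hom ▷ A.alg.X ≫ (γ g).obj (A.alg.X ⊗ X) ◁ (A.z g).inv ≫
        Functor.LaxMonoidal.μ (γ g) (A.alg.X ⊗ X) A.alg.X ≫ (γ g).map (α_ _ _ _).hom := by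
    simp only [A.twist_hom, comp_whiskerRight, whiskerLeft_comp, Category.assoc]
    rw [← whisker_exchange_assoc (Functor.LaxMonoidal.μ (γ g) A.alg.X X),
      Functor.LaxMonoidal.associativity, whisker_exchange_assoc (A.z g).inv,
      whisker_exchange_assoc (A.z g).inv]
    monoidal
  dsimp only [IsCrossing.bimod, extendBimod] at h₁ ⊢
  simp only [Category.assoc] at h₁ ⊢
  rw [h₁, ← whiskerLeft_comp_assoc, ← he]
  simp only [Functor.map_comp]
  rw [← reassoc_of% h₂]
  simp only [whiskerLeft_comp, Category.assoc]
  rw [whisker_exchange_assoc (A.z g).inv ((γ g).map (s X)),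
    Functor.LaxMonoidal.μ_natural_right_assoc]

lemma twist_natural (g : G) {X Y : C} (f : X ⟶ Y) :
    A.alg.X ◁ (γ g).map f ≫ (A.twist g Y).hom =
      (A.twist g X).hom ≫ (γ g).map (A.alg.X ◁ f) := by
  rw [A.twist_hom, A.twist_hom, Category.assoc, ← Functor.LaxMonoidal.μ_natural_right,
    whisker_exchange_assoc]

/-- The isomorphism `η g : α(γ(g)(X)) ≅ γ(g)(α(X))` of bimodules. -/
def twistIso (g : G) : γ g ⋙ h.functor ≅ h.functor ⋙ A.act g :=
  NatIso.ofComponents (fun X => Bimod.isoOfIso (A.twist g X) (h.actLeft_twist g X)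
    (h.actRight_twist g X)) (fun f => by ext; exact twist_natural g f)

end IsEquivariantCrossing

end Equivariance

section Standard

variable {G : Type*} [Group G] {C : Type u} [Category.{v} C] [MonoidalCategory C]
  {γ : G → C ⥤ C} [MonoidalAction γ] {A : EquivariantAlgebra γ}
  {s : ∀ X : C, X ⊗ A.alg.X ⟶ A.alg.X ⊗ X}

/-- The tensor structure of a standard alpha-induction is induced by `tensorAux`. -/
lemma IsCrossing.bimodProj_μ_assoc [HasCoequalizers C] [RigidCategory C] {h : IsCrossing A.alg s}
    {m : h.functor.Monoidal} {η : ∀ g, γ g ⋙ h.functor ≅ h.functor ⋙ A.act g}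
    (hs : A.IsStandard m η) (X Y : C) {Z : C} (t : A.alg.X ⊗ (X ⊗ Y) ⟶ Z) :
    bimodProj (h.bimod X) (h.bimod Y) ≫ (Functor.LaxMonoidal.μ h.functor X Y).hom ≫ t =
      h.tensorAux X Y ≫ t :=
  (Category.assoc _ _ _).symm.trans (congrArg (· ≫ t) (hs.tensor X Y))

namespace IsEquivariantCrossing

lemma twist_comp {g h k : G} (e : g * h = k) (X : C) :
    A.alg.X ◁ (actComp γ e X).hom ≫ (A.twist k X).hom =
      (A.twist g ((γ h).obj X)).hom ≫ (γ g).map (A.twist h X).hom ≫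
        (actComp γ e (A.alg.X ⊗ X)).hom := by
  have hz := A.z_inv_comp e
  simp only [A.twist_hom, Functor.map_comp, Category.assoc]
  rw [← Functor.LaxMonoidal.μ_natural_left_assoc, actComp_tensor, MonoidalCategory.tensorHom_def,
    whisker_exchange_assoc, ← hz]
  simp only [comp_whiskerRight, Category.assoc]

lemma twist_one (X : C) :
    A.alg.X ◁ (actOne γ X).hom ≫ (A.twist 1 X).hom = (actOne γ (A.alg.X ⊗ X)).hom := by
  rw [A.twist_hom, A.z_one_inv, actOne_tensor, MonoidalCategory.tensorHom_def', Category.assoc]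

lemma twist_assoc (g : G) (X Y : C) : (α_ A.alg.X ((γ g).obj X) ((γ g).obj Y)).hom ≫
    A.alg.X ◁ Functor.LaxMonoidal.μ (γ g) X Y ≫ (A.twist g (X ⊗ Y)).hom =
      (A.twist g X).hom ▷ (γ g).obj Y ≫ Functor.LaxMonoidal.μ (γ g) (A.alg.X ⊗ X) Y ≫
        (γ g).map (α_ A.alg.X X Y).hom := by
  simp only [A.twist_hom, comp_whiskerRight, Category.assoc]
  rw [Functor.LaxMonoidal.associativity, whisker_exchange_assoc, associator_naturality_left_assoc]

lemma twist_unit (g : G) : (ρ_ A.alg.X).inv ≫ A.alg.X ◁ Functor.LaxMonoidal.ε (γ g) ≫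
    (A.twist g (𝟙_ C)).hom = (A.z g).inv ≫ (γ g).map (ρ_ A.alg.X).inv := by
  rw [A.twist_hom, whisker_exchange_assoc, ← rightUnitor_inv_naturality_assoc,
    Functor.LaxMonoidal.right_unitality_inv]

variable (h : IsEquivariantCrossing A s)

/-- The isomorphisms `A ⊗ γ(g)(X) ≅ γ(g)(A ⊗ X)` are compatible with the products `tensorAux`. -/
lemma twist_tensor (g : G) (X Y : C) :
    h.tensorAux ((γ g).obj X) ((γ g).obj Y) ≫ A.alg.X ◁ Functor.LaxMonoidal.μ (γ g) X Y ≫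
        (A.twist g (X ⊗ Y)).hom =
      ((A.twist g X).hom ⊗ₘ (A.twist g Y).hom) ≫
        Functor.LaxMonoidal.μ (γ g) (A.alg.X ⊗ X) (A.alg.X ⊗ Y) ≫ (γ g).map (h.tensorAux X Y) := by
  have h₁ := h.actRight_twist g X
  have h₂ : (γ g).obj (A.alg.X ⊗ X) ◁ (A.twist g Y).hom ≫
      Functor.LaxMonoidal.μ (γ g) (A.alg.X ⊗ X) (A.alg.X ⊗ Y) ≫ (γ g).map (α_ _ _ _).inv =
      (α_ _ _ _).inv ≫ ((γ g).obj (A.alg.X ⊗ X) ◁ (A.z g).inv ≫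
        Functor.LaxMonoidal.μ (γ g) (A.alg.X ⊗ X) A.alg.X) ▷ (γ g).obj Y ≫
          Functor.LaxMonoidal.μ (γ g) _ _ := by
    rw [A.twist_hom, whiskerLeft_comp_assoc, Functor.LaxMonoidal.associativity_inv,
      comp_whiskerRight_assoc, associator_inv_naturality_middle_assoc]
  dsimp only [IsCrossing.tensorAux]
  simp only [Category.assoc]
  rw [twist_assoc, ← comp_whiskerRight_assoc, h₁, MonoidalCategory.tensorHom_def, Category.assoc,
    Functor.map_comp, Functor.map_comp, reassoc_of% h₂]
  simp only [comp_whiskerRight, Category.assoc]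
  rw [Functor.LaxMonoidal.μ_natural_left_assoc, associator_inv_naturality_left_assoc]
  simp only [comp_whiskerRight]

variable [HasCoequalizers C] [RigidCategory C]

/-- The standard tensor structure of `X ↦ A ⊗ X` exists. -/
lemma exists_isStandard :
    ∃ (m : h.functor.Monoidal) (η : ∀ g, γ g ⋙ h.functor ≅ h.functor ⋙ A.act g),
    A.IsStandard m η :=
  ⟨h.core.toMonoidal, h.twistIso,
    { tensor := h.bimodProj_tensorIso
      unit := rfl
      action := fun _ _ => rfl }⟩

variable {h} {m : h.functor.Monoidal} {η : ∀ g, γ g ⋙ h.functor ≅ h.functor ⋙ A.act g}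
  (hs : A.IsStandard m η)

include hs

lemma twist_isMonoidal [MonoidalAction A.act] (hact : A.IsInducedAction) (g : G) :
    NatTrans.IsMonoidal (η g).hom where
  unit := by
    ext
    rw [Functor.LaxMonoidal.comp_ε, Functor.LaxMonoidal.comp_ε, Category.assoc]
    have h₁ := twist_unit (A := A) g
    have h₂ := hs.action g (𝟙_ C)
    have h₃ := hs.unit
    have h₄ := hact.unit g
    exact (congrArg₂ (fun a b => a ≫ A.alg.X ◁ Functor.LaxMonoidal.ε (γ g) ≫ b) h₃ h₂).trans
      (h₁.trans (congrArg₂ (fun a b => a ≫ (γ g).map b) h₄ h₃).symm)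
  tensor X Y := by
    ext
    have h₁ := h.twist_tensor g X Y
    rw [← cancel_epi (bimodProj _ _), Functor.LaxMonoidal.comp_μ, Functor.LaxMonoidal.comp_μ]
    simp only [Bimod.comp_hom', Category.assoc]
    have h₃ := hact.tensor g (h.bimod X) (h.bimod Y)
    have h₄ := ((γ g).map_comp _ _).symm.trans (congrArg (γ g).map (hs.tensor X Y))
    rw [reassoc_of% bimodProj_tensorHom, hs.action, hs.action, hs.action]
    refine (IsCrossing.bimodProj_μ_assoc hs _ _ _).trans (Eq.trans ?_ (congrArg
      (fun t => ((A.twist g X).hom ⊗ₘ (A.twist g Y).hom) ≫ t) ((reassoc_of% h₃) _)).symm)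
    exact h₁.trans (congrArg (fun t => ((A.twist g X).hom ⊗ₘ (A.twist g Y).hom) ≫
      Functor.LaxMonoidal.μ (γ g) (A.alg.X ⊗ X) (A.alg.X ⊗ Y) ≫ t) h₄).symm

lemma η_comp [MonoidalAction A.act] (hact : A.IsInducedAction) {g h' k : G} (e : g * h' = k)
    (X : C) :
    h.functor.map (actComp γ e X).hom ≫ (η k).hom.app X =
      (η g).hom.app ((γ h').obj X) ≫ (A.act g).map ((η h').hom.app X) ≫
        (actComp A.act e (h.functor.obj X)).hom := by
  ext
  have h₁ := twist_comp (A := A) e X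
  simp only [Bimod.comp_hom']
  rw [hs.action, hs.action, hs.action, hact.comp]
  exact h₁

lemma η_one [MonoidalAction A.act] (hact : A.IsInducedAction) (X : C) :
    h.functor.map (actOne γ X).hom ≫ (η 1).hom.app X = (actOne A.act (h.functor.obj X)).hom := by
  ext
  have h₁ := twist_one (A := A) X
  simp only [Bimod.comp_hom']
  rw [hs.action, hact.one]
  exact h₁

end IsEquivariantCrossing

end Standard

/-! ### Exactness of alpha-induction -/

section Exact

variable {C : Type u} [Category.{v} C] [MonoidalCategory C] [Abelian C] [MonoidalPreadditive C]
  [RigidCategory C]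

variable {A : Mon C}

instance : (Bimod.forget A : Bimod A A ⥤ C).Additive where

instance : (Bimod.forget A : Bimod A A ⥤ C).Faithful where
  map_injective h := by ext; exact h

instance {M N : Bimod A A} (f : M ⟶ N) : PreservesLimit (parallelPair f 0)
    (Bimod.forget A : Bimod A A ⥤ C) :=
  preservesLimit_of_preserves_limit_cone (kernelBimodIsLimit f)
    ((KernelFork.isLimitMapConeEquiv _ (Bimod.forget A)).symm (kernelIsKernel f.hom))

instance {M N : Bimod A A} (f : M ⟶ N) : PreservesColimit (parallelPair f 0)
    (Bimod.forget A : Bimod A A ⥤ C) :=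
  preservesColimit_of_preserves_colimit_cocone (cokernelBimodIsColimit f)
    ((CokernelCofork.isColimitMapCoconeEquiv _ (Bimod.forget A)).symm (cokernelIsCokernel f.hom))

/-- An additive functor to bimodules is exact if it is exact on underlying objects: the forgetful
functor is faithful and exact, so that it reflects exact sequences. -/
lemma exact_of_comp_forget {F : C ⥤ Bimod A A} [F.Additive]
    (h : (F ⋙ Bimod.forget A).PreservesHomology) :
    PreservesFiniteLimits F ∧ PreservesFiniteColimits F := by
  let U : Bimod A A ⥤ C := Bimod.forget A
  have : PreservesFiniteLimits U := U.preservesFiniteLimits_of_preservesKernels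
  have : PreservesFiniteColimits U := U.preservesFiniteColimits_of_preservesCokernels
  refine ((F.exact_tfae).out 1 3).1 fun S hS => ?_
  rw [← ShortComplex.exact_map_iff_of_faithful _ U]
  exact hS.map (F ⋙ U)

instance (X : C) : PreservesFiniteLimits (tensorLeft X) :=
  have := (tensorLeftAdjunction X (Xᘁ)).rightAdjoint_preservesLimits
  inferInstance

end Exact

/-! ### Pivotality of alpha-induction -/

section Pivotal

variable {G : Type*} [Group G] {C : Type u} [Category.{v} C] [MonoidalCategory C]
  {γ : G → C ⥤ C} [MonoidalAction γ] {A : EquivariantFrobeniusAlgebra γ}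
  {s : ∀ X : C, X ⊗ A.alg.X ⟶ A.alg.X ⊗ X}

namespace IsCrossing

variable (h : IsCrossing A.alg s)

/-- The pairing of `A ⊗ Y` with `A ⊗ X` induced by a pairing of `Y` with `X`. -/
def extendPairing {X Y : C} (e : Y ⊗ X ⟶ 𝟙_ C) : (A.alg.X ⊗ Y) ⊗ (A.alg.X ⊗ X) ⟶ 𝟙_ C :=
  h.tensorAux Y X ≫ A.alg.X ◁ e ≫ (ρ_ A.alg.X).hom ≫ ComonObj.counit (X := A.alg.X)

/-- Moving `A` under `X` first, the pairing becomes the pairing of `Y` with `X` followed by the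
Frobenius form. -/
lemma extendPairing_crossing_left {X Y : C} (e : Y ⊗ X ⟶ 𝟙_ C) :
    (A.alg.X ⊗ Y) ◁ s X ≫ h.extendPairing e =
      𝟙 _ ⊗≫ A.alg.X ◁ e ▷ A.alg.X ⊗≫ A.form := by
  have h₁ := h.actRight_tensor Y X
  have h₂ := (h.functor.map e).right_act_hom
  have h₃ := h.unit_actRight
  have h₄ : (h.bimod (Y ⊗ X)).actRight ≫ A.alg.X ◁ e =
    (A.alg.X ◁ e) ▷ A.alg.X ≫ (h.bimod (𝟙_ C)).actRight := h₂
  calc _ = 𝟙 _ ⊗≫ ((α_ _ _ _).hom ≫ (A.alg.X ⊗ Y) ◁ s X ≫ (α_ _ _ _).inv ≫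
        (h.bimod Y).actRight ▷ X ≫ (α_ _ _ _).hom) ⊗≫ A.alg.X ◁ e ⊗≫
          ComonObj.counit (X := A.alg.X) := by
        dsimp only [extendPairing, tensorAux]; monoidal
    _ = 𝟙 _ ⊗≫ ((h.bimod (Y ⊗ X)).actRight ≫ A.alg.X ◁ e) ⊗≫
          ComonObj.counit (X := A.alg.X) := by rw [← h₁]; monoidal
    _ = 𝟙 _ ⊗≫ (A.alg.X ◁ e) ▷ A.alg.X ⊗≫ ((ρ_ A.alg.X).inv ▷ A.alg.X ≫
          (h.bimod (𝟙_ C)).actRight) ⊗≫ ComonObj.counit (X := A.alg.X) := by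
        rw [h₄]; monoidal
    _ = _ := by rw [h₃]; dsimp only [EquivariantFrobeniusAlgebra.form]; monoidal

/-- Dually to `extendPairing_crossing_left`, the pairing becomes the Frobenius form followed by the
pairing of `X` with `Y`. This uses that the crossing respects the counit. -/
lemma extendPairing_crossing_right
    (hε : ∀ X, s X ≫ ComonObj.counit (X := A.alg.X) ▷ X =
      X ◁ ComonObj.counit (X := A.alg.X) ≫ (ρ_ X).hom ≫ (λ_ X).inv)
    {X Y : C} (e : X ⊗ Y ⟶ 𝟙_ C) :
    s X ▷ (A.alg.X ⊗ Y) ≫ h.extendPairing e = 𝟙 _ ⊗≫ X ◁ A.form ▷ Y ⊗≫ e := by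
  have h₁ := h.mul X
  calc _ = 𝟙 _ ⊗≫ ((α_ X A.alg.X A.alg.X).inv ≫ s X ▷ A.alg.X ≫ (α_ A.alg.X X A.alg.X).hom ≫
        A.alg.X ◁ s X ≫ (α_ A.alg.X A.alg.X X).inv ≫ MonObj.mul (X := A.alg.X) ▷ X) ▷ Y ⊗≫
          (A.alg.X ◁ e ≫ ComonObj.counit (X := A.alg.X) ▷ 𝟙_ C) ⊗≫ 𝟙 _ := by
        dsimp only [extendPairing, tensorAux, bimod, extendBimod]; monoidal
    _ = 𝟙 _ ⊗≫ (X ◁ MonObj.mul (X := A.alg.X)) ▷ Y ⊗≫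
          (s X ≫ ComonObj.counit (X := A.alg.X) ▷ X) ▷ Y ⊗≫ e := by
        rw [← h₁, whisker_exchange]; monoidal
    _ = _ := by rw [hε]; dsimp only [EquivariantFrobeniusAlgebra.form]; monoidal

/-- Rotation commutes with the passage from pairings to pairings of extended objects: rotating `X`
and then `A` past `A ⊗ Y` uses the symmetry of the Frobenius form. -/
lemma rotate_extendPairing [RigidCategory C] {δ : PivotalStructure C} (hA : A.IsSymmetric δ)
    [∀ X, Epi (s X)]
    (hε : ∀ X, s X ≫ ComonObj.counit (X := A.alg.X) ▷ X =
      X ◁ ComonObj.counit (X := A.alg.X) ≫ (ρ_ X).hom ≫ (λ_ X).inv)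
    {X Y : C} (e : Y ⊗ X ⟶ 𝟙_ C) :
    δ.rotate (h.extendPairing e) = h.extendPairing (δ.rotate e) := by
  have h₁ : (α_ (A.alg.X ⊗ Y) X A.alg.X).hom ≫ (A.alg.X ⊗ Y) ◁ s X ≫ h.extendPairing e =
      ((α_ _ _ _).hom ≫ A.alg.X ◁ e ≫ (ρ_ _).hom) ▷ A.alg.X ≫ A.form := by
    rw [extendPairing_crossing_left]; monoidal
  have h₂ : (α_ A.alg.X (A.alg.X ⊗ Y) X).hom ≫
      A.alg.X ◁ ((α_ _ _ _).hom ≫ A.alg.X ◁ e ≫ (ρ_ _).hom) ≫ A.form =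
        ((α_ _ _ _).inv ≫ A.form ▷ Y ≫ (λ_ _).hom) ▷ X ≫ e := by
    calc _ = 𝟙 _ ⊗≫ ((A.alg.X ⊗ A.alg.X) ◁ e ≫ A.form ▷ 𝟙_ C) ⊗≫ 𝟙 _ := by monoidal
      _ = _ := by rw [whisker_exchange]; monoidal
  have : Epi (s X ▷ (A.alg.X ⊗ Y)) :=
    inferInstanceAs (Epi ((tensorRight (A.alg.X ⊗ Y)).map (s X)))
  -- After composition with `s X` both factors `A` are adjacent, and `A` and `X` can be rotated
  -- separately.
  rw [← cancel_epi (s X ▷ (A.alg.X ⊗ Y)), ← δ.rotate_whiskerLeft, δ.rotate_tensor, h₁,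
    δ.rotate_whiskerRight, hA.rotate_form, h₂, δ.rotate_whiskerRight,
    h.extendPairing_crossing_right hε]
  monoidal

variable [RigidCategory C] [HasCoequalizers C] {h} {m : h.functor.Monoidal}
  {η : ∀ g, γ g ⋙ h.functor ≅ h.functor ⋙ A.act g} (hs : A.IsStandard m η)

include hs

/-- The unit isomorphism of a standard alpha-induction is `A ⊗ 𝟙 ≅ A`. -/
lemma toUnitHom_map_η {X : C} (f : X ⟶ 𝟙_ C) :
    toUnitHom (h.functor.map f ≫ Functor.OplaxMonoidal.η h.functor) =
      A.alg.X ◁ f ≫ (ρ_ A.alg.X).hom := by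
  have h₁ := congrArg Bimod.Hom.hom (Functor.Monoidal.ε_η h.functor)
  have h₂ : (ρ_ A.alg.X).inv ≫ toUnitHom (Q := h.bimod (𝟙_ C))
      (Functor.OplaxMonoidal.η h.functor) = 𝟙 _ := by
    rw [← hs.unit]
    exact h₁
  exact congrArg (fun t => A.alg.X ◁ f ≫ t)
    (((Iso.inv_comp_eq (ρ_ A.alg.X)).1 h₂).trans (Category.comp_id _))

/-- Alpha-induction sends the pairing `e` to `extendPairing e` on underlying objects. -/
lemma pairing_mapPairing {X Y : C} (e : Y ⊗ X ⟶ 𝟙_ C) :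
    A.pairing (mapPairing h.functor e) = h.extendPairing e := by
  have h₁ := congrArg (fun t => bimodProj (h.bimod Y) (h.bimod X) ≫
    (Functor.LaxMonoidal.μ h.functor Y X).hom ≫ t ≫ ComonObj.counit (X := A.alg.X))
      (toUnitHom_map_η hs e)
  have h₂ := congrArg (bimodProj (h.bimod Y) (h.bimod X) ≫ ·)
    (Category.assoc (Functor.LaxMonoidal.μ h.functor Y X).hom
      (toUnitHom (h.functor.map e ≫ Functor.OplaxMonoidal.η h.functor))
      (ComonObj.counit (X := A.alg.X)))
  exact (Category.assoc _ _ _).trans (h₂.trans (h₁.trans ((bimodProj_μ_assoc hs Y X _).trans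
    (congrArg (h.tensorAux Y X ≫ ·) (Category.assoc _ _ _)))))

lemma isPivotalFunctor {δ : PivotalStructure C} (hA : A.IsSymmetric δ) [∀ X, Epi (s X)]
    (hε : ∀ X, s X ≫ ComonObj.counit (X := A.alg.X) ▷ X =
      X ◁ ComonObj.counit (X := A.alg.X) ≫ (ρ_ X).hom ≫ (λ_ X).inv)
    [RigidCategory (Bimod A.alg A.alg)] {δ' : PivotalStructure (Bimod A.alg A.alg)}
    (hδ' : A.IsInducedPivotal δ δ') : IsPivotalFunctor δ δ' h.functor := by
  intro X
  refine (EquivariantFrobeniusAlgebra.realizes_bimod_iff δ (hδ' _) _ _ _).2 ?_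
  have h₁ := pairing_mapPairing hs (ε_ X Xᘁ)
  have h₂ := pairing_mapPairing hs ((δ.iso X).hom ▷ Xᘁ ≫ ε_ Xᘁ (Xᘁ)ᘁ)
  rw [mapPairing_whiskerRight, EquivariantFrobeniusAlgebra.pairing_whiskerRight] at h₂
  refine h₂.trans (Eq.trans ?_ (congrArg δ.rotate h₁).symm)
  exact (congrArg h.extendPairing (δ.rotate_evaluation X)).symm.trans
    (h.rotate_extendPairing hA hε _).symm

end IsCrossing

end Pivotal

section Crossed

variable {k : Type w} [Field k] {G : Type*} [Group G]
    {C : Type u} [Category.{v} C] [Abelian C] [Linear k C] [MonoidalCategory C]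
    [MonoidalPreadditive C] [MonoidalLinear k C] [RigidCategory C]
    {γ : G → C ⥤ C} [MonoidalAction γ] {P : G → ObjectProperty C} {δ : PivotalStructure C}
    {A : EquivariantFrobeniusAlgebra γ} {s : ∀ X : C, X ⊗ A.alg.X ⟶ A.alg.X ⊗ X}
    {h : IsEquivariantCrossing A.toEquivariantAlgebra s} {m : h.functor.Monoidal}
    {η : ∀ g, γ g ⋙ h.functor ≅ h.functor ⋙ A.act g}

/-- `X ↦ A ⊗ X` is a `G`-crossed functor when the crossing also respects the counit of `A`. -/
lemma IsEquivariantCrossing.isGCrossedFunctor (hs : A.IsStandard m η) (hP : IsGrading P)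
    (hA : P 1 A.alg.X) (hsp : A.IsSpecial k) (hsy : A.IsSymmetric δ) [∀ X, Epi (s X)]
    (hε : ∀ X, s X ≫ ComonObj.counit (X := A.alg.X) ▷ X =
      X ◁ ComonObj.counit (X := A.alg.X) ≫ (ρ_ X).hom ≫ (λ_ X).inv)
    [RigidCategory (Bimod A.alg A.alg)]
    {δ' : PivotalStructure (Bimod A.alg A.alg)} (hδ' : A.IsInducedPivotal δ δ')
    [MonoidalAction A.act] (hact : A.IsInducedAction) :
    IsGCrossedFunctor k γ P δ A.act (A.grading P) δ' h.functor η := by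
  have ha : h.functor.Additive :=
    ⟨fun {X Y f g} => by ext; exact MonoidalPreadditive.whiskerLeft_add f g⟩
  have hex := exact_of_comp_forget (F := h.functor)
    (inferInstanceAs (tensorLeft A.alg.X).PreservesHomology)
  exact {
    additive := ha
    linear := ⟨fun {X Y} f c => by ext; exact MonoidalLinear.whiskerLeft_smul A.alg.X c f⟩
    left_exact := hex.1
    right_exact := hex.2
    faithful := ⟨fun {X Y f f'} e => by
      obtain ⟨c, hc₀, hc⟩ := hsp.2
      have e' : A.alg.X ◁ f = A.alg.X ◁ f' := congrArg Bimod.Hom.hom e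
      -- `f` is recovered from `A ◁ f`, up to the invertible scalar `ε ∘ η`.
      have key (t : X ⟶ Y) : MonObj.one (X := A.alg.X) ▷ X ≫ A.alg.X ◁ t ≫
          ComonObj.counit (X := A.alg.X) ▷ Y = c • 𝟙_ C ◁ t := by
        rw [whisker_exchange, ← comp_whiskerRight_assoc, hc, MonoidalLinear.smul_whiskerRight,
          Linear.smul_comp, id_whiskerRight, Category.id_comp]
      have e₁ := (key f).symm.trans ((congrArg (fun t => MonObj.one (X := A.alg.X) ▷ X ≫ t ≫
        ComonObj.counit (X := A.alg.X) ▷ Y) e').trans (key f'))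
      exact (MonoidalCategory.whiskerLeft_iff f f').1 (smul_right_injective _ hc₀ e₁)⟩
    η_isMonoidal := twist_isMonoidal (h := h) hs hact
    η_comp := η_comp (h := h) hs hact
    η_one := η_one (h := h) hs hact
    graded := fun g X hX => by
      have := hP.tensor hA hX
      rwa [one_mul] at this
    pivotal := IsCrossing.isPivotalFunctor hs hsy hε hδ'
  }

end Crossed

/-! ### The positive and the negative crossing -/

section Unit

variable {C : Type u} [Category.{v} C] [MonoidalCategory C] {A : C} {s : ∀ X : C, X ⊗ A ⟶ A ⊗ X}

/-- For an epimorphic crossing, compatibility with the unit object follows from compatibility with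
tensor products: applied to `𝟙 ⊗ 𝟙 ≅ 𝟙`, the latter makes `s 𝟙` an idempotent up to unitors. -/
lemma crossing_unit_of_epi (hn : ∀ {X Y : C} (f : X ⟶ Y), f ▷ A ≫ s Y = s X ≫ A ◁ f)
    (ht : ∀ X Y : C, s (X ⊗ Y) = (α_ X Y A).hom ≫ X ◁ s Y ≫ (α_ X A Y).inv ≫ s X ▷ Y ≫
      (α_ A X Y).hom) [Epi (s (𝟙_ C))] : s (𝟙_ C) = (λ_ A).hom ≫ (ρ_ A).inv := by
  have h₁ := hn (λ_ (𝟙_ C)).hom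
  rw [ht] at h₁
  have h₂ : s (𝟙_ C) ≫ (ρ_ A).hom ≫ (λ_ A).inv ≫ s (𝟙_ C) = s (𝟙_ C) ≫ 𝟙 _ := by
    calc _ = 𝟙 _ ⊗≫ (((α_ _ _ A).hom ≫ 𝟙_ C ◁ s (𝟙_ C) ≫ (α_ _ A _).inv ≫ s (𝟙_ C) ▷ 𝟙_ C ≫
          (α_ A _ _).hom) ≫ A ◁ (λ_ (𝟙_ C)).hom) := by monoidal
      _ = _ := by rw [← h₁]; monoidal
  rw [cancel_epi] at h₂
  rw [← cancel_epi (λ_ A).inv, ← cancel_epi (ρ_ A).hom, h₂]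
  simp

end Unit

section Counit

variable {k : Type w} [Field k] {G : Type*} [Group G]
    {C : Type u} [Category.{v} C] [Preadditive C] [Linear k C] [MonoidalCategory C]
    [MonoidalPreadditive C] [MonoidalLinear k C]
    {γ : G → C ⥤ C} [MonoidalAction γ] {A : EquivariantFrobeniusAlgebra γ}

/-- Since `ε ∘ η` is an invertible scalar, a crossing which is natural with respect to the
endomorphism `η ∘ ε` of `A` respects the counit. -/
lemma crossing_counit (hsp : A.IsSpecial k) {X : C} {s : X ⊗ A.alg.X ⟶ A.alg.X ⊗ X}
    (h₁ : X ◁ MonObj.one (X := A.alg.X) ≫ s =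
      (ρ_ X).hom ≫ (λ_ X).inv ≫ MonObj.one (X := A.alg.X) ▷ X)
    (h₂ : X ◁ (ComonObj.counit (X := A.alg.X) ≫ MonObj.one (X := A.alg.X)) ≫ s =
      s ≫ (ComonObj.counit (X := A.alg.X) ≫ MonObj.one (X := A.alg.X)) ▷ X) :
    s ≫ ComonObj.counit (X := A.alg.X) ▷ X =
      X ◁ ComonObj.counit (X := A.alg.X) ≫ (ρ_ X).hom ≫ (λ_ X).inv := by
  obtain ⟨c, hc₀, hc⟩ := hsp.2
  apply smul_right_injective _ hc₀
  have h₃ := congrArg (· ≫ ComonObj.counit (X := A.alg.X) ▷ X) h₂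
  simp only [Category.assoc, whiskerLeft_comp] at h₃
  rw [reassoc_of% h₁, ← comp_whiskerRight, ← comp_whiskerRight, Category.assoc, hc] at h₃
  simpa using h₃.symm

end Counit

section Homogeneous

variable {G : Type*} [Group G] {C : Type u} [Category.{v} C] [MonoidalCategory C]
  [Preadditive C] {P : G → ObjectProperty C}

/-- Morphisms out of `H(X)`, for an additive functor `H`, may be compared on the homogeneous
components of `X`. -/
lemma homogeneous_map_ext (hP : IsGrading P) {E : Type*} [Category* E] [Preadditive E]
    (H : C ⥤ E) [H.Additive] {X : C} {Z : E} {f f' : H.obj X ⟶ Z}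
    (h : ∀ (g : G) (X' : C) (_ : P g X') (i : X' ⟶ X), H.map i ≫ f = H.map i ≫ f') : f = f' := by
  obtain ⟨d⟩ := hP.decomposition X
  rw [← Category.id_comp f, ← Category.id_comp f', ← H.map_id, ← d.sum_π_ι, H.map_sum,
    Preadditive.sum_comp, Preadditive.sum_comp]
  refine Finset.sum_congr rfl fun g _ => ?_
  rw [H.map_comp, Category.assoc, Category.assoc, h g _ (d.homogeneous g) (d.ι g)]

end Homogeneous

namespace EquivariantAlgebra

variable {G : Type*} [Group G] {C : Type u} [Category.{v} C] [MonoidalCategory C]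
  {γ : G → C ⥤ C} [MonoidalAction γ] {P : G → ObjectProperty C}
  (A : EquivariantAlgebra γ) (b : GBraiding γ P)

/-- The multiplicativity of the braiding in its homogeneous variable, for the crossing with `A`. -/
lemma crossHom_tensor [Preadditive C] {g h k : G} (e : g * h = k) {X Y : C} (hX : P g X)
    (hY : P h Y) (hXY : P k (X ⊗ Y)) :
    A.crossHom b hXY = (α_ X Y A.alg.X).hom ≫ X ◁ A.crossHom b hY ≫ (α_ X A.alg.X Y).inv ≫
      A.crossHom b hX ▷ Y ≫ (α_ A.alg.X X Y).hom := by
  have h₁ := A.z_comp e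
  have h₂ := b.naturality_right hX (A.z h).hom
  rw [crossHom, crossHom, crossHom, b.tensor_left' e hX hY hXY]
  simp only [whiskerLeft_comp, comp_whiskerRight, Category.assoc]
  rw [associator_inv_naturality_middle_assoc, ← comp_whiskerRight_assoc (X ◁ (A.z h).hom), h₂,
    ← associator_naturality_left, ← comp_whiskerRight_assoc ((actComp γ e A.alg.X).hom ▷ X),
    ← comp_whiskerRight, h₁]
  simp only [comp_whiskerRight, Category.assoc]

lemma crossHom_equivariant {h k : G} (g : G) (e : k * g = g * h) {X : C} (hX : P h X)
    (hX' : P k ((γ g).obj X)) :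
    (γ g).obj X ◁ (A.z g).inv ≫ Functor.LaxMonoidal.μ (γ g) X A.alg.X ≫
        (γ g).map (A.crossHom b hX) =
      A.crossHom b hX' ≫ (A.z g).inv ▷ (γ g).obj X ≫ Functor.LaxMonoidal.μ (γ g) A.alg.X X := by
  have h₁ := b.naturality_right hX' (A.z g).hom
  have h₂ := b.equivariant e hX hX' A.alg.X
  have h₃ := A.z_comp e
  have h₄ := A.z_comp (g := g) (h := h) rfl
  rw [← cancel_epi ((γ g).obj X ◁ (A.z g).hom), whiskerLeft_hom_inv_assoc, crossHom, crossHom,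
    Category.assoc, reassoc_of% h₁, ← comp_whiskerRight_assoc ((γ k).map _), ← h₃,
    comp_whiskerRight_assoc, ← reassoc_of% h₂, ← comp_whiskerRight_assoc (actComp γ _ _).hom, h₄,
    comp_whiskerRight_assoc, hom_inv_whiskerRight_assoc, Functor.map_comp,
    Functor.LaxMonoidal.μ_natural_left, Functor.Monoidal.δ_μ_assoc]

/-- The crossing is natural with respect to equivariant endomorphisms of `A`. -/
lemma crossHom_endo {f : A.alg.X ⟶ A.alg.X}
    (hf : ∀ g, (γ g).map f ≫ (A.z g).hom = (A.z g).hom ≫ f) {g : G} {X : C} (hX : P g X) :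
    X ◁ f ≫ A.crossHom b hX = A.crossHom b hX ≫ f ▷ X := by
  rw [crossHom, reassoc_of% (b.naturality_right hX f), ← comp_whiskerRight, hf, comp_whiskerRight,
    Category.assoc]

instance {g : G} {X : C} (hX : P g X) : IsIso (A.crossHom b hX) := by
  unfold crossHom; infer_instance

section Positive

variable [Preadditive C] [MonoidalPreadditive C] (hP : IsGrading P)

lemma crossPos_tensor (X Y : C) :
    A.crossPos b hP (X ⊗ Y) = (α_ X Y A.alg.X).hom ≫ X ◁ A.crossPos b hP Y ≫
      (α_ X A.alg.X Y).inv ≫ A.crossPos b hP X ▷ Y ≫ (α_ A.alg.X X Y).hom := by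
  -- Both sides are compared on homogeneous components of `X` and of `Y`.
  refine homogeneous_map_ext hP (tensorRight Y ⋙ tensorRight A.alg.X) fun g X' hX i => ?_
  refine homogeneous_map_ext hP (tensorLeft X' ⋙ tensorRight A.alg.X) fun h Y' hY j => ?_
  have h₁ := A.crossPos_eq b hP (hP.tensor hX hY) (X' ◁ j ≫ i ▷ Y)
  have h₂ := A.crossPos_eq b hP hX i
  have h₃ := A.crossPos_eq b hP hY j
  change (X' ◁ j) ▷ A.alg.X ≫ i ▷ Y ▷ A.alg.X ≫ _ = (X' ◁ j) ▷ A.alg.X ≫ i ▷ Y ▷ A.alg.X ≫ _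
  rw [← comp_whiskerRight_assoc, h₁, A.crossHom_tensor b rfl hX hY]
  calc _ = 𝟙 _ ⊗≫ X' ◁ A.crossHom b hY ⊗≫ (A.crossHom b hX ▷ Y' ≫ (A.alg.X ⊗ X') ◁ j) ⊗≫
        (A.alg.X ◁ i) ▷ Y ⊗≫ 𝟙 _ := by monoidal
    _ = 𝟙 _ ⊗≫ X' ◁ (A.crossHom b hY ≫ A.alg.X ◁ j) ⊗≫
        (A.crossHom b hX ≫ A.alg.X ◁ i) ▷ Y ⊗≫ 𝟙 _ := by rw [← whisker_exchange]; monoidal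
    _ = 𝟙 _ ⊗≫ X' ◁ j ▷ A.alg.X ⊗≫ (X' ◁ A.crossPos b hP Y ≫ i ▷ (A.alg.X ⊗ Y)) ⊗≫
        A.crossPos b hP X ▷ Y ⊗≫ 𝟙 _ := by rw [← h₂, ← h₃]; monoidal
    _ = _ := by rw [whisker_exchange]; monoidal

instance (X : C) : Epi (A.crossPos b hP X) where
  left_cancellation f f' h := by
    refine homogeneous_map_ext hP (tensorLeft A.alg.X) fun g X' hX i => ?_
    change A.alg.X ◁ i ≫ f = A.alg.X ◁ i ≫ f'
    rw [← cancel_epi (A.crossHom b hX), ← reassoc_of% (A.crossPos_eq b hP hX i),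
      ← reassoc_of% (A.crossPos_eq b hP hX i), h]

lemma crossPos_endo {f : A.alg.X ⟶ A.alg.X}
    (hf : ∀ g, (γ g).map f ≫ (A.z g).hom = (A.z g).hom ≫ f) (X : C) :
    X ◁ f ≫ A.crossPos b hP X = A.crossPos b hP X ≫ f ▷ X := by
  refine homogeneous_ext hP fun g X' hX i => ?_
  have h₁ := A.crossPos_eq b hP hX i
  rw [← whisker_exchange_assoc, h₁, reassoc_of% h₁, reassoc_of% (A.crossHom_endo b hf hX),
    whisker_exchange]

lemma crossPos_isEquivariantCrossing (hγ : ∀ g, (γ g).Additive)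
    (hc : ∀ (g : G) {h : G} {X : C}, P h X → P (g * h * g⁻¹) ((γ g).obj X)) :
    IsEquivariantCrossing A (A.crossPos b hP) where
  one := A.crossPos_one b hP
  mul := A.crossPos_mul b hP
  natural := A.crossPos_natural b hP
  tensor := A.crossPos_tensor b hP
  unit := crossing_unit_of_epi (A.crossPos_natural b hP) (A.crossPos_tensor b hP)
  equivariant g X := by
    have := hγ g
    refine homogeneous_map_ext hP (γ g ⋙ tensorRight A.alg.X) fun h X' hX i => ?_
    have h₁ := A.crossPos_eq b hP (hc g hX) ((γ g).map i)
    have h₂ := A.crossHom_equivariant b g (by group) hX (hc g hX)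
    have h₃ := congrArg (γ g).map (A.crossPos_eq b hP hX i)
    rw [Functor.map_comp, Functor.map_comp] at h₃
    change (γ g).map i ▷ A.alg.X ≫ _ = (γ g).map i ▷ A.alg.X ≫ _
    rw [reassoc_of% h₁, ← whisker_exchange_assoc, Functor.LaxMonoidal.μ_natural_left_assoc, h₃,
      reassoc_of% h₂, whisker_exchange_assoc, Functor.LaxMonoidal.μ_natural_right]

end Positive

section Negative

variable (hA : P 1 A.alg.X)

/-- The isomorphism `γ(1)γ(g) ≅ γ(k)` expressed by `γ(g)γ(1) ≅ γ(k)`, where `k = g`. -/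
lemma actComp_one_left {g k : G} (e : 1 * g = k) (e' : g * 1 = k) (X : C) :
    (actComp γ e X).hom =
      (actOne γ ((γ g).obj X)).inv ≫ (γ g).map (actOne γ X).hom ≫ (actComp γ e' X).hom := by
  obtain rfl : g = k := by simpa using e
  have h₁ := MonoidalAction.one_comp (γ := γ) g X
  have h₂ := MonoidalAction.comp_one (γ := γ) g X
  rw [Iso.eq_inv_comp]
  exact h₁.trans h₂.symm

/-- The multiplicativity of the braiding in its second variable, for the crossing of `A` over
objects. -/
lemma crossOver_tensor (X Y : C) : (A.crossOver b hA (X ⊗ Y)).hom =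
    (α_ A.alg.X X Y).inv ≫ (A.crossOver b hA X).hom ▷ Y ≫ (α_ X A.alg.X Y).hom ≫
      X ◁ (A.crossOver b hA Y).hom ≫ (α_ X Y A.alg.X).inv := by
  have h₁ : Functor.LaxMonoidal.μ (γ 1) X Y ≫ (actOne γ (X ⊗ Y)).inv =
      (actOne γ X).inv ▷ (γ 1).obj Y ≫ X ◁ (actOne γ Y).inv := by
    rw [Iso.comp_inv_eq, actOne_tensor, MonoidalCategory.tensorHom_def']
    simp
  simp only [crossOver, Iso.trans_hom, whiskerRightIso_hom, Iso.symm_hom, b.tensor_right hA,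
    Category.assoc]
  rw [← comp_whiskerRight, h₁]
  calc _ = 𝟙 _ ⊗≫ (b.iso hA X).hom ▷ Y ⊗≫ ((γ 1).obj X ◁ (b.iso hA Y).hom ≫
        (actOne γ X).inv ▷ ((γ 1).obj Y ⊗ A.alg.X)) ⊗≫ X ◁ (actOne γ Y).inv ▷ A.alg.X ⊗≫ 𝟙 _ := by
        monoidal
    _ = _ := by rw [whisker_exchange]; monoidal

/-- The crossing of `A` over `X` is equivariant; both `A` and `γ(g)(A)` have degree `1`. -/
lemma crossOver_equivariant (g : G) (X : C) (hA' : P 1 ((γ g).obj A.alg.X)) :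
    (A.crossOver b hA ((γ g).obj X)).hom ≫ (γ g).obj X ◁ (A.z g).inv ≫
        Functor.LaxMonoidal.μ (γ g) X A.alg.X =
      (A.z g).inv ▷ (γ g).obj X ≫ Functor.LaxMonoidal.μ (γ g) A.alg.X X ≫
        (γ g).map (A.crossOver b hA X).hom := by
  have h₁ := b.equivariant (g := 1) (h := g) (k := 1) (by simp) hA hA' X
  have h₂ : Functor.LaxMonoidal.μ (γ g) A.alg.X X ≫ (γ g).map (b.iso hA X).hom =
      (b.iso hA' ((γ g).obj X)).hom ≫ (actOne γ ((γ g).obj X)).inv ▷ (γ g).obj A.alg.X ≫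
        (γ g).map (actOne γ X).hom ▷ (γ g).obj A.alg.X ≫ Functor.LaxMonoidal.μ (γ g) _ _ := by
    rw [actComp_one_left _ rfl] at h₁
    simp only [comp_whiskerRight, ← Category.assoc, cancel_mono] at h₁
    simp only [Category.assoc] at h₁
    rw [← reassoc_of% h₁, Functor.Monoidal.δ_μ, Category.comp_id]
  simp only [crossOver, Iso.trans_hom, whiskerRightIso_hom, Iso.symm_hom, Category.assoc,
    Functor.map_comp]
  rw [reassoc_of% h₂, ← Functor.LaxMonoidal.μ_natural_left, ← comp_whiskerRight_assoc ((γ g).map _),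
    ← Functor.map_comp, Iso.hom_inv_id]
  simp only [CategoryTheory.Functor.map_id, id_whiskerRight, Category.id_comp]
  rw [reassoc_of% (b.naturality_left hA hA' (A.z g).inv), whisker_exchange_assoc]

variable [Preadditive C]

lemma crossNeg_tensor (X Y : C) :
    A.crossNeg b hA (X ⊗ Y) = (α_ X Y A.alg.X).hom ≫ X ◁ A.crossNeg b hA Y ≫
      (α_ X A.alg.X Y).inv ≫ A.crossNeg b hA X ▷ Y ≫ (α_ A.alg.X X Y).hom := by
  rw [crossNeg_eq, crossNeg_eq, crossNeg_eq, ← cancel_epi (A.crossOver b hA (X ⊗ Y)).hom,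
    Iso.hom_inv_id, crossOver_tensor]
  simp

instance (X : C) : IsIso (A.crossNeg b hA X) := by rw [crossNeg_eq]; infer_instance

lemma crossNeg_isEquivariantCrossing (hP : IsGrading P) (hA' : ∀ g, P 1 ((γ g).obj A.alg.X)) :
    IsEquivariantCrossing A (A.crossNeg b hA) where
  one := A.crossNeg_one b hP hA
  mul := A.crossNeg_mul b hP hA
  natural := A.crossNeg_natural b hA
  tensor := A.crossNeg_tensor b hA
  unit := crossing_unit_of_epi (A.crossNeg_natural b hA) (A.crossNeg_tensor b hA)
  equivariant g X := by
    have h₁ := A.crossOver_equivariant b hA g X (hA' g)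
    rw [crossNeg_eq, crossNeg_eq, Iso.eq_inv_comp, reassoc_of% h₁, ← Functor.map_comp,
      Iso.hom_inv_id, CategoryTheory.Functor.map_id, Category.comp_id]

lemma crossNeg_endo (f : A.alg.X ⟶ A.alg.X) (X : C) :
    X ◁ f ≫ A.crossNeg b hA X = A.crossNeg b hA X ≫ f ▷ X := by
  rw [crossNeg_eq, Iso.comp_inv_eq, Category.assoc, Iso.eq_inv_comp]
  simp only [crossOver, Iso.trans_hom, whiskerRightIso_hom, Iso.symm_hom, Category.assoc]
  rw [reassoc_of% (b.naturality_left hA hA f X), whisker_exchange]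

end Negative

end EquivariantAlgebra

/-- The endomorphism `η ∘ ε` of `A` is equivariant. -/
lemma EquivariantFrobeniusAlgebra.z_counit_one {G : Type*} [Group G] {C : Type u} [Category.{v} C]
    [MonoidalCategory C] {γ : G → C ⥤ C} [MonoidalAction γ] (A : EquivariantFrobeniusAlgebra γ)
    (g : G) :
    (γ g).map (ComonObj.counit (X := A.alg.X) ≫ MonObj.one (X := A.alg.X)) ≫ (A.z g).hom =
      (A.z g).hom ≫ ComonObj.counit (X := A.alg.X) ≫ MonObj.one (X := A.alg.X) := by
  have h : Functor.OplaxMonoidal.η (γ g) ≫ MonObj.one (X := A.alg.X) =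
      (γ g).map (MonObj.one (X := A.alg.X)) ≫ (A.z g).hom := by
    conv_lhs => rw [← A.one_z g, Functor.Monoidal.η_ε_assoc]
  rw [reassoc_of% (A.z_counit g), h, Functor.map_comp, Category.assoc]

end EquivariantTensor

theorem mainTheorem6 {k : Type w} [Field k] {G : Type*} [Group G]
    {C : Type u} [Category.{v} C] [Abelian C] [Linear k C] [MonoidalCategory C]
    [MonoidalPreadditive C] [MonoidalLinear k C] [RigidCategory C]
    (γ : G → C ⥤ C) [MonoidalAction γ] (P : G → ObjectProperty C) (δ : PivotalStructure C)
    (hC : IsGCrossed k γ P δ) (b : GBraiding γ P)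
    (A : EquivariantFrobeniusAlgebra γ) (hA : P 1 A.alg.X) (hspecial : A.IsSpecial k)
    (hsymm : A.IsSymmetric δ) :
    ∃ (_ : RigidCategory (Bimod A.alg A.alg)) (_ : MonoidalAction A.act)
      (δ' : PivotalStructure (Bimod A.alg A.alg)),
      A.IsInducedAction ∧ A.IsInducedPivotal δ δ' ∧
      IsGCrossed k A.act (A.grading P) δ' ∧
      (∃ (m : (A.alphaPos b hC.grading).Monoidal)
        (η : ∀ g, γ g ⋙ A.alphaPos b hC.grading ≅ A.alphaPos b hC.grading ⋙ A.act g),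
        A.IsStandard m η ∧
        IsGCrossedFunctor k γ P δ A.act (A.grading P) δ' (A.alphaPos b hC.grading) η) ∧
      (∃ (m : (A.alphaNeg b hC.grading hA).Monoidal)
        (η : ∀ g, γ g ⋙ A.alphaNeg b hC.grading hA ≅ A.alphaNeg b hC.grading hA ⋙ A.act g),
        A.IsStandard m η ∧
        IsGCrossedFunctor k γ P δ A.act (A.grading P) δ' (A.alphaNeg b hC.grading hA) η) := by
  obtain ⟨c, hc₀, hc⟩ := hspecial.1
  let := A.bimodRigid hc₀ hc hsymm
  let := A.bimodAction
  have hδ' : A.IsInducedPivotal δ (A.bimodPivotal hc₀ hc hsymm) :=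
    fun M => A.realizes_pivotalIso hc₀ hc hsymm M
  have hact : A.IsInducedAction := A.isInducedAction
  have hA' (g : G) : P 1 ((γ g).obj A.alg.X) :=
    hC.grading.iso_closed 1 (A.z g).symm hA
  refine ⟨_, _, A.bimodPivotal hc₀ hc hsymm, hact, hδ', A.isGCrossed hC hA hδ' hact, ?_, ?_⟩
  · have h := A.crossPos_isEquivariantCrossing b hC.grading hC.additive hC.conj
    obtain ⟨m, η, hs⟩ := h.exists_isStandard
    exact ⟨m, η, hs, h.isGCrossedFunctor hs hC.grading hA hspecial hsymm
      (fun X => crossing_counit hspecial (h.one X) (A.crossPos_endo b hC.grading A.z_counit_one X))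
      hδ' hact⟩
  · have h := A.crossNeg_isEquivariantCrossing b hA hC.grading hA'
    obtain ⟨m, η, hs⟩ := h.exists_isStandard
    exact ⟨m, η, hs, h.isGCrossedFunctor hs hC.grading hA hspecial hsymm
      (fun X => crossing_counit hspecial (h.one X) (A.crossNeg_endo b hA _ X)) hδ' hact⟩
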